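/- Consider finite simple undirected graphs and the following two reductions of a graph $G$. - **D3a.** Let $p,q,r$ be three vertices of degree three that induce a triangle in $G$ and whose neighbors outside $\{p,q,r\}$ are all distinct. Replace $p,q,r$ by a single new vertex adjacent to the same three outside neighbors. - **D3b.** Let $p,q,r$ be three vertices of degree three that induce a path in $G$ with middle vertex $q$, and suppose that there is a vertex $s$ adjacent to all three of $p,q,r$. Delete $q$ and add the edge $pr$. A graph is *D3-reducible* if some (possibly empty) sequence of these reductions transforms it into a graph isomorphic to the complete graph $K_4$. **Theorem.** D3-reducible graphs can be recognized in linear time: there are a program for a random access machine (with unit-cost operations on words) and a constant $c$ such that, for every graph $G$ with vertex set $\{0,\dots,n-1\}$ and $m$ edges, given by adjacency lists (with each list in arbitrary order, and all lists stored consecutively in memory after $n$ and a table of their start addresses, so that the input consists of $N = n+2+2m$ words), the program halts after at most $c\,(n+1)$ time units, with output $1$ if $G$ is D3-reducible and output $0$ if it is not. The program works on every machine whose words can hold all natural numbers less than $cN$; thus words of $O(\log N)$ bits suffice. -/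

import Mathlib

/-! ### D3 reductions -/

namespace D3

/-- `v` has degree three. -/
def DegThree {V : Type} (G : SimpleGraph V) (v : V) : Prop :=
  (G.neighborSet v).ncard = 3

/-- The precondition of rule D3a: `p`, `q`, `r` are degree-three vertices that induce a triangle
and whose neighbors outside `{p, q, r}` are all distinct. -/
structure CanA {V : Type} (G : SimpleGraph V) (p q r : V) : Prop where
  deg_p : DegThree G p
  deg_q : DegThree G q
  deg_r : DegThree G r
  adj_pq : G.Adj p q
  adj_qr : G.Adj q r
  adj_pr : G.Adj p r
  distinct_pq : Disjoint (G.neighborSet p \ {p, q, r}) (G.neighborSet q \ {p, q, r})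
  distinct_qr : Disjoint (G.neighborSet q \ {p, q, r}) (G.neighborSet r \ {p, q, r})
  distinct_pr : Disjoint (G.neighborSet p \ {p, q, r}) (G.neighborSet r \ {p, q, r})

/-- Adjacency after rule D3a; `none` is the new vertex that replaces `p`, `q`, `r`. -/
def adjA {V : Type} (G : SimpleGraph V) (p q r : V) :
    Option {v : V // v ≠ p ∧ v ≠ q ∧ v ≠ r} → Option {v : V // v ≠ p ∧ v ≠ q ∧ v ≠ r} → Prop
  | none, none => False
  | none, some v => G.Adj p v ∨ G.Adj q v ∨ G.Adj r v
  | some u, none => G.Adj p u ∨ G.Adj q u ∨ G.Adj r u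
  | some u, some v => G.Adj u v

/-- The result of rule D3a: `p`, `q`, `r` are replaced by a single new vertex with the same
outside neighbors. -/
def resultA {V : Type} (G : SimpleGraph V) (p q r : V) :
    SimpleGraph (Option {v : V // v ≠ p ∧ v ≠ q ∧ v ≠ r}) where
  Adj := adjA G p q r
  symm := ⟨by
    rintro (_ | u) (_ | v) h
    · exact h
    · exact h
    · exact h
    · exact G.adj_symm h⟩
  loopless := ⟨by
    rintro (_ | u) h
    · exact h
    · exact G.irrefl h⟩

/-- The precondition of rule D3b: `p`, `q`, `r` are degree-three vertices that induce a path with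
middle vertex `q`, and some vertex `s` (the apex) is adjacent to all three of them. -/
structure CanB {V : Type} (G : SimpleGraph V) (p q r : V) : Prop where
  deg_p : DegThree G p
  deg_q : DegThree G q
  deg_r : DegThree G r
  adj_pq : G.Adj p q
  adj_qr : G.Adj q r
  ne_pr : p ≠ r
  not_adj_pr : ¬ G.Adj p r
  apex : ∃ s : V, G.Adj s p ∧ G.Adj s q ∧ G.Adj s r

/-- The result of rule D3b: `q` is deleted and the edge `pr` is added. -/
def resultB {V : Type} (G : SimpleGraph V) (p q r : V) : SimpleGraph {v : V // v ≠ q} :=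
  (G ⊔ SimpleGraph.edge p r).induce {v : V | v ≠ q}

/-- A graph together with its vertex set. -/
abbrev Graph : Type 1 := Σ V : Type, SimpleGraph V

/-- One D3 reduction. -/
inductive Step : Graph → Graph → Prop
  | d3a {V : Type} (G : SimpleGraph V) (p q r : V) (h : CanA G p q r) :
      Step ⟨V, G⟩ ⟨_, resultA G p q r⟩
  | d3b {V : Type} (G : SimpleGraph V) (p q r : V) (h : CanB G p q r) :
      Step ⟨V, G⟩ ⟨_, resultB G p q r⟩

/-- A graph is D3-reducible if some (possibly empty) sequence of D3 reductions turns it into a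
complete graph on four vertices. -/
def Reducible {V : Type} (G : SimpleGraph V) : Prop :=
  ∃ H : Graph, Relation.ReflTransGen Step ⟨V, G⟩ H ∧
    Nonempty (H.2 ≃g (⊤ : SimpleGraph (Fin 4)))

end D3

/-! ### A random access machine with unit-cost operations on bounded words -/

namespace RAM

/-- A memory state: registers `0, 1, 2, …` (a program mentions finitely many of them) and a random
access memory. -/
structure State where
  reg : ℕ → ℕ
  mem : ℕ → ℕ

/-- Expressions. `load a` reads the memory cell with address `a`; `sub` is truncated subtraction;
`lt` and `eq` return `1` for true and `0` for false. -/
inductive Expr : Type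
  | const (k : ℕ)
  | reg (i : ℕ)
  | load (a : Expr)
  | add (a b : Expr)
  | sub (a b : Expr)
  | lt (a b : Expr)
  | eq (a b : Expr)

/-- The value of an expression. -/
def Expr.val (σ : State) : Expr → ℕ
  | const k => k
  | reg i => σ.reg i
  | load a => σ.mem (a.val σ)
  | add a b => a.val σ + b.val σ
  | sub a b => a.val σ - b.val σ
  | lt a b => if a.val σ < b.val σ then 1 else 0
  | eq a b => if a.val σ = b.val σ then 1 else 0

/-- All values (addresses included) that occur in the evaluation of the expression fit in a machine
word, i.e. are less than `W`. -/
def Expr.Fits (W : ℕ) (σ : State) : Expr → Prop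
  | const k => k < W
  | reg i => σ.reg i < W
  | load a => a.Fits W σ ∧ σ.mem (a.val σ) < W
  | add a b => a.Fits W σ ∧ b.Fits W σ ∧ a.val σ + b.val σ < W
  | sub a b => a.Fits W σ ∧ b.Fits W σ
  | lt a b => a.Fits W σ ∧ b.Fits W σ ∧ 1 < W
  | eq a b => a.Fits W σ ∧ b.Fits W σ ∧ 1 < W

/-- The time to evaluate an expression: one unit per operation. -/
def Expr.cost : Expr → ℕ
  | const _ => 1
  | reg _ => 1
  | load a => a.cost + 1
  | add a b => a.cost + b.cost + 1
  | sub a b => a.cost + b.cost + 1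
  | lt a b => a.cost + b.cost + 1
  | eq a b => a.cost + b.cost + 1

/-- Programs. Conditions are true when their value is nonzero. -/
inductive Prog : Type
  /-- do nothing -/
  | skip
  /-- register `i` receives the value of `e` -/
  | assign (i : ℕ) (e : Expr)
  /-- the memory cell with address `a` receives the value of `e` -/
  | store (a e : Expr)
  /-- sequential composition -/
  | seq (c d : Prog)
  /-- if `e` then `c` else `d` -/
  | cond (e : Expr) (c d : Prog)
  /-- while `e` do `c` -/
  | loop (e : Expr) (c : Prog)

/-- `Exec W c σ t τ`: on a machine whose words hold the numbers less than `W`, the program `c`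
started in state `σ` halts in state `τ` after exactly `t` time units. A program that tries to
compute a value that does not fit in a word fails, i.e. has no halting run. -/
inductive Exec (W : ℕ) : Prog → State → ℕ → State → Prop
  | skip (σ : State) : Exec W .skip σ 1 σ
  | assign (i : ℕ) (e : Expr) (σ : State) (he : e.Fits W σ) :
      Exec W (.assign i e) σ (e.cost + 1) { σ with reg := Function.update σ.reg i (e.val σ) }
  | store (a e : Expr) (σ : State) (ha : a.Fits W σ) (he : e.Fits W σ) :
      Exec W (.store a e) σ (a.cost + e.cost + 1)
        { σ with mem := Function.update σ.mem (a.val σ) (e.val σ) }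
  | seq {c d : Prog} {σ τ υ : State} {t u : ℕ} (hc : Exec W c σ t τ) (hd : Exec W d τ u υ) :
      Exec W (.seq c d) σ (t + u) υ
  | cond_true {e : Expr} {c d : Prog} {σ τ : State} {t : ℕ} (he : e.Fits W σ)
      (h : e.val σ ≠ 0) (hc : Exec W c σ t τ) :
      Exec W (.cond e c d) σ (e.cost + 1 + t) τ
  | cond_false {e : Expr} {c d : Prog} {σ τ : State} {t : ℕ} (he : e.Fits W σ)
      (h : e.val σ = 0) (hd : Exec W d σ t τ) :
      Exec W (.cond e c d) σ (e.cost + 1 + t) τ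
  | loop_true {e : Expr} {c : Prog} {σ τ υ : State} {t u : ℕ} (he : e.Fits W σ)
      (h : e.val σ ≠ 0) (hc : Exec W c σ t τ) (hl : Exec W (.loop e c) τ u υ) :
      Exec W (.loop e c) σ (e.cost + 1 + t + u) υ
  | loop_false {e : Expr} {c : Prog} {σ : State} (he : e.Fits W σ) (h : e.val σ = 0) :
      Exec W (.loop e c) σ (e.cost + 1) σ

/-- The machine is deterministic: final state and running time are determined by the program and
the initial state. -/
theorem Exec.deterministic {W : ℕ} {c : Prog} {σ τ τ' : State} {t t' : ℕ}
    (h : Exec W c σ t τ) (h' : Exec W c σ t' τ') : t = t' ∧ τ = τ' := by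
  induction h generalizing t' τ' with
  | skip => cases h'; exact ⟨rfl, rfl⟩
  | assign => cases h'; exact ⟨rfl, rfl⟩
  | store => cases h'; exact ⟨rfl, rfl⟩
  | seq _ _ ih₁ ih₂ =>
    cases h' with
    | seq h₁ h₂ =>
      obtain ⟨rfl, rfl⟩ := ih₁ h₁
      obtain ⟨rfl, rfl⟩ := ih₂ h₂
      exact ⟨rfl, rfl⟩
  | cond_true _ h _ ih =>
    cases h' with
    | cond_true _ _ h₁ =>
      obtain ⟨rfl, rfl⟩ := ih h₁
      exact ⟨rfl, rfl⟩
    | cond_false _ h₀ _ => exact absurd h₀ h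
  | cond_false _ h _ ih =>
    cases h' with
    | cond_true _ h₀ _ => exact absurd h h₀
    | cond_false _ _ h₁ =>
      obtain ⟨rfl, rfl⟩ := ih h₁
      exact ⟨rfl, rfl⟩
  | loop_true _ h _ _ ih₁ ih₂ =>
    cases h' with
    | loop_true _ _ h₁ h₂ =>
      obtain ⟨rfl, rfl⟩ := ih₁ h₁
      obtain ⟨rfl, rfl⟩ := ih₂ h₂
      exact ⟨rfl, rfl⟩
    | loop_false _ h₀ => exact absurd h₀ h
  | loop_false _ h =>
    cases h' with
    | loop_true _ h₀ _ _ => exact absurd h h₀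
    | loop_false => exact ⟨rfl, rfl⟩

/-- The initial state on an input: the input occupies the memory cells from address `0` on, all
other cells and all registers are `0`. -/
def init (input : List ℕ) : State where
  reg := fun _ => 0
  mem := fun a => input.getD a 0

end RAM

/-! ### Adjacency lists -/

namespace AdjList

/-- `L v` lists the neighbors of `v`, each of them once, in an arbitrary order. -/
def Represents {n : ℕ} (L : Fin n → List (Fin n)) (G : SimpleGraph (Fin n)) : Prop :=
  ∀ v, (L v).Nodup ∧ ∀ w, w ∈ L v ↔ G.Adj v w

/-- The address at which the list of vertex `v` starts in `encode L`, and at which the list of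
vertex `v - 1` ends. -/
def start {n : ℕ} (L : Fin n → List (Fin n)) (v : ℕ) : ℕ :=
  n + 2 + ((List.ofFn L).take v).flatten.length

/-- Adjacency lists as a sequence of words: the number `n` of vertices, the `n + 1` addresses
`start L 0, …, start L n`, and the lists of the vertices `0, …, n - 1` one after the other. -/
def encode {n : ℕ} (L : Fin n → List (Fin n)) : List ℕ :=
  n :: ((List.range (n + 1)).map (start L) ++ (List.ofFn L).flatten.map Fin.val)

end AdjList

/-!
The reductions are confluent up to isomorphism, so `G` is D3-reducible if and only if reducing it
greedily ends in `K₄`. A reducible graph with `n` vertices has degree sum at most `4 n`, so denser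
inputs are rejected after summing the degrees, and afterwards linear time in `n + m` is linear time
in `n`. The candidates for a reduction are kept on a stack: a reduction changes the graph near a
bounded number of vertices of degree three, which are pushed again, and it deletes a vertex, so the
stack receives `O(n)` entries in total.

To decide in constant time whether a reduction applies at a vertex, the machine knows the three
neighbors of every vertex of degree three. It never stores longer adjacency lists: for every vertex
it maintains only the degree and the sum of the neighbors modulo `n`. When the degree of a vertex
drops to three, the reduction exhibits two of the remaining neighbors, and the sum gives the third.
-/

namespace D3

variable {V V' : Type} {f : V' → V} {H : SimpleGraph V'} {G : SimpleGraph V}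

/-- `u`, `v` and `w` are all the neighbors of `x` (with possible repetitions). -/
def HasNeighbors (G : SimpleGraph V) (x u v w : V) : Prop :=
  ∀ y, G.Adj x y ↔ y = u ∨ y = v ∨ y = w

theorem DegThree.exists_third {v a b : V} (h : DegThree G v)
    (ha : G.Adj v a) (hb : G.Adj v b) (hab : a ≠ b) :
    ∃ c, c ≠ a ∧ c ≠ b ∧ HasNeighbors G v a b c := by
  have hsub : ({a, b} : Set V) ⊆ G.neighborSet v := by
    rintro x (rfl | rfl) <;> assumption
  have hcard : (G.neighborSet v \ {a, b}).ncard = 1 := by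
    rw [Set.ncard_sdiff hsub (Set.toFinite _), Set.ncard_pair hab, h]
  obtain ⟨c, hc⟩ := Set.ncard_eq_one.1 hcard
  have hc' (w : V) : (G.Adj v w ∧ ¬ (w = a ∨ w = b)) ↔ w = c := by
    simpa using Set.ext_iff.1 hc w
  exact ⟨c, by grind, by grind, fun w => by grind⟩

theorem HasNeighbors.degThree {v a b c : V} (h : HasNeighbors G v a b c)
    (hab : a ≠ b) (hac : a ≠ c) (hbc : b ≠ c) : DegThree G v :=
  Set.ncard_eq_three.2 ⟨a, b, c, hab, hac, hbc, Set.ext h⟩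

/-- `p`, `q`, `r` satisfy the precondition of rule D3a (see `CanA.exists_configA` and
`ConfigA.canA`), and `p'`, `q'`, `r'` are their respective neighbors outside the triangle. -/
structure ConfigA (G : SimpleGraph V) (p q r p' q' r' : V) : Prop where
  nbrs_p : HasNeighbors G p q r p'
  nbrs_q : HasNeighbors G q p r q'
  nbrs_r : HasNeighbors G r p q r'
  ne_pq : p ≠ q
  ne_pr : p ≠ r
  ne_qr : q ≠ r
  outside_p : p' ≠ p ∧ p' ≠ q ∧ p' ≠ r
  outside_q : q' ≠ p ∧ q' ≠ q ∧ q' ≠ r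
  outside_r : r' ≠ p ∧ r' ≠ q ∧ r' ≠ r
  ne_pq' : p' ≠ q'
  ne_pr' : p' ≠ r'
  ne_qr' : q' ≠ r'

section Config

variable {p q r s p' q' r' : V}

theorem ConfigA.swap_qr (h : ConfigA G p q r p' q' r') : ConfigA G p r q p' r' q' := by
  cases h
  constructor <;> grind [HasNeighbors]

theorem ConfigA.swap_pq (h : ConfigA G p q r p' q' r') : ConfigA G q p r q' p' r' := by
  cases h
  constructor <;> grind [HasNeighbors]

/-- `p`, `q`, `r` satisfy the precondition of rule D3b with apex `s` (see `CanB.exists_configB` and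
`ConfigB.canB`), and `p'` and `r'` are the remaining neighbors of `p` and `r`. -/
structure ConfigB (G : SimpleGraph V) (p q r s p' r' : V) : Prop where
  nbrs_p : HasNeighbors G p q s p'
  nbrs_q : HasNeighbors G q p r s
  nbrs_r : HasNeighbors G r q s r'
  ne_pq : p ≠ q
  ne_pr : p ≠ r
  ne_qr : q ≠ r
  apex_ne : s ≠ p ∧ s ≠ q ∧ s ≠ r
  outside_p : p' ≠ p ∧ p' ≠ q ∧ p' ≠ r ∧ p' ≠ s
  outside_r : r' ≠ p ∧ r' ≠ q ∧ r' ≠ r ∧ r' ≠ s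

theorem ConfigB.swap (h : ConfigB G p q r s p' r') : ConfigB G r q p s r' p' := by
  cases h
  constructor <;> grind [HasNeighbors]

theorem CanA.exists_configA (h : CanA G p q r) : ∃ p' q' r', ConfigA G p q r p' q' r' := by
  obtain ⟨p', _, _, np⟩ := h.deg_p.exists_third h.adj_pq h.adj_pr h.adj_qr.ne
  obtain ⟨q', _, _, nq⟩ := h.deg_q.exists_third h.adj_pq.symm h.adj_qr h.adj_pr.ne
  obtain ⟨r', _, _, nr⟩ := h.deg_r.exists_third h.adj_pr.symm h.adj_qr.symm h.adj_pq.ne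
  have hp : p' ≠ p := ((np p').2 (by simp)).ne'
  have hq : q' ≠ q := ((nq q').2 (by simp)).ne'
  have hr : r' ≠ r := ((nr r').2 (by simp)).ne'
  have dpq := Set.disjoint_left.1 h.distinct_pq
  have dqr := Set.disjoint_left.1 h.distinct_qr
  have dpr := Set.disjoint_left.1 h.distinct_pr
  specialize @dpq p'
  specialize @dqr q'
  specialize @dpr p'
  simp only [Set.mem_sdiff, SimpleGraph.mem_neighborSet, Set.mem_insert_iff,
    Set.mem_singleton_iff, np _, nq _, nr _] at dpq dqr dpr
  refine ⟨p', q', r', np, nq, nr, h.adj_pq.ne, h.adj_pr.ne, h.adj_qr.ne, ?_, ?_, ?_, ?_, ?_, ?_⟩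
    <;> grind

theorem ConfigA.canA (h : ConfigA G p q r p' q' r') : CanA G p q r := by
  obtain ⟨np, nq, nr, pq, pr, qr, pp, qq, rr, _, _, _⟩ := h
  refine ⟨np.degThree qr pp.2.1.symm pp.2.2.symm, nq.degThree pr qq.1.symm qq.2.2.symm,
    nr.degThree pq rr.1.symm rr.2.1.symm, (np _).2 (by simp), (nq _).2 (by simp),
    (np _).2 (by simp), ?_, ?_, ?_⟩ <;>
  · simp only [Set.disjoint_left, Set.mem_sdiff, SimpleGraph.mem_neighborSet, Set.mem_insert_iff,
      Set.mem_singleton_iff, np _, nq _, nr _]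
    grind

theorem CanB.exists_configB (h : CanB G p q r) : ∃ s p' r', ConfigB G p q r s p' r' := by
  obtain ⟨s, sp, sq, sr⟩ := h.apex
  obtain ⟨t, _, _, nq⟩ := h.deg_q.exists_third h.adj_pq.symm h.adj_qr h.ne_pr
  obtain rfl : s = t := by
    have := (nq s).1 sq.symm
    have := sp.ne
    have := sr.ne
    grind
  obtain ⟨p', _, _, np⟩ := h.deg_p.exists_third h.adj_pq sp.symm sq.ne'
  obtain ⟨r', _, _, nr⟩ := h.deg_r.exists_third h.adj_qr.symm sr.symm sq.ne'
  have hp : p' ≠ p := ((np p').2 (by simp)).ne'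
  have hr : r' ≠ r := ((nr r').2 (by simp)).ne'
  have hpr := h.not_adj_pr
  have hrp : ¬ G.Adj r p := fun e => hpr e.symm
  rw [np] at hpr
  rw [nr] at hrp
  exact ⟨s, p', r', np, nq, nr, h.adj_pq.ne, h.ne_pr, h.adj_qr.ne, ⟨sp.ne, sq.ne, sr.ne⟩,
    by grind, by grind⟩

theorem ConfigB.canB (h : ConfigB G p q r s p' r') : CanB G p q r := by
  obtain ⟨np, nq, nr, _, pr, _, ss, pp, rr⟩ := h
  refine ⟨np.degThree ss.2.1.symm pp.2.1.symm pp.2.2.2.symm,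
    nq.degThree pr ss.1.symm ss.2.2.symm, nr.degThree ss.2.1.symm rr.2.1.symm rr.2.2.2.symm,
    (np _).2 (by simp), (nq _).2 (by simp), pr, ?_, s, ((np s).2 (by simp)).symm,
    ((nq s).2 (by simp)).symm, ((nr s).2 (by simp)).symm⟩
  rw [np]
  grind

end Config

/-- Rule D3a on a fixed vertex type: `p` becomes the new vertex, and `q` and `r` become isolated
instead of being deleted. -/
def reduceA (G : SimpleGraph V) (p q r : V) : SimpleGraph V where
  Adj u v := u ≠ v ∧ u ≠ q ∧ u ≠ r ∧ v ≠ q ∧ v ≠ r ∧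
    (G.Adj u v ∨ (u = p ∧ (G.Adj q v ∨ G.Adj r v)) ∨ (v = p ∧ (G.Adj q u ∨ G.Adj r u)))
  symm := ⟨fun u v h => by grind [G.adj_comm u v]⟩
  loopless := ⟨fun _ h => h.1 rfl⟩

/-- Rule D3b on a fixed vertex type: `q` becomes isolated instead of being deleted. -/
def reduceB (G : SimpleGraph V) (p q r : V) : SimpleGraph V where
  Adj u v := u ≠ v ∧ u ≠ q ∧ v ≠ q ∧ (G.Adj u v ∨ (u = p ∧ v = r) ∨ (u = r ∧ v = p))
  symm := ⟨fun u v h => by grind [G.adj_comm u v]⟩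
  loopless := ⟨fun _ h => h.1 rfl⟩

theorem reduceA_adj {p q r u v : V} : (reduceA G p q r).Adj u v ↔
    u ≠ v ∧ u ≠ q ∧ u ≠ r ∧ v ≠ q ∧ v ≠ r ∧
    (G.Adj u v ∨ (u = p ∧ (G.Adj q v ∨ G.Adj r v)) ∨ (v = p ∧ (G.Adj q u ∨ G.Adj r u))) :=
  Iff.rfl

theorem reduceB_adj {p q r u v : V} : (reduceB G p q r).Adj u v ↔
    u ≠ v ∧ u ≠ q ∧ v ≠ q ∧ (G.Adj u v ∨ (u = p ∧ v = r) ∨ (u = r ∧ v = p)) :=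
  Iff.rfl

theorem reduceA_swap_qr (G : SimpleGraph V) (p q r : V) : reduceA G p r q = reduceA G p q r := by
  ext u v
  simp only [reduceA_adj]
  tauto

theorem reduceB_swap (G : SimpleGraph V) (p q r : V) : reduceB G r q p = reduceB G p q r := by
  ext u v
  simp only [reduceB_adj]
  tauto

/-- `f` embeds `H` into `G`, and all vertices of `G` outside the image are isolated. It relates a
graph to its copy on a larger vertex type, where deleted vertices live on as isolated ones. -/
structure IsSupportEmbedding (f : V' → V) (H : SimpleGraph V') (G : SimpleGraph V) : Prop where
  injective : Function.Injective f
  adj_iff : ∀ u v, G.Adj (f u) (f v) ↔ H.Adj u v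
  mem_range : ∀ {u v}, G.Adj u v → ∃ u', f u' = u

theorem isSupportEmbedding_map (f : V' ↪ V) (H : SimpleGraph V') :
    IsSupportEmbedding f H (H.map f) where
  injective := f.injective
  adj_iff _ _ := SimpleGraph.map_adj_apply
  mem_range h := by
    obtain ⟨u, _, -, rfl, -⟩ := (SimpleGraph.map_adj _ _ _ _).1 h
    exact ⟨u, rfl⟩

namespace IsSupportEmbedding

theorem of_iso {H : SimpleGraph V'} {G : SimpleGraph V} (e : H ≃g G) :
    IsSupportEmbedding e H G where
  injective := e.injective
  adj_iff _ _ := e.map_adj_iff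
  mem_range _ := e.surjective _

theorem comp {V'' : Type} {g : V'' → V'} {K : SimpleGraph V''} (hf : IsSupportEmbedding f H G)
    (hg : IsSupportEmbedding g K H) : IsSupportEmbedding (f ∘ g) K G where
  injective := hf.injective.comp hg.injective
  adj_iff u v := by simp only [Function.comp_apply, hf.adj_iff, hg.adj_iff]
  mem_range {u v} h := by
    obtain ⟨u, rfl⟩ := hf.mem_range h
    obtain ⟨v, rfl⟩ := hf.mem_range h.symm
    obtain ⟨u, rfl⟩ := hg.mem_range ((hf.adj_iff _ _).1 h)
    exact ⟨u, rfl⟩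

theorem hasNeighbors_iff (hf : IsSupportEmbedding f H G) {v a b c : V'} :
    HasNeighbors G (f v) (f a) (f b) (f c) ↔ HasNeighbors H v a b c := by
  refine ⟨fun h w => ?_, fun h w => ⟨fun hw => ?_, ?_⟩⟩
  · rw [← hf.adj_iff, h, hf.injective.eq_iff, hf.injective.eq_iff, hf.injective.eq_iff]
  · obtain ⟨w, rfl⟩ := hf.mem_range hw.symm
    rwa [hf.adj_iff, h, ← hf.injective.eq_iff, ← hf.injective.eq_iff (b := b),
      ← hf.injective.eq_iff (b := c)] at hw
  · rintro (rfl | rfl | rfl) <;> rw [hf.adj_iff, h] <;> simp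

theorem configA_iff (hf : IsSupportEmbedding f H G) {p q r p' q' r' : V'} :
    ConfigA G (f p) (f q) (f r) (f p') (f q') (f r') ↔ ConfigA H p q r p' q' r' := by
  have hne (a b : V') : f a ≠ f b ↔ a ≠ b := hf.injective.ne_iff
  constructor <;> rintro ⟨np, nq, nr, _, _, _, _, _, _, _, _, _⟩ <;>
    constructor <;> simp_all only [hf.hasNeighbors_iff, and_self, ne_eq, not_false_eq_true]

theorem configB_iff (hf : IsSupportEmbedding f H G) {p q r s p' r' : V'} :
    ConfigB G (f p) (f q) (f r) (f s) (f p') (f r') ↔ ConfigB H p q r s p' r' := by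
  have hne (a b : V') : f a ≠ f b ↔ a ≠ b := hf.injective.ne_iff
  constructor <;> rintro ⟨np, nq, nr, _, _, _, _, _, _⟩ <;>
    constructor <;> simp_all only [hf.hasNeighbors_iff, and_self, ne_eq, not_false_eq_true]

theorem canA (hf : IsSupportEmbedding f H G) {p q r : V'} (h : CanA H p q r) :
    CanA G (f p) (f q) (f r) := by
  obtain ⟨_, _, _, h⟩ := h.exists_configA
  exact (hf.configA_iff.2 h).canA

theorem canB (hf : IsSupportEmbedding f H G) {p q r : V'} (h : CanB H p q r) :
    CanB G (f p) (f q) (f r) := by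
  obtain ⟨_, _, _, h⟩ := h.exists_configB
  exact (hf.configB_iff.2 h).canB

theorem exists_canA (hf : IsSupportEmbedding f H G) {p q r : V} (h : CanA G p q r) :
    ∃ p₀ q₀ r₀, f p₀ = p ∧ f q₀ = q ∧ f r₀ = r ∧ CanA H p₀ q₀ r₀ := by
  obtain ⟨p', q', r', h⟩ := h.exists_configA
  obtain ⟨p, rfl⟩ := hf.mem_range ((h.nbrs_p q).2 (by simp))
  obtain ⟨q, rfl⟩ := hf.mem_range ((h.nbrs_q r).2 (by simp))
  obtain ⟨r, rfl⟩ := hf.mem_range ((h.nbrs_r r').2 (by simp))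
  obtain ⟨p', rfl⟩ := hf.mem_range ((h.nbrs_p p').2 (by simp)).symm
  obtain ⟨q', rfl⟩ := hf.mem_range ((h.nbrs_q q').2 (by simp)).symm
  obtain ⟨r', rfl⟩ := hf.mem_range ((h.nbrs_r r').2 (by simp)).symm
  exact ⟨p, q, r, rfl, rfl, rfl, (hf.configA_iff.1 h).canA⟩

theorem exists_canB (hf : IsSupportEmbedding f H G) {p q r : V} (h : CanB G p q r) :
    ∃ p₀ q₀ r₀, f p₀ = p ∧ f q₀ = q ∧ f r₀ = r ∧ CanB H p₀ q₀ r₀ := by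
  obtain ⟨s, p', r', h⟩ := h.exists_configB
  obtain ⟨p, rfl⟩ := hf.mem_range ((h.nbrs_p q).2 (by simp))
  obtain ⟨q, rfl⟩ := hf.mem_range ((h.nbrs_q r).2 (by simp))
  obtain ⟨r, rfl⟩ := hf.mem_range ((h.nbrs_r r').2 (by simp))
  obtain ⟨s, rfl⟩ := hf.mem_range ((h.nbrs_q s).2 (by simp)).symm
  obtain ⟨p', rfl⟩ := hf.mem_range ((h.nbrs_p p').2 (by simp)).symm
  obtain ⟨r', rfl⟩ := hf.mem_range ((h.nbrs_r r').2 (by simp)).symm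
  exact ⟨p, q, r, rfl, rfl, rfl, (hf.configB_iff.1 h).canB⟩

theorem reduceA (hf : IsSupportEmbedding f H G) (p q r : V') :
    IsSupportEmbedding f (reduceA H p q r) (reduceA G (f p) (f q) (f r)) where
  injective := hf.injective
  adj_iff u v := by simp only [reduceA_adj, hf.adj_iff, ne_eq, hf.injective.eq_iff]
  mem_range h := by
    obtain ⟨-, -, -, -, -, h | ⟨rfl, -⟩ | ⟨-, h | h⟩⟩ := reduceA_adj.1 h
    exacts [hf.mem_range h, ⟨_, rfl⟩, hf.mem_range h.symm, hf.mem_range h.symm]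

theorem reduceB (hf : IsSupportEmbedding f H G) (p q r : V') :
    IsSupportEmbedding f (reduceB H p q r) (reduceB G (f p) (f q) (f r)) where
  injective := hf.injective
  adj_iff u v := by simp only [reduceB_adj, hf.adj_iff, ne_eq, hf.injective.eq_iff]
  mem_range h := by
    obtain ⟨-, -, -, h | ⟨rfl, -⟩ | ⟨rfl, -⟩⟩ := reduceB_adj.1 h
    exacts [hf.mem_range h, ⟨_, rfl⟩, ⟨_, rfl⟩]

theorem of_resultA {p q r : V} (hpq : p ≠ q) (hpr : p ≠ r) :
    IsSupportEmbedding (fun o : Option {v : V // v ≠ p ∧ v ≠ q ∧ v ≠ r} => o.elim p Subtype.val)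
      (resultA G p q r) (D3.reduceA G p q r) where
  injective := by
    rintro (_ | ⟨u, hu⟩) (_ | ⟨v, hv⟩) e <;> simp only [Option.elim] at e ⊢ <;> grind
  adj_iff := by
    rintro (_ | ⟨u, hu⟩) (_ | ⟨v, hv⟩) <;> simp only [reduceA_adj, resultA, adjA, Option.elim]
    · grind
    · grind
    · grind [G.adj_comm]
    · grind [G.ne_of_adj]
  mem_range {u v} h := by
    by_cases e : u = p
    · exact ⟨none, e.symm⟩
    · exact ⟨some ⟨u, e, h.2.1, h.2.2.1⟩, rfl⟩

theorem of_resultB (G : SimpleGraph V) (p q r : V) :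
    IsSupportEmbedding Subtype.val (resultB G p q r) (D3.reduceB G p q r) where
  injective := Subtype.val_injective
  adj_iff := by
    rintro ⟨u, hu⟩ ⟨v, hv⟩
    simp only [reduceB_adj, resultB, SimpleGraph.comap_adj, SimpleGraph.sup_adj,
      SimpleGraph.edge_adj, Function.Embedding.subtype_apply]
    grind [G.ne_of_adj]
  mem_range {u v} h := ⟨⟨u, h.2.1⟩, rfl⟩

end IsSupportEmbedding

theorem nonempty_iso_reduceA_swap_pq {p q r : V} (hpq : p ≠ q) (hpr : p ≠ r) (hqr : q ≠ r) :
    Nonempty (reduceA G p q r ≃g reduceA G q p r) := by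
  classical
  refine ⟨⟨Equiv.swap p q, fun {u v} => ?_⟩⟩
  simp only [reduceA_adj, Equiv.swap_apply_def]
  grind [G.adj_comm]

section ConfigA

variable {p q r p' q' r' a b c a' b' c' : V}

theorem ConfigA.exists_first {x : V} (h : ConfigA G p q r p' q' r')
    (hx : x = p ∨ x = q ∨ x = r) :
    ∃ y z x' y' z', ConfigA G x y z x' y' z' ∧
      (∀ w, w = p ∨ w = q ∨ w = r ↔ w = x ∨ w = y ∨ w = z) ∧
      Nonempty (reduceA G p q r ≃g reduceA G x y z) := by
  rcases hx with rfl | rfl | rfl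
  · exact ⟨q, r, p', q', r', h, fun _ => Iff.rfl, ⟨.refl⟩⟩
  · exact ⟨p, r, q', p', r', h.swap_pq, by grind,
      nonempty_iso_reduceA_swap_pq h.ne_pq h.ne_pr h.ne_qr⟩
  · refine ⟨p, q, r', p', q', h.swap_qr.swap_pq, by grind, ?_⟩
    rw [← reduceA_swap_qr]
    exact nonempty_iso_reduceA_swap_pq h.ne_pr h.ne_pq h.ne_qr.symm

theorem ConfigA.exists_first_second {x y : V} (h : ConfigA G p q r p' q' r')
    (hx : x = p ∨ x = q ∨ x = r) (hy : y = p ∨ y = q ∨ y = r) (hxy : x ≠ y) :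
    ∃ z x' y' z', ConfigA G x y z x' y' z' ∧ (z = p ∨ z = q ∨ z = r) ∧
      Nonempty (reduceA G p q r ≃g reduceA G x y z) := by
  obtain ⟨y₀, z, x', y', z', hxyz, hmem, i⟩ := h.exists_first hx
  rcases ((hmem y).1 hy).resolve_left hxy.symm with rfl | rfl
  · exact ⟨z, x', y', z', hxyz, (hmem z).2 (by simp), i⟩
  · exact ⟨y₀, x', z', y', hxyz.swap_qr, (hmem y₀).2 (by simp), by rwa [reduceA_swap_qr G x]⟩

theorem ConfigA.reduceA_eq_of_common_first (h₁ : ConfigA G p q r p' q' r')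
    (h₂ : ConfigA G p b c a' b' c') : reduceA G p q r = reduceA G p b c := by
  have hb := (h₁.nbrs_p b).1 ((h₂.nbrs_p b).2 (by simp))
  have hc := (h₁.nbrs_p c).1 ((h₂.nbrs_p c).2 (by simp))
  have hbc := (h₂.nbrs_q c).2 (by simp)
  have : (b = q ∧ c = r) ∨ (b = r ∧ c = q) := by
    cases h₁
    cases h₂
    grind [HasNeighbors, G.adj_comm]
  rcases this with ⟨rfl, rfl⟩ | ⟨rfl, rfl⟩
  · rfl
  · exact reduceA_swap_qr _ _ _ _

theorem ConfigA.nonempty_iso_of_common {x : V} (h₁ : ConfigA G p q r p' q' r')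
    (h₂ : ConfigA G a b c a' b' c') (hx₁ : x = p ∨ x = q ∨ x = r)
    (hx₂ : x = a ∨ x = b ∨ x = c) : Nonempty (reduceA G p q r ≃g reduceA G a b c) := by
  obtain ⟨_, _, _, _, _, k₁, -, ⟨i₁⟩⟩ := h₁.exists_first hx₁
  obtain ⟨_, _, _, _, _, k₂, -, ⟨i₂⟩⟩ := h₂.exists_first hx₂
  rw [k₁.reduceA_eq_of_common_first k₂] at i₁
  exact ⟨i₁.trans i₂.symm⟩

theorem ConfigA.nonempty_iso_rotate (h : ConfigA G p q r p' q' r') :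
    Nonempty (reduceA G p q r ≃g reduceA G r p q) := by
  rw [← reduceA_swap_qr G p]
  exact nonempty_iso_reduceA_swap_pq h.ne_pr h.ne_pq h.ne_qr.symm

open Classical in
/-- The permutation exchanging `p` with `a` and `q` with `b`. -/
noncomputable def exchange (p q a b : V) : Equiv.Perm V :=
  Equiv.swap a p * Equiv.swap b q

open Classical in
theorem exchange_apply (hap : a ≠ p) (hab : a ≠ b) (haq : a ≠ q) (hpb : p ≠ b) (hpq : p ≠ q)
    (u : V) : exchange p q a b u =
      if u = a then p else if u = p then a else if u = b then q else if u = q then b else u := by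
  simp only [exchange, Equiv.Perm.mul_apply, Equiv.swap_apply_def]
  grind

/-- Exchanging `p` with `a` and `q` with `b` identifies the two results, once `r` and `c` represent
the contracted triangles. -/
theorem ConfigA.nonempty_iso_of_two_edges (h₁ : ConfigA G p q r a b r')
    (h₂ : ConfigA G a b c p q c') : Nonempty (reduceA G p q r ≃g reduceA G a b c) := by
  suffices i : Nonempty (reduceA G r p q ≃g reduceA G c a b) by
    obtain ⟨i₁⟩ := h₁.nonempty_iso_rotate
    obtain ⟨i₂⟩ := h₂.nonempty_iso_rotate
    exact ⟨(i₁.trans i.some).trans i₂.symm⟩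
  have happly := exchange_apply h₁.outside_p.1 h₂.ne_pq h₁.outside_p.2.1 h₂.outside_p.2.1 h₁.ne_pq
  refine ⟨⟨exchange p q a b, fun {u v} => ?_⟩⟩
  have hu := G.adj_comm u
  have hv := G.adj_comm v
  rw [happly, happly, reduceA_adj, reduceA_adj]
  cases h₁
  cases h₂
  simp only [HasNeighbors] at *
  by_cases u = a ∨ u = p ∨ u = b ∨ u = q
  · grind [G.ne_of_adj]
  · by_cases v = a ∨ v = p ∨ v = b ∨ v = q <;> grind [G.ne_of_adj]

theorem ConfigA.nonempty_iso_of_outside_mem (h₁ : ConfigA G p q r p' q' r')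
    (h₂ : ConfigA G a b c a' b' c') (ha' : a' = p ∨ a' = q ∨ a' = r)
    (hb' : b' = p ∨ b' = q ∨ b' = r) (ha : a ≠ p ∧ a ≠ q ∧ a ≠ r) (hb : b ≠ p ∧ b ≠ q ∧ b ≠ r) :
    Nonempty (reduceA G p q r ≃g reduceA G a b c) := by
  obtain ⟨z, x', y', _, h, hz, ⟨i⟩⟩ := h₁.exists_first_second ha' hb' h₂.ne_pq'
  obtain rfl : x' = a := by
    have := (h.nbrs_p a).1 ((h₂.nbrs_p a').2 (by simp)).symm
    grind
  obtain rfl : y' = b := by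
    have := (h.nbrs_q b).1 ((h₂.nbrs_q b').2 (by simp)).symm
    grind
  exact ⟨i.trans (h.nonempty_iso_of_two_edges h₂).some⟩

open Classical in
/-- The map that contracts the triangle `pqr` to `p`. -/
noncomputable def contract (p q r x : V) : V :=
  if x = p ∨ x = q ∨ x = r then p else x

theorem HasNeighbors.reduceA {u : V} (hpq : p ≠ q) (hpr : p ≠ r)
    (hu : u ≠ p ∧ u ≠ q ∧ u ≠ r) (hn : HasNeighbors G u a b c) :
    HasNeighbors (D3.reduceA G p q r) u
      (contract p q r a) (contract p q r b) (contract p q r c) := by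
  intro w
  simp only [reduceA_adj, contract]
  grind [HasNeighbors, G.adj_comm, G.ne_of_adj]

theorem ConfigA.canA_reduceA (h₁ : ConfigA G p q r p' q' r') (h₂ : ConfigA G a b c a' b' c')
    (ha : a ≠ p ∧ a ≠ q ∧ a ≠ r) (hb : b ≠ p ∧ b ≠ q ∧ b ≠ r) (hc : c ≠ p ∧ c ≠ q ∧ c ≠ r)
    (hab : ¬ ((a' = p ∨ a' = q ∨ a' = r) ∧ (b' = p ∨ b' = q ∨ b' = r)))
    (hac : ¬ ((a' = p ∨ a' = q ∨ a' = r) ∧ (c' = p ∨ c' = q ∨ c' = r)))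
    (hbc : ¬ ((b' = p ∨ b' = q ∨ b' = r) ∧ (c' = p ∨ c' = q ∨ c' = r))) :
    CanA (reduceA G p q r) a b c := by
  have na := h₂.nbrs_p.reduceA h₁.ne_pq h₁.ne_pr ha
  have nb := h₂.nbrs_q.reduceA h₁.ne_pq h₁.ne_pr hb
  have nc := h₂.nbrs_r.reduceA h₁.ne_pq h₁.ne_pr hc
  cases h₂
  refine ConfigA.canA (p' := contract p q r a') (q' := contract p q r b')
    (r' := contract p q r c') ?_
  constructor <;> grind [contract]

theorem ConfigA.nonempty_iso_or_canA (h₁ : ConfigA G p q r p' q' r')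
    (h₂ : ConfigA G a b c a' b' c') : Nonempty (reduceA G p q r ≃g reduceA G a b c) ∨
      ((a ≠ p ∧ a ≠ q ∧ a ≠ r) ∧ (b ≠ p ∧ b ≠ q ∧ b ≠ r) ∧ (c ≠ p ∧ c ≠ q ∧ c ≠ r) ∧
        CanA (reduceA G p q r) a b c) := by
  refine or_iff_not_imp_left.2 fun hiso => ?_
  have hdisj {x : V} (hx : x = a ∨ x = b ∨ x = c) : x ≠ p ∧ x ≠ q ∧ x ≠ r := by
    by_contra hx'
    exact hiso (h₁.nonempty_iso_of_common h₂ (by grind) hx)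
  have ha := hdisj (x := a) (by simp)
  have hb := hdisj (x := b) (by simp)
  have hc := hdisj (x := c) (by simp)
  refine ⟨ha, hb, hc, h₁.canA_reduceA h₂ ha hb hc ?_ ?_ ?_⟩ <;> rintro ⟨hx, hy⟩
  · exact hiso (h₁.nonempty_iso_of_outside_mem h₂ hx hy ha hb)
  · rw [← reduceA_swap_qr G a] at hiso
    exact hiso (h₁.nonempty_iso_of_outside_mem h₂.swap_qr hx hy ha hc)
  · obtain ⟨i⟩ := h₁.nonempty_iso_of_outside_mem h₂.swap_pq.swap_qr hx hy hb hc
    exact hiso ⟨i.trans h₂.swap_pq.swap_qr.nonempty_iso_rotate.some⟩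

theorem reduceA_reduceA_comm (G : SimpleGraph V) (ha : a ≠ p ∧ a ≠ q ∧ a ≠ r)
    (hb : b ≠ p ∧ b ≠ q ∧ b ≠ r) (hc : c ≠ p ∧ c ≠ q ∧ c ≠ r) :
    reduceA (reduceA G p q r) a b c = reduceA (reduceA G a b c) p q r := by
  ext u v
  simp only [reduceA_adj]
  by_cases u = p <;> by_cases u = a <;> by_cases v = p <;> by_cases v = a <;> grind [G.adj_comm]

end ConfigA

section ConfigAB

variable {p q r p' q' r' x y z s x' z' : V}

theorem ConfigA.not_mem_configB (h₁ : ConfigA G p q r p' q' r') (h₂ : ConfigB G x y z s x' z') :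
    p ≠ x ∧ p ≠ y ∧ p ≠ z ∧ p ≠ s := by
  have hys := (h₂.nbrs_q s).2 (by simp)
  have hxs := (h₂.nbrs_p s).2 (by simp)
  have hzs := (h₂.nbrs_r s).2 (by simp)
  have hyx := (h₂.nbrs_q x).2 (by simp)
  have hyz := (h₂.nbrs_q z).2 (by simp)
  cases h₁
  cases h₂
  refine ⟨?_, ?_, ?_, ?_⟩ <;> rintro rfl <;> grind [HasNeighbors, G.adj_comm]

theorem ConfigA.disjoint_configB (h₁ : ConfigA G p q r p' q' r')
    (h₂ : ConfigB G x y z s x' z') {w : V} (hw : w = x ∨ w = y ∨ w = z ∨ w = s) :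
    w ≠ p ∧ w ≠ q ∧ w ≠ r := by
  have := h₁.not_mem_configB h₂
  have := h₁.swap_pq.not_mem_configB h₂
  have := h₁.swap_qr.swap_pq.not_mem_configB h₂
  grind

theorem ConfigA.reduceB_reduceA_comm (h₁ : ConfigA G p q r p' q' r')
    (h₂ : ConfigB G x y z s x' z') :
    reduceB (reduceA G p q r) x y z = reduceA (reduceB G x y z) p q r := by
  have hx := h₁.disjoint_configB h₂ (w := x) (by simp)
  have hy := h₁.disjoint_configB h₂ (w := y) (by simp)
  have hz := h₁.disjoint_configB h₂ (w := z) (by simp)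
  ext u v
  simp only [reduceA_adj, reduceB_adj]
  by_cases u = p <;> by_cases v = p <;> grind

theorem ConfigA.canB_reduceA (h₁ : ConfigA G p q r p' q' r') (h₂ : ConfigB G x y z s x' z') :
    CanB (reduceA G p q r) x y z := by
  have hx := h₁.disjoint_configB h₂ (w := x) (by simp)
  have hy := h₁.disjoint_configB h₂ (w := y) (by simp)
  have hz := h₁.disjoint_configB h₂ (w := z) (by simp)
  have hs := h₁.disjoint_configB h₂ (w := s) (by simp)
  have nx := h₂.nbrs_p.reduceA h₁.ne_pq h₁.ne_pr hx
  have ny := h₂.nbrs_q.reduceA h₁.ne_pq h₁.ne_pr hy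
  have nz := h₂.nbrs_r.reduceA h₁.ne_pq h₁.ne_pr hz
  cases h₂
  refine ConfigB.canB (s := s) (p' := contract p q r x') (r' := contract p q r z') ?_
  constructor <;> grind [contract]

theorem ConfigA.canA_reduceB (h₁ : ConfigA G p q r p' q' r') (h₂ : ConfigB G x y z s x' z') :
    CanA (reduceB G x y z) p q r := by
  have hp := h₁.not_mem_configB h₂
  have hq := h₁.swap_pq.not_mem_configB h₂
  have hr := h₁.swap_qr.swap_pq.not_mem_configB h₂
  refine ConfigA.canA (p' := p') (q' := q') (r' := r') ?_
  cases h₁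
  cases h₂
  constructor <;> try assumption
  all_goals
    intro w
    rw [reduceB_adj]
    grind [HasNeighbors, G.adj_comm]

end ConfigAB

section ConfigB

variable {p q r s p' r' x y z t x' z' : V}

theorem ConfigB.not_adj (h : ConfigB G p q r s p' r') : ¬ G.Adj p r :=
  h.canB.not_adj_pr

theorem ConfigB.reduceB_eq_of_same_middle (h₁ : ConfigB G p q r s p' r')
    (h₂ : ConfigB G x q z t x' z') : reduceB G p q r = reduceB G x q z := by
  have hps := (h₁.nbrs_p s).2 (by simp)
  have hrs := (h₁.nbrs_r s).2 (by simp)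
  have hxz := h₂.not_adj
  have hx := (h₁.nbrs_q x).1 ((h₂.nbrs_q x).2 (by simp))
  have hz := (h₁.nbrs_q z).1 ((h₂.nbrs_q z).2 (by simp))
  have : (x = p ∧ z = r) ∨ (x = r ∧ z = p) := by
    cases h₁
    cases h₂
    grind [HasNeighbors, G.adj_comm]
  rcases this with ⟨rfl, rfl⟩ | ⟨rfl, rfl⟩
  · rfl
  · rw [reduceB_swap]

theorem ConfigB.nonempty_iso_of_middle_eq_end (h₁ : ConfigB G p q r s p' r')
    (h₂ : ConfigB G x p z t x' z') : Nonempty (reduceB G p q r ≃g reduceB G x p z) := by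
  classical
  have hqs := (h₁.nbrs_q s).2 (by simp)
  have hxt := (h₂.nbrs_p t).2 (by simp)
  have hzt := (h₂.nbrs_r t).2 (by simp)
  have hx := (h₁.nbrs_p x).1 ((h₂.nbrs_q x).2 (by simp))
  have hz := (h₁.nbrs_p z).1 ((h₂.nbrs_q z).2 (by simp))
  have ht := (h₁.nbrs_p t).1 ((h₂.nbrs_q t).2 (by simp))
  have hshape : t = s ∧ ((x = q ∧ z = p') ∨ (z = q ∧ x = p')) := by
    cases h₁
    cases h₂
    grind [HasNeighbors, G.adj_comm]
  refine ⟨⟨Equiv.swap p q, fun {u v} => ?_⟩⟩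
  have hu := G.adj_comm u
  cases h₁
  cases h₂
  rw [reduceB_adj, reduceB_adj]
  simp only [Equiv.swap_apply_def]
  by_cases u = p ∨ u = q <;> by_cases v = p ∨ v = q <;> grind [HasNeighbors, G.ne_of_adj]

theorem ConfigB.nonempty_iso_of_middle_eq_apex (h₁ : ConfigB G p q r s p' r')
    (h₂ : ConfigB G x s z t x' z') : Nonempty (reduceB G p q r ≃g reduceB G x s z) := by
  classical
  have hqp := (h₁.nbrs_q p).2 (by simp)
  have hqr := (h₁.nbrs_q r).2 (by simp)
  have hp := (h₂.nbrs_q p).1 ((h₁.nbrs_p s).2 (by simp)).symm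
  have hq := (h₂.nbrs_q q).1 ((h₁.nbrs_q s).2 (by simp)).symm
  have hr := (h₂.nbrs_q r).1 ((h₁.nbrs_r s).2 (by simp)).symm
  have hshape : t = q ∧ ((x = p ∧ z = r) ∨ (z = p ∧ x = r)) := by
    cases h₁
    cases h₂
    grind [HasNeighbors, G.adj_comm]
  refine ⟨⟨Equiv.swap s q, fun {u v} => ?_⟩⟩
  have hu := G.adj_comm u
  cases h₁
  cases h₂
  rw [reduceB_adj, reduceB_adj]
  simp only [Equiv.swap_apply_def]
  by_cases u = s ∨ u = q <;> by_cases v = s ∨ v = q <;> grind [HasNeighbors, G.ne_of_adj]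

theorem ConfigB.nonempty_iso_of_same_ends (h₁ : ConfigB G p q r s p' r')
    (h₂ : ConfigB G p y r t x' z') (hyq : y ≠ q) (hys : y ≠ s) :
    Nonempty (reduceB G p q r ≃g reduceB G p y r) := by
  classical
  have hqy : ¬ G.Adj q y := by
    rw [h₁.nbrs_q]
    cases h₂
    grind
  have hyt := (h₂.nbrs_q t).2 (by simp)
  have hy := (h₁.nbrs_p y).1 ((h₂.nbrs_p y).2 (by simp))
  have ht := (h₁.nbrs_p t).1 ((h₂.nbrs_p t).2 (by simp))
  have hts : t = s := by
    cases h₁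
    cases h₂
    grind [HasNeighbors, G.adj_comm]
  refine ⟨⟨Equiv.swap q y, fun {u v} => ?_⟩⟩
  have hu := G.adj_comm u
  cases h₁
  cases h₂
  rw [reduceB_adj, reduceB_adj]
  simp only [Equiv.swap_apply_def]
  by_cases u = q ∨ u = y <;> by_cases v = q ∨ v = y <;> grind [HasNeighbors, G.ne_of_adj]

theorem reduceB_reduceB_comm (G : SimpleGraph V) (hq : q ≠ x ∧ q ≠ y ∧ q ≠ z)
    (hy : y ≠ p ∧ y ≠ r) :
    reduceB (reduceB G p q r) x y z = reduceB (reduceB G x y z) p q r := by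
  ext u v
  simp only [reduceB_adj]
  grind

open Classical in
theorem ConfigB.canB_reduceB (h₁ : ConfigB G p q r s p' r') (h₂ : ConfigB G x y z t x' z')
    (hy : y ≠ p ∧ y ≠ q ∧ y ≠ r ∧ y ≠ s) (hxz : ¬ ((x = p ∧ z = r) ∨ (x = r ∧ z = p))) :
    CanB (reduceB G p q r) x y z := by
  have hqy : ¬ G.Adj q y := by
    rw [h₁.nbrs_q]
    grind
  have hq : q ≠ x ∧ q ≠ z ∧ q ≠ t := by
    cases h₂
    grind [HasNeighbors, G.adj_comm]
  have hps := (h₁.nbrs_p s).2 (by simp)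
  have hqs := (h₁.nbrs_q s).2 (by simp)
  have hrs := (h₁.nbrs_r s).2 (by simp)
  have hx := G.adj_comm x
  have hz := G.adj_comm z
  have hs : s ≠ x ∧ s ≠ z := by
    cases h₁
    cases h₂
    grind [HasNeighbors]
  have hx' : x' = q ↔ x = p ∨ x = r := by grind [h₁.nbrs_q x, h₂.nbrs_p q]
  have hz' : z' = q ↔ z = p ∨ z = r := by grind [h₁.nbrs_q z, h₂.nbrs_r q]
  refine ConfigB.canB (s := t) (p' := if x' = q then if x = p then r else p else x')
    (r' := if z' = q then if z = p then r else p else z') ?_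
  cases h₁
  cases h₂
  constructor <;> try assumption
  case nbrs_p | nbrs_q | nbrs_r =>
    intro w
    rw [reduceB_adj]
    grind [HasNeighbors, G.ne_of_adj]
  all_goals grind [HasNeighbors]

theorem ConfigB.nonempty_iso_or_canB (h₁ : ConfigB G p q r s p' r')
    (h₂ : ConfigB G x y z t x' z') : Nonempty (reduceB G p q r ≃g reduceB G x y z) ∨
      (y ≠ p ∧ y ≠ q ∧ y ≠ r ∧ CanB (reduceB G p q r) x y z) := by
  refine or_iff_not_imp_left.2 fun hiso => ?_
  have hq : y ≠ q := by
    rintro rfl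
    exact hiso ⟨h₁.reduceB_eq_of_same_middle h₂ ▸ .refl⟩
  have hp : y ≠ p := by
    rintro rfl
    exact hiso (h₁.nonempty_iso_of_middle_eq_end h₂)
  have hr : y ≠ r := by
    rintro rfl
    rw [← reduceB_swap] at hiso
    exact hiso (h₁.swap.nonempty_iso_of_middle_eq_end h₂)
  have hs : y ≠ s := by
    rintro rfl
    exact hiso (h₁.nonempty_iso_of_middle_eq_apex h₂)
  refine ⟨hp, hq, hr, h₁.canB_reduceB h₂ ⟨hp, hq, hr, hs⟩ ?_⟩
  rintro (⟨rfl, rfl⟩ | ⟨rfl, rfl⟩)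
  · exact hiso (h₁.nonempty_iso_of_same_ends h₂ hq hs)
  · rw [← reduceB_swap G z] at hiso
    exact hiso (h₁.swap.nonempty_iso_of_same_ends h₂ hq hs)

end ConfigB

section Diamond

/-- A D3 reduction on a fixed vertex type, labelled with the number of vertices it deletes. -/
inductive LocalStep : ℕ → SimpleGraph V → SimpleGraph V → Prop
  | d3a {G : SimpleGraph V} {p q r : V} (h : CanA G p q r) : LocalStep 2 G (reduceA G p q r)
  | d3b {G : SimpleGraph V} {p q r : V} (h : CanB G p q r) : LocalStep 1 G (reduceB G p q r)

theorem LocalStep.map {V' : Type} {f : V' → V} {d : ℕ} {H K : SimpleGraph V'}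
    (hf : IsSupportEmbedding f H G) (h : LocalStep d H K) :
    ∃ L, LocalStep d G L ∧ IsSupportEmbedding f K L := by
  rcases h with h | h
  · exact ⟨_, .d3a (hf.canA h), hf.reduceA _ _ _⟩
  · exact ⟨_, .d3b (hf.canB h), hf.reduceB _ _ _⟩

theorem ConfigA.exists_diamond_configB {p q r p' q' r' x y z s x' z' : V}
    (h₁ : ConfigA G p q r p' q' r') (h₂ : ConfigB G x y z s x' z') :
    ∃ M, LocalStep 1 (reduceA G p q r) M ∧ LocalStep 2 (reduceB G x y z) M := by
  refine ⟨_, .d3b (h₁.canB_reduceA h₂), ?_⟩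
  rw [h₁.reduceB_reduceA_comm h₂]
  exact .d3a (h₁.canA_reduceB h₂)

theorem LocalStep.diamond {d e : ℕ} {H K : SimpleGraph V} (h₁ : LocalStep d G H)
    (h₂ : LocalStep e G K) :
    (d = e ∧ Nonempty (H ≃g K)) ∨ ∃ M, LocalStep e H M ∧ LocalStep d K M := by
  rcases h₁ with h₁ | h₁ <;> rcases h₂ with h₂ | h₂
  · obtain ⟨_, _, _, h₁⟩ := h₁.exists_configA
    obtain ⟨_, _, _, h₂⟩ := h₂.exists_configA
    rcases h₁.nonempty_iso_or_canA h₂ with i | ⟨ha, hb, hc, h₂₁⟩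
    · exact .inl ⟨rfl, i⟩
    rcases h₂.nonempty_iso_or_canA h₁ with ⟨⟨i⟩⟩ | ⟨-, -, -, h₁₂⟩
    · exact .inl ⟨rfl, ⟨i.symm⟩⟩
    refine .inr ⟨_, .d3a h₂₁, ?_⟩
    rw [reduceA_reduceA_comm G ha hb hc]
    exact .d3a h₁₂
  · obtain ⟨_, _, _, h₁⟩ := h₁.exists_configA
    obtain ⟨_, _, _, h₂⟩ := h₂.exists_configB
    exact .inr (h₁.exists_diamond_configB h₂)
  · obtain ⟨_, _, _, h₁⟩ := h₁.exists_configB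
    obtain ⟨_, _, _, h₂⟩ := h₂.exists_configA
    obtain ⟨M, hK, hH⟩ := h₂.exists_diamond_configB h₁
    exact .inr ⟨M, hH, hK⟩
  · obtain ⟨_, _, _, h₁⟩ := h₁.exists_configB
    obtain ⟨_, _, _, h₂⟩ := h₂.exists_configB
    rcases h₁.nonempty_iso_or_canB h₂ with i | ⟨hp, -, hr, h₂₁⟩
    · exact .inl ⟨rfl, i⟩
    rcases h₂.nonempty_iso_or_canB h₁ with ⟨⟨i⟩⟩ | ⟨hx, hy, hz, h₁₂⟩
    · exact .inl ⟨rfl, ⟨i.symm⟩⟩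
    refine .inr ⟨_, .d3b h₂₁, ?_⟩
    rw [reduceB_reduceB_comm G ⟨hx, hy, hz⟩ ⟨hp, hr⟩]
    exact .d3b h₁₂

end Diamond

section Reducibility

variable {d k : ℕ}

/-- `G` is a complete graph on four vertices together with any number of isolated vertices. -/
def IsK4 (G : SimpleGraph V) : Prop :=
  ∃ A : Finset V, A.card = 4 ∧ ∀ u v, G.Adj u v ↔ u ∈ A ∧ v ∈ A ∧ u ≠ v

theorem IsK4.of_iso_top (e : G ≃g (⊤ : SimpleGraph (Fin 4))) : IsK4 G := by
  refine ⟨Finset.univ.map e.symm.toEquiv.toEmbedding, by simp, fun u v => ?_⟩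
  rw [← e.map_adj_iff]
  simp

theorem IsK4.map (hf : IsSupportEmbedding f H G) (h : IsK4 H) : IsK4 G := by
  obtain ⟨A, hA, hadj⟩ := h
  refine ⟨A.map ⟨f, hf.injective⟩, by simpa using hA, fun u v => ⟨fun huv => ?_, ?_⟩⟩
  · obtain ⟨u, rfl⟩ := hf.mem_range huv
    obtain ⟨v, rfl⟩ := hf.mem_range huv.symm
    simpa [hf.injective.eq_iff] using (hadj u v).1 ((hf.adj_iff _ _).1 huv)
  · simp only [Finset.mem_map, Function.Embedding.coeFn_mk]
    rintro ⟨⟨u, hu, rfl⟩, ⟨v, hv, rfl⟩, huv⟩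
    exact (hf.adj_iff _ _).2 ((hadj u v).2 ⟨hu, hv, fun h => huv (h ▸ rfl)⟩)

theorem IsK4.nonempty_iso_top (hf : IsSupportEmbedding f H G) (h : IsK4 G)
    (hV' : Nat.card V' = 4) : Nonempty (H ≃g (⊤ : SimpleGraph (Fin 4))) := by
  have : Finite V' := Nat.finite_of_card_ne_zero (by omega)
  have := Fintype.ofFinite V'
  obtain ⟨A, hA, hadj⟩ := h
  have hsub : A ⊆ Finset.univ.map ⟨f, hf.injective⟩ := by
    intro u hu
    obtain ⟨v, hv, hvu⟩ := Finset.exists_mem_ne (by omega : 1 < A.card) u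
    obtain ⟨u', rfl⟩ := hf.mem_range ((hadj u v).2 ⟨hu, hv, hvu.symm⟩)
    simp
  have hA_eq := Finset.eq_of_subset_of_card_le hsub <| by
    rw [Finset.card_map, hA, Finset.card_univ, ← Nat.card_eq_fintype_card, hV']
  have hH : H = ⊤ := by
    ext u v
    rw [← hf.adj_iff, hadj, hA_eq]
    simp [hf.injective.eq_iff]
  subst hH
  exact ⟨SimpleGraph.Iso.completeGraph (Finite.equivFinOfCardEq hV')⟩

theorem IsK4.not_canA (h : IsK4 G) (p q r : V) : ¬ CanA G p q r := by
  intro hc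
  obtain ⟨A, -, hadj⟩ := h
  obtain ⟨p', q', r', hc⟩ := hc.exists_configA
  have hpp' : G.Adj p p' := (hc.nbrs_p p').2 (by simp)
  have hqp : G.Adj q p := (hc.nbrs_q p).2 (by simp)
  have hqp' : q ≠ p' := fun h => hc.outside_p.2.1 h.symm
  have hadj_qp' : G.Adj q p' := (hadj q p').2 ⟨((hadj q p).1 hqp).1, ((hadj p p').1 hpp').2.1, hqp'⟩
  rcases (hc.nbrs_q p').1 hadj_qp' with h | h | h
  · exact hc.outside_p.1 h
  · exact hc.outside_p.2.2 h
  · exact hc.ne_pq' h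

theorem IsK4.not_canB (h : IsK4 G) (p q r : V) : ¬ CanB G p q r := by
  intro hc
  obtain ⟨A, -, hadj⟩ := h
  have hp := ((hadj p q).1 hc.adj_pq).1
  have hr := ((hadj q r).1 hc.adj_qr).2.1
  exact hc.not_adj_pr ((hadj p r).2 ⟨hp, hr, hc.ne_pr⟩)

theorem IsK4.not_localStep {K : SimpleGraph V} (h : IsK4 G) : ¬ LocalStep d G K := by
  rintro (hc | hc)
  · exact h.not_canA _ _ _ hc
  · exact h.not_canB _ _ _ hc

/-- Local steps turn `G` into a complete graph on four vertices. The number `k` counts the vertices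
of `G` without those that earlier steps have deleted: these stay in `V` as isolated vertices. -/
inductive ReducibleTo : SimpleGraph V → ℕ → Prop
  | k4 {G : SimpleGraph V} (h : IsK4 G) : ReducibleTo G 4
  | step {G H : SimpleGraph V} {d k : ℕ} (h : LocalStep d G H) (hr : ReducibleTo H k) :
      ReducibleTo G (k + d)

theorem ReducibleTo.map (hf : IsSupportEmbedding f H G) (h : ReducibleTo H k) :
    ReducibleTo G k := by
  induction h generalizing G with
  | k4 h => exact .k4 (h.map hf)
  | step hs _ ih =>
    obtain ⟨L, hL, hf'⟩ := hs.map hf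
    exact .step hL (ih hf')

theorem ReducibleTo.of_iso {H : SimpleGraph V} (h : ReducibleTo H k) :
    Nonempty (H ≃g G) → ReducibleTo G k := fun ⟨e⟩ => h.map (.of_iso e)

theorem ReducibleTo.of_step {K : SimpleGraph V} (h : ReducibleTo G k) (hs : LocalStep d G K) :
    ∃ j, k = j + d ∧ ReducibleTo K j := by
  induction h generalizing K d with
  | k4 h => exact absurd hs h.not_localStep
  | @step G H e k hGH hH ih =>
    rcases hGH.diamond hs with ⟨rfl, hiso⟩ | ⟨M, hHM, hKM⟩
    · exact ⟨k, rfl, hH.of_iso hiso⟩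
    · obtain ⟨j, rfl, hM⟩ := ih hHM
      exact ⟨j + e, by omega, .step hKM hM⟩

theorem LocalStep.reducibleTo_iff {K : SimpleGraph V} (hs : LocalStep d G K) :
    ReducibleTo G (k + d) ↔ ReducibleTo K k := by
  refine ⟨fun h => ?_, .step hs⟩
  obtain ⟨j, hj, hK⟩ := h.of_step hs
  rwa [Nat.add_right_cancel hj]

theorem card_resultA_vertices [Finite V] {p q r : V} (hpq : p ≠ q) (hpr : p ≠ r) (hqr : q ≠ r) :
    Nat.card V = Nat.card (Option {v : V // v ≠ p ∧ v ≠ q ∧ v ≠ r}) + 2 := by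
  have hcompl : ({v : V | v ≠ p ∧ v ≠ q ∧ v ≠ r} : Set V) = ({p, q, r} : Set V)ᶜ := by
    ext v
    simp
  have hcard := Set.ncard_add_ncard_compl ({p, q, r} : Set V)
  rw [Set.ncard_eq_three.2 ⟨p, q, r, hpq, hpr, hqr, rfl⟩, ← hcompl,
    ← Nat.card_coe_set_eq {v : V | _}] at hcard
  rw [Finite.card_option, ← hcard]
  simp only [Set.coe_ofPred]
  omega

theorem card_resultB_vertices [Finite V] (q : V) : Nat.card V = Nat.card {v : V // v ≠ q} + 1 := by
  classical
  have hcard := Nat.card_congr (Equiv.optionSubtypeNe q)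
  rw [← hcard, Finite.card_option]

theorem Step.exists_localStep {X Y : Graph} [Finite X.1] {f : X.1 → V} (h : Step X Y)
    (hf : IsSupportEmbedding f X.2 G) :
    ∃ d K, ∃ g : Y.1 → V, LocalStep d G K ∧ IsSupportEmbedding g Y.2 K ∧
      Finite Y.1 ∧ Nat.card X.1 = Nat.card Y.1 + d := by
  rcases h with ⟨H, p, q, r, h⟩ | ⟨H, p, q, r, h⟩
  · exact ⟨2, _, _, .d3a (hf.canA h),
      (hf.reduceA p q r).comp (.of_resultA h.adj_pq.ne h.adj_pr.ne), inferInstance,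
      card_resultA_vertices h.adj_pq.ne h.adj_pr.ne h.adj_qr.ne⟩
  · exact ⟨1, _, _, .d3b (hf.canB h),
      (hf.reduceB p q r).comp (.of_resultB H p q r), inferInstance, card_resultB_vertices q⟩

theorem LocalStep.exists_step [Finite V'] {K : SimpleGraph V} (h : LocalStep d G K)
    (hf : IsSupportEmbedding f H G) :
    ∃ Y : Graph, ∃ g : Y.1 → V, Step ⟨V', H⟩ Y ∧ IsSupportEmbedding g Y.2 K ∧
      Finite Y.1 ∧ Nat.card V' = Nat.card Y.1 + d := by
  rcases h with h | h
  · obtain ⟨p, q, r, rfl, rfl, rfl, hH⟩ := hf.exists_canA h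
    exact ⟨⟨_, resultA H p q r⟩, _, .d3a H p q r hH,
      (hf.reduceA p q r).comp (.of_resultA hH.adj_pq.ne hH.adj_pr.ne), inferInstance,
      card_resultA_vertices hH.adj_pq.ne hH.adj_pr.ne hH.adj_qr.ne⟩
  · obtain ⟨p, q, r, rfl, rfl, rfl, hH⟩ := hf.exists_canB h
    exact ⟨⟨_, resultB H p q r⟩, _, .d3b H p q r hH,
      (hf.reduceB p q r).comp (.of_resultB H p q r), inferInstance, card_resultB_vertices q⟩

theorem ReducibleTo.reducible [Finite V'] (h : ReducibleTo G k) (hf : IsSupportEmbedding f H G)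
    (hk : Nat.card V' = k) : Reducible H := by
  induction h generalizing V' with
  | k4 h => exact ⟨⟨V', H⟩, .refl, h.nonempty_iso_top hf hk⟩
  | step hs _ ih =>
    obtain ⟨Y, g, hY, hg, _, hcard⟩ := hs.exists_step hf
    obtain ⟨K, hK, e⟩ := ih hg (by omega)
    exact ⟨K, .head hY hK, e⟩

theorem Reducible.reducibleTo [Finite V'] (h : Reducible H) (hf : IsSupportEmbedding f H G) :
    ReducibleTo G (Nat.card V') := by
  obtain ⟨K, hK, ⟨e⟩⟩ := h
  suffices ∀ X : Graph, Relation.ReflTransGen Step X K → Finite X.1 →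
      ∀ (f : X.1 → V) (G : SimpleGraph V), IsSupportEmbedding f X.2 G →
        ReducibleTo G (Nat.card X.1) from this ⟨V', H⟩ hK ‹_› f G hf
  intro X hX
  induction hX using Relation.ReflTransGen.head_induction_on with
  | refl =>
    intro _ f G hf
    rw [Nat.card_congr e.toEquiv, Nat.card_fin]
    exact .k4 ((IsK4.of_iso_top e).map hf)
  | head hstep _ ih =>
    intro _ f G hf
    obtain ⟨d, L, g, hL, hg, hfin, hcard⟩ := hstep.exists_localStep hf
    rw [hcard]
    exact .step hL (ih hfin g L hg)

theorem reducible_iff_reducibleTo [Finite V'] (hf : IsSupportEmbedding f H G) :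
    Reducible H ↔ ReducibleTo G (Nat.card V') :=
  ⟨fun h => h.reducibleTo hf, fun h => h.reducible hf rfl⟩

end Reducibility

section DegreeSum

variable {p q r s p' q' r' : V} {N : V → Finset V} {S : Finset V}

/-- `N u` is the set of neighbors of `u`, for every `u`. -/
def IsNeighborhood (G : SimpleGraph V) (N : V → Finset V) : Prop := ∀ u w, w ∈ N u ↔ G.Adj u w

theorem IsNeighborhood.degThree_iff (hN : IsNeighborhood G N) {u : V} :
    DegThree G u ↔ (N u).card = 3 := by
  have : G.neighborSet u = N u := by
    ext w
    simp [hN u w]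
  rw [DegThree, this, Set.ncard_coe_finset]

theorem ConfigA.support_reduceA_subset (h : ConfigA G p q r p' q' r') :
    (reduceA G p q r).support ⊆ G.support \ {q, r} := by
  rintro u ⟨w, huw⟩
  obtain ⟨-, huq, hur, -, -, hadj⟩ := reduceA_adj.1 huw
  refine ⟨?_, by simp [huq, hur]⟩
  obtain huw | ⟨rfl, -⟩ | ⟨-, hqu | hru⟩ := hadj
  · exact ⟨_, huw⟩
  · exact ⟨_, h.canA.adj_pq⟩
  · exact ⟨_, hqu.symm⟩
  · exact ⟨_, hru.symm⟩

theorem ConfigB.support_reduceB_subset (h : ConfigB G p q r s p' r') :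
    (reduceB G p q r).support ⊆ G.support \ {q} := by
  rintro u ⟨w, huw⟩
  obtain ⟨-, huq, -, hadj⟩ := reduceB_adj.1 huw
  refine ⟨?_, huq⟩
  obtain huw | ⟨rfl, -⟩ | ⟨rfl, -⟩ := hadj
  · exact ⟨_, huw⟩
  · exact ⟨_, h.canB.adj_pq⟩
  · exact ⟨_, h.canB.adj_qr.symm⟩

theorem IsNeighborhood.sum_card_eq_of_support_subset {A : Finset V} (hN : IsNeighborhood G N)
    (hA : G.support ⊆ A) (hAS : A ⊆ S) : ∑ u ∈ S, (N u).card = ∑ u ∈ A, (N u).card := by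
  refine (Finset.sum_subset hAS fun u _ hu => ?_).symm
  rw [Finset.card_eq_zero, Finset.eq_empty_iff_forall_notMem]
  exact fun w hw => hu (hA ⟨w, (hN u w).1 hw⟩)

theorem IsK4.sum_card (h : IsK4 G) (hN : IsNeighborhood G N) (hS : G.support ⊆ S) :
    ∑ u ∈ S, (N u).card = 12 := by
  classical
  obtain ⟨A, hA, hadj⟩ := h
  have hGA : G.support ⊆ A := fun u ⟨w, huw⟩ => ((hadj u w).1 huw).1
  have hAS : A ⊆ S := by
    intro u hu
    obtain ⟨v, hv, hvu⟩ := Finset.exists_mem_ne (by omega : 1 < A.card) u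
    exact hS ⟨v, (hadj u v).2 ⟨hu, hv, hvu.symm⟩⟩
  have hdeg : ∀ u ∈ A, (N u).card = 3 := by
    intro u hu
    have : N u = A.erase u := by
      ext w
      rw [hN, hadj, Finset.mem_erase]
      tauto
    rw [this, Finset.card_erase_of_mem hu, hA]
  rw [hN.sum_card_eq_of_support_subset hGA hAS, Finset.sum_congr rfl hdeg, Finset.sum_const, hA]
  rfl

theorem IsK4.of_sum_card {A : Finset V} (hA : A.card = 4) (hN : IsNeighborhood G N)
    (hGA : G.support ⊆ A) (hsum : ∑ u ∈ A, (N u).card = 12) : IsK4 G := by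
  classical
  have hsub : ∀ u, N u ⊆ A.erase u := by
    intro u w hw
    have huw := (hN u w).1 hw
    exact Finset.mem_erase.2 ⟨huw.ne', hGA ⟨_, huw.symm⟩⟩
  have hcard : ∀ u ∈ A, (A.erase u).card = 3 := fun u hu => by
    rw [Finset.card_erase_of_mem hu, hA]
  have hle : ∀ u ∈ A, (N u).card ≤ 3 := fun u hu =>
    (Finset.card_le_card (hsub u)).trans (hcard u hu).le
  have heq : ∀ u ∈ A, (N u).card = 3 := by
    refine (Finset.sum_eq_sum_iff_of_le hle).1 ?_
    rw [hsum, Finset.sum_const, hA]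
    rfl
  refine ⟨A, hA, fun u v => ⟨fun h => ⟨hGA ⟨_, h⟩, hGA ⟨_, h.symm⟩, h.ne⟩, ?_⟩⟩
  rintro ⟨hu, hv, huv⟩
  have hNu := Finset.eq_of_subset_of_card_le (hsub u) (by rw [hcard u hu, heq u hu])
  rw [← hN, hNu]
  exact Finset.mem_erase.2 ⟨huv.symm, hv⟩

section DecidableEq

variable [DecidableEq V]

/-- The neighborhoods after rule D3a. -/
def neighborhoodA (N : V → Finset V) (p q r p' q' r' u : V) : Finset V :=
  if u = p then {p', q', r'} else if u = q ∨ u = r then ∅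
  else if u = q' then insert p ((N u).erase q) else if u = r' then insert p ((N u).erase r)
  else N u

/-- The neighborhoods after rule D3b. -/
def neighborhoodB (N : V → Finset V) (p q r s u : V) : Finset V :=
  if u = q then ∅ else if u = p then insert r ((N u).erase q)
  else if u = r then insert p ((N u).erase q) else if u = s then (N u).erase q
  else N u

theorem IsNeighborhood.reduceA (hN : IsNeighborhood G N) (h : ConfigA G p q r p' q' r') :
    IsNeighborhood (reduceA G p q r) (neighborhoodA N p q r p' q' r') := by
  intro u w
  have hNuw := hN u w
  cases h
  rw [neighborhoodA, reduceA_adj]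
  split_ifs <;> grind [HasNeighbors, G.adj_comm, G.ne_of_adj]

theorem IsNeighborhood.reduceB (hN : IsNeighborhood G N) (h : ConfigB G p q r s p' r') :
    IsNeighborhood (reduceB G p q r) (neighborhoodB N p q r s) := by
  intro u w
  have hNuw := hN u w
  cases h
  rw [neighborhoodB, reduceB_adj]
  split_ifs <;> grind [HasNeighbors, G.adj_comm, G.ne_of_adj]

theorem card_insert_erase {A : Finset V} {a b : V} (ha : a ∉ A) (hb : b ∈ A) :
    (insert a (A.erase b)).card = A.card := by
  rw [Finset.card_insert_of_notMem (fun h => ha (Finset.mem_of_mem_erase h)),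
    Finset.card_erase_add_one hb]

theorem ConfigA.card_neighborhoodA (h : ConfigA G p q r p' q' r') (hN : IsNeighborhood G N)
    (u : V) :
    (neighborhoodA N p q r p' q' r' u).card = if u = q ∨ u = r then 0 else (N u).card := by
  have hp : (N p).card = 3 := hN.degThree_iff.1 h.canA.deg_p
  have hq' : q ∈ N q' := (hN q' q).2 ((h.nbrs_q q').2 (by simp)).symm
  have hr' : r ∈ N r' := (hN r' r).2 ((h.nbrs_r r').2 (by simp)).symm
  have hpq' : p ∉ N q' := by
    cases h
    grind [IsNeighborhood, HasNeighbors, G.adj_comm]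
  have hpr' : p ∉ N r' := by
    cases h
    grind [IsNeighborhood, HasNeighbors, G.adj_comm]
  rw [neighborhoodA]
  by_cases hu : u = p
  · subst hu
    rw [if_pos rfl, hp, if_neg (by simp [h.ne_pq, h.ne_pr])]
    exact Finset.card_eq_three.2 ⟨_, _, _, h.ne_pq', h.ne_pr', h.ne_qr', rfl⟩
  rw [if_neg hu]
  split_ifs with h₁ h₂ h₃
  · rfl
  · rw [h₂, card_insert_erase hpq' hq']
  · rw [h₃, card_insert_erase hpr' hr']
  · rfl

theorem ConfigB.card_neighborhoodB (h : ConfigB G p q r s p' r') (hN : IsNeighborhood G N)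
    (u : V) :
    (neighborhoodB N p q r s u).card =
      if u = q then 0 else if u = s then (N u).card - 1 else (N u).card := by
  have hqp : q ∈ N p := (hN p q).2 h.canB.adj_pq
  have hqr : q ∈ N r := (hN r q).2 h.canB.adj_qr.symm
  have hqs : q ∈ N s := (hN s q).2 ((h.nbrs_q s).2 (by simp)).symm
  have hrp : r ∉ N p := fun hr => h.not_adj ((hN p r).1 hr)
  have hpr : p ∉ N r := fun hp => h.not_adj ((hN r p).1 hp).symm
  have hps : p ≠ s := h.apex_ne.1.symm
  have hrs : r ≠ s := h.apex_ne.2.2.symm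
  rw [neighborhoodB]
  split_ifs with h₁ h₂ h₃ h₄ h₅ h₆
  · rfl
  · exact absurd (h₂.symm.trans h₃) hps
  · rw [h₂, card_insert_erase hrp hqp]
  · exact absurd (h₄.symm.trans h₅) hrs
  · rw [h₄, card_insert_erase hpr hqr]
  · rw [h₆, Finset.card_erase_of_mem hqs]
  · rfl

theorem ConfigA.sum_card_neighborhoodA (h : ConfigA G p q r p' q' r') (hN : IsNeighborhood G N)
    (hS : G.support ⊆ S) :
    ∑ u ∈ S, (neighborhoodA N p q r p' q' r' u).card + 6 = ∑ u ∈ S, (N u).card := by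
  have hq : (N q).card = 3 := hN.degThree_iff.1 h.canA.deg_q
  have hr : (N r).card = 3 := hN.degThree_iff.1 h.canA.deg_r
  have hqS : q ∈ S := hS ⟨_, h.canA.adj_qr⟩
  have hrS : r ∈ S.erase q := Finset.mem_erase.2 ⟨h.ne_qr.symm, hS ⟨_, h.canA.adj_qr.symm⟩⟩
  have hrest : ∑ u ∈ (S.erase q).erase r, (neighborhoodA N p q r p' q' r' u).card =
      ∑ u ∈ (S.erase q).erase r, (N u).card := by
    refine Finset.sum_congr rfl fun u hu => ?_
    simp only [Finset.mem_erase] at hu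
    rw [h.card_neighborhoodA hN, if_neg (by tauto)]
  rw [← Finset.add_sum_erase _ _ hqS, ← Finset.add_sum_erase _ _ hrS,
    ← Finset.add_sum_erase S (fun u => (N u).card) hqS,
    ← Finset.add_sum_erase _ (fun u => (N u).card) hrS, hrest, h.card_neighborhoodA hN,
    h.card_neighborhoodA hN, hq, hr, if_pos (.inl rfl), if_pos (.inr rfl)]
  omega

theorem ConfigB.sum_card_neighborhoodB (h : ConfigB G p q r s p' r') (hN : IsNeighborhood G N)
    (hS : G.support ⊆ S) :
    ∑ u ∈ S, (neighborhoodB N p q r s u).card + 4 = ∑ u ∈ S, (N u).card := by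
  have hq : (N q).card = 3 := hN.degThree_iff.1 h.canB.deg_q
  have hqs : G.Adj q s := (h.nbrs_q s).2 (by simp)
  have hs : 0 < (N s).card := Finset.card_pos.2 ⟨q, (hN s q).2 hqs.symm⟩
  have hqS : q ∈ S := hS ⟨_, hqs⟩
  have hsS : s ∈ S.erase q := Finset.mem_erase.2 ⟨hqs.ne', hS ⟨_, hqs.symm⟩⟩
  have hrest : ∑ u ∈ (S.erase q).erase s, (neighborhoodB N p q r s u).card =
      ∑ u ∈ (S.erase q).erase s, (N u).card := by
    refine Finset.sum_congr rfl fun u hu => ?_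
    simp only [Finset.mem_erase] at hu
    rw [h.card_neighborhoodB hN, if_neg (by tauto), if_neg (by tauto)]
  rw [← Finset.add_sum_erase _ _ hqS, ← Finset.add_sum_erase _ _ hsS,
    ← Finset.add_sum_erase S (fun u => (N u).card) hqS,
    ← Finset.add_sum_erase _ (fun u => (N u).card) hsS, hrest, h.card_neighborhoodB hN,
    h.card_neighborhoodB hN, hq, if_pos rfl, if_neg hqs.ne', if_pos rfl]
  omega

end DecidableEq

theorem ReducibleTo.sum_card_le {k : ℕ} (h : ReducibleTo G k) (hN : IsNeighborhood G N)
    (hS : G.support ⊆ S) : ∑ u ∈ S, (N u).card ≤ 4 * k := by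
  classical
  induction h generalizing N with
  | k4 h =>
    rw [h.sum_card hN hS]
    omega
  | step hs _ ih =>
    rcases hs with h | h
    · obtain ⟨_, _, _, h⟩ := h.exists_configA
      have hle := ih (hN.reduceA h) ((h.support_reduceA_subset.trans Set.sdiff_subset).trans hS)
      have hsum := h.sum_card_neighborhoodA hN hS
      omega
    · obtain ⟨_, _, _, h⟩ := h.exists_configB
      have hle := ih (hN.reduceB h) ((h.support_reduceB_subset.trans Set.sdiff_subset).trans hS)
      have hsum := h.sum_card_neighborhoodB hN hS
      omega

end DegreeSum

section Update

variable [DecidableEq V] {N : V → Finset V} {p q r s p' q' r' : V}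

theorem ConfigA.neighborhoodA_eq_update (h : ConfigA G p q r p' q' r') (hN : IsNeighborhood G N) :
    neighborhoodA N p q r p' q' r' =
      let N₁ := Function.update N q' (insert p ((N q').erase q))
      let N₂ := Function.update N₁ r' (insert p ((N₁ r').erase r))
      let N₃ := Function.update N₂ p (insert q' ((N₂ p).erase q))
      let N₄ := Function.update N₃ p (insert r' ((N₃ p).erase r))
      let N₅ := Function.update N₄ q ∅
      Function.update N₅ r ∅ := by
  have hNp : N p = {q, r, p'} := by
    ext w
    simp [hN p w, h.nbrs_p w]
  cases h
  funext u
  simp only [neighborhoodA, Function.update_apply, hNp]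
  grind

theorem ConfigB.neighborhoodB_eq_update (h : ConfigB G p q r s p' r') :
    neighborhoodB N p q r s =
      let N₁ := Function.update N p (insert r ((N p).erase q))
      let N₂ := Function.update N₁ r (insert p ((N₁ r).erase q))
      let N₃ := Function.update N₂ s ((N₂ s).erase q)
      Function.update N₃ q ∅ := by
  cases h
  funext u
  simp only [neighborhoodB, Function.update_apply]
  grind

end Update

section Local

variable {G' : SimpleGraph V} {p q r s p' q' r' : V}

theorem ConfigA.of_hasNeighbors (hp : HasNeighbors G p q r p') (hq : HasNeighbors G q p r q')
    (hr : HasNeighbors G r p q r') (hp' : p' ≠ q ∧ p' ≠ r) (hq' : q' ≠ p ∧ q' ≠ r)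
    (hr' : r' ≠ p ∧ r' ≠ q) (hne : p' ≠ q' ∧ p' ≠ r' ∧ q' ≠ r') : ConfigA G p q r p' q' r' := by
  have hpq := ((hp q).2 (.inl rfl)).ne
  have hpr := ((hp r).2 (.inr (.inl rfl))).ne
  have hqr := ((hq r).2 (.inr (.inl rfl))).ne
  have hpp' := ((hp p').2 (.inr (.inr rfl))).ne
  have hqq' := ((hq q').2 (.inr (.inr rfl))).ne
  have hrr' := ((hr r').2 (.inr (.inr rfl))).ne
  constructor <;> grind

theorem HasNeighbors.third_unique {v a b c c' : V} (h : HasNeighbors G v a b c)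
    (h' : HasNeighbors G v a b c') (ha : c' ≠ a) (hb : c' ≠ b) : c = c' := by
  have := (h c').1 ((h' c').2 (.inr (.inr rfl)))
  grind

theorem CanA.ne_of_hasNeighbors (h : CanA G p q r) (hp : HasNeighbors G p q r p')
    (hq : HasNeighbors G q p r q') (hr : HasNeighbors G r p q r') :
    p' ≠ q' ∧ p' ≠ r' ∧ q' ≠ r' := by
  obtain ⟨p'', q'', r'', h⟩ := h.exists_configA
  rw [hp.third_unique h.nbrs_p h.outside_p.2.1 h.outside_p.2.2,
    hq.third_unique h.nbrs_q h.outside_q.1 h.outside_q.2.2,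
    hr.third_unique h.nbrs_r h.outside_r.1 h.outside_r.2.1]
  exact ⟨h.ne_pq', h.ne_pr', h.ne_qr'⟩

theorem CanB.exists_configB_of_hasNeighbors (h : CanB G p q r) (hq : HasNeighbors G q p r s) :
    ∃ p' r', ConfigB G p q r s p' r' := by
  obtain ⟨t, p', r', h⟩ := h.exists_configB
  obtain rfl := hq.third_unique h.nbrs_q h.apex_ne.1 h.apex_ne.2.2
  exact ⟨p', r', h⟩

theorem CanA.symm (h : CanA G p q r) : CanA G p r q :=
  have ⟨_, _, _, h⟩ := h.exists_configA
  h.swap_qr.canA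

theorem CanB.symm (h : CanB G p q r) : CanB G r q p :=
  have ⟨_, _, _, h⟩ := h.exists_configB
  h.swap.canB

/-- A reduction applies at `u`: either `u` is in the triangle of rule D3a, or `u` is the vertex that
rule D3b deletes. -/
def Active (G : SimpleGraph V) (u : V) : Prop :=
  ∃ x y, CanA G u x y ∨ CanB G x u y

theorem HasNeighbors.not_active (hp : HasNeighbors G p q r s)
    (hqr : ¬ CanA G p q r ∧ ¬ CanB G q p r) (hrs : ¬ CanA G p r s ∧ ¬ CanB G r p s)
    (hsq : ¬ CanA G p s q ∧ ¬ CanB G s p q) : ¬ Active G p := by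
  rintro ⟨x, y, h | h⟩
  · have := h.adj_qr.ne
    have := (hp x).1 h.adj_pq
    have := (hp y).1 h.adj_pr
    grind [CanA.symm]
  · have := h.ne_pr
    have := (hp x).1 h.adj_pq.symm
    have := (hp y).1 h.adj_qr
    grind [CanB.symm]

theorem Active.degThree (h : Active G p) : DegThree G p := by
  obtain ⟨x, y, h | h⟩ := h
  · exact h.deg_p
  · exact h.deg_q

theorem Active.of_adj_iff (hp : Active G' p)
    (h : ∀ w, DegThree G' w → w = p ∨ G'.Adj p w → ∀ t, G.Adj w t ↔ G'.Adj w t) :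
    Active G p := by
  obtain ⟨x, y, hxy | hxy⟩ := hp
  · have adj_p := h p hxy.deg_p (.inl rfl)
    have adj_x := h x hxy.deg_q (.inr hxy.adj_pq)
    have adj_y := h y hxy.deg_r (.inr hxy.adj_pr)
    obtain ⟨_, _, _, config⟩ := hxy.exists_configA
    exact ⟨x, y, .inl (ConfigA.canA { config with
      nbrs_p := fun t => (adj_p t).trans (config.nbrs_p t)
      nbrs_q := fun t => (adj_x t).trans (config.nbrs_q t)
      nbrs_r := fun t => (adj_y t).trans (config.nbrs_r t) })⟩
  · have adj_p := h p hxy.deg_q (.inl rfl)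
    have adj_x := h x hxy.deg_p (.inr hxy.adj_pq.symm)
    have adj_y := h y hxy.deg_r (.inr hxy.adj_qr)
    obtain ⟨_, _, _, config⟩ := hxy.exists_configB
    exact ⟨x, y, .inr (ConfigB.canB { config with
      nbrs_p := fun t => (adj_x t).trans (config.nbrs_p t)
      nbrs_q := fun t => (adj_p t).trans (config.nbrs_q t)
      nbrs_r := fun t => (adj_y t).trans (config.nbrs_r t) })⟩

end Local

theorem third_eq_add_sub {a b c v w : ℕ} (h3 : ({a, b, c} : Finset ℕ).card = 3)
    (hv : v ∈ ({a, b, c} : Finset ℕ)) (hw : w ∈ ({a, b, c} : Finset ℕ)) (hvw : v ≠ w) :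
    a + b + c - v - w ≠ v ∧ a + b + c - v - w ≠ w ∧
      ({a, b, c} : Finset ℕ) = {v, w, a + b + c - v - w} := by
  obtain ⟨hab, hac, hbc⟩ : a ≠ b ∧ a ≠ c ∧ b ≠ c := by
    simp only [Finset.card_insert_eq_ite, Finset.card_singleton] at h3
    grind
  grind

theorem ReducibleTo.iff_of_not_active {V : Type} {G : SimpleGraph V} {N : V → Finset V}
    {A : Finset V} (hN : IsNeighborhood G N) (hA : G.support ⊆ A) (hG : ∀ u, ¬ Active G u) :
    ReducibleTo G A.card ↔ A.card = 4 ∧ ∑ u ∈ A, (N u).card = 12 := by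
  refine ⟨fun h => ?_, fun ⟨h4, hsum⟩ => h4 ▸ .k4 (.of_sum_card h4 hN hA hsum)⟩
  generalize hk : A.card = k at h ⊢
  cases h with
  | k4 h => exact ⟨rfl, h.sum_card hN hA⟩
  | step h =>
    cases h with
    | d3a h => exact (hG _ ⟨_, _, .inl h⟩).elim
    | d3b h => exact (hG _ ⟨_, _, .inr h⟩).elim

end D3

namespace AdjList

/-- The adjacency list of `u` as a list of natural numbers, empty if `u` is not a vertex. -/
def neighborList {n : ℕ} (L : Fin n → List (Fin n)) (u : ℕ) : List ℕ :=
  if h : u < n then (L ⟨u, h⟩).map Fin.val else []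

section Encode

variable {n : ℕ} (L : Fin n → List (Fin n)) {u v w : ℕ}

theorem neighborList_of_lt (h : u < n) : neighborList L u = (L ⟨u, h⟩).map Fin.val := dif_pos h

theorem neighborList_of_not_lt (h : ¬ u < n) : neighborList L u = [] := dif_neg h

theorem lt_of_mem_neighborList (hw : w ∈ neighborList L u) : w < n := by
  by_cases hu : u < n
  · rw [neighborList_of_lt L hu] at hw
    obtain ⟨w, -, rfl⟩ := List.mem_map.1 hw
    exact w.2
  · simp [neighborList_of_not_lt L hu] at hw

theorem start_zero : start L 0 = n + 2 := by
  simp [start]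

theorem start_succ (hv : v < n) : start L (v + 1) = start L v + (neighborList L v).length := by
  rw [start, start, List.take_add_one, neighborList_of_lt L hv]
  simp [hv, add_assoc]

theorem start_eq_sum (hv : v ≤ n) :
    start L v = n + 2 + ∑ u ∈ Finset.range v, (neighborList L u).length := by
  induction v with
  | zero => simp [start_zero]
  | succ v ih => rw [start_succ L hv, ih (by omega), Finset.sum_range_succ, add_assoc]

theorem start_mono (hvw : v ≤ w) (hw : w ≤ n) : start L v ≤ start L w := by
  rw [start_eq_sum L (hvw.trans hw), start_eq_sum L hw]
  gcongr

theorem length_encode : (encode L).length = start L n := by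
  rw [start, List.take_of_length_le (by simp)]
  simp only [encode, List.length_cons, List.length_append, List.length_map, List.length_range]
  omega

theorem add_two_le_length_encode : n + 2 ≤ (encode L).length := by
  rw [length_encode, ← start_zero L]
  exact start_mono L (Nat.zero_le n) le_rfl

theorem getD_encode_zero : (encode L).getD 0 0 = n := rfl

theorem getD_encode_succ (hv : v ≤ n) : (encode L).getD (v + 1) 0 = start L v := by
  rw [encode, List.getD_cons_succ, List.getD_append _ _ _ _ (by simp; omega)]
  simp [Nat.lt_succ_of_le hv]

theorem getD_encode_start_add {j : ℕ} (hv : v < n) (hj : j < (neighborList L v).length) :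
    (encode L).getD (start L v + j) 0 = (neighborList L v)[j] := by
  obtain ⟨before, after, encode_eq, length_before⟩ : ∃ before after,
      encode L = before ++ (neighborList L v ++ after) ∧ before.length = start L v := by
    refine ⟨n :: ((List.range (n + 1)).map (start L) ++ ((List.ofFn L).take v).flatten.map Fin.val),
      ((List.ofFn L).drop (v + 1)).flatten.map Fin.val, ?_, ?_⟩
    · have split : List.ofFn L =
          (List.ofFn L).take v ++ L ⟨v, hv⟩ :: (List.ofFn L).drop (v + 1) := by
        conv_lhs => rw [← List.take_append_drop v (List.ofFn L)]
        rw [List.drop_eq_getElem_cons (by simpa using hv), List.getElem_ofFn]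
      rw [neighborList_of_lt L hv, encode]
      conv_lhs => rw [split]
      simp
    · simp only [start, List.length_cons, List.length_append, List.length_map, List.length_range]
      omega
  rw [encode_eq, ← length_before, List.getD_append_right _ _ _ _ (Nat.le_add_right _ _),
    Nat.add_sub_cancel_left, List.getD_append _ _ _ _ hj, List.getD_eq_getElem _ _ hj]

theorem getD_encode_le (a : ℕ) : (encode L).getD a 0 ≤ (encode L).length := by
  have := add_two_le_length_encode L
  by_cases ha : a < (encode L).length
  · rw [List.getD_eq_getElem _ _ ha]
    have hmem := List.getElem_mem ha
    generalize (encode L)[a] = w at hmem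
    rw [encode, List.mem_cons, List.mem_append, List.mem_map, List.mem_map] at hmem
    rcases hmem with rfl | ⟨v, hv, rfl⟩ | ⟨v, -, rfl⟩
    · omega
    · rw [length_encode]
      exact start_mono L (Nat.lt_succ_iff.1 (List.mem_range.1 hv)) le_rfl
    · omega
  · rw [List.getD_eq_default _ _ (by omega)]
    omega

end Encode

namespace Represents

variable {n : ℕ} {L : Fin n → List (Fin n)} {G : SimpleGraph (Fin n)}

theorem nodup_neighborList (h : Represents L G) (u : ℕ) : (neighborList L u).Nodup := by
  by_cases hu : u < n
  · rw [neighborList_of_lt L hu]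
    exact (h _).1.map Fin.val_injective
  · simp [neighborList_of_not_lt L hu]

theorem isNeighborhood (h : Represents L G) :
    D3.IsNeighborhood (G.map Fin.valEmbedding) fun u => (neighborList L u).toFinset := by
  intro u w
  rw [List.mem_toFinset, SimpleGraph.map_adj]
  by_cases hu : u < n
  · rw [neighborList_of_lt L hu, List.mem_map]
    constructor
    · rintro ⟨w, hw, rfl⟩
      exact ⟨_, _, ((h _).2 w).1 hw, rfl, rfl⟩
    · rintro ⟨u, w, huw, rfl, rfl⟩
      exact ⟨w, ((h _).2 w).2 huw, rfl⟩
  · simp only [neighborList_of_not_lt L hu, List.not_mem_nil, false_iff]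
    rintro ⟨u, -, -, rfl, -⟩
    exact hu u.2

theorem card_toFinset_neighborList (h : Represents L G) (u : ℕ) :
    (neighborList L u).toFinset.card = (neighborList L u).length :=
  List.toFinset_card_of_nodup (h.nodup_neighborList u)

end Represents

theorem support_map_valEmbedding_subset {n : ℕ} (G : SimpleGraph (Fin n)) :
    (G.map Fin.valEmbedding).support ⊆ Finset.range n := by
  rw [SimpleGraph.support_map]
  rintro _ ⟨u, -, rfl⟩
  simp

end AdjList

namespace ArrayLang

/-- The registers of the array language. -/
inductive Reg
  | n | sp | alive | dsum | v | x | y | z | x' | y' | done | t₁ | t₂ | t₃ | tmp | ptr | out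
  deriving DecidableEq

/-- The arrays of the array language, indexed by vertices: degrees, the three neighbors of a vertex
of degree three, and the sum of the neighbors of a vertex. The array `stack`, indexed by positions,
holds a stack of vertices. -/
inductive ArrayName
  | deg | nb₁ | nb₂ | nb₃ | sum | stack
  deriving DecidableEq

/-- The number of the machine register that holds a register of the array language. -/
def Reg.idx : Reg → ℕ
  | n => 1 | sp => 2 | alive => 3 | dsum => 4 | v => 5 | x => 6 | y => 7 | z => 8 | x' => 9
  | y' => 10 | done => 11 | t₁ => 12 | t₂ => 13 | t₃ => 14 | tmp => 15 | ptr => 16 | out => 17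

/-- The arrays are interleaved: the entries with the same index form a record of eight words (two of
them unused), in which `f.idx` is the offset of the entry of `f`. -/
def ArrayName.idx : ArrayName → ℕ
  | deg => 0 | nb₁ => 1 | nb₂ => 2 | nb₃ => 3 | sum => 4 | stack => 5

theorem Reg.idx_injective : Function.Injective Reg.idx := by
  intro a b h
  cases a <;> cases b <;> first | rfl | exact absurd h (by decide)

theorem Reg.idx_pos (r : Reg) : 0 < r.idx := by
  cases r <;> decide

theorem ArrayName.idx_injective : Function.Injective ArrayName.idx := by
  intro a b h
  cases a <;> cases b <;> first | rfl | exact absurd h (by decide)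

theorem ArrayName.idx_lt (f : ArrayName) : f.idx < 8 := by
  cases f <;> decide

/-- The states of the array language. -/
structure State where
  reg : Reg → ℕ
  arr : ArrayName → ℕ → ℕ

/-- Expressions of the array language. An array is read at the index in register `r`, and `input r`
is the input word whose address is in register `r`. -/
inductive Expr
  | const (k : ℕ)
  | reg (r : Reg)
  | arr (f : ArrayName) (r : Reg)
  | input (r : Reg)
  | add (a b : Expr)
  | sub (a b : Expr)
  | lt (a b : Expr)
  | eq (a b : Expr)
  | or (a b : Expr)

/-- Programs of the array language. `store f r e` changes the entry of the array `f` at the index in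
register `r`. -/
inductive Prog
  | skip
  | assign (r : Reg) (e : Expr)
  | store (f : ArrayName) (r : Reg) (e : Expr)
  | seq (c d : Prog)
  | cond (e : Expr) (c d : Prog)
  | loop (e : Expr) (c : Prog)

/-- An input of `N` words, a bound `M` for all values in registers and arrays, and a word bound
`W` that is large enough for addresses. -/
structure Env where
  input : ℕ → ℕ
  N : ℕ
  M : ℕ
  W : ℕ
  N_lt : N < M
  input_lt : ∀ a < N, input a < M
  le_M : 16 ≤ M
  le_W : N + 8 * M + 8 ≤ W

/-- The value of an expression. -/
def Expr.val (E : Env) (s : State) : Expr → ℕ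
  | const k => k
  | reg r => s.reg r
  | arr f r => s.arr f (s.reg r)
  | input r => E.input (s.reg r)
  | add a b => a.val E s + b.val E s
  | sub a b => a.val E s - b.val E s
  | lt a b => if a.val E s < b.val E s then 1 else 0
  | eq a b => if a.val E s = b.val E s then 1 else 0
  | or a b => if a.val E s = 0 ∧ b.val E s = 0 then 0 else 1

/-- No sum that occurs in the evaluation exceeds the bound, and only the input is read as input.
Constants are less than `16`, so that they satisfy every bound. -/
def Expr.Safe (E : Env) (s : State) : Expr → Prop
  | const k => k < 16
  | reg _ => True
  | arr _ _ => True
  | input r => s.reg r < E.N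
  | add a b => a.Safe E s ∧ b.Safe E s ∧ a.val E s + b.val E s < E.M
  | sub a b => a.Safe E s ∧ b.Safe E s
  | lt a b => a.Safe E s ∧ b.Safe E s
  | eq a b => a.Safe E s ∧ b.Safe E s
  | or a b => a.Safe E s ∧ b.Safe E s

/-- The state after an assignment to a register. -/
def State.setReg (s : State) (r : Reg) (a : ℕ) : State :=
  { s with reg := Function.update s.reg r a }

/-- The state after an assignment to an array entry. -/
def State.setArr (s : State) (f : ArrayName) (i a : ℕ) : State :=
  { s with arr := Function.update s.arr f (Function.update (s.arr f) i a) }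

@[simp]
theorem State.setReg_reg (s : State) (r r' : Reg) (a : ℕ) :
    (s.setReg r a).reg r' = if r' = r then a else s.reg r' := by
  simp [State.setReg, Function.update_apply]

@[simp]
theorem State.setReg_arr (s : State) (r : Reg) (a : ℕ) : (s.setReg r a).arr = s.arr := rfl

@[simp]
theorem State.setArr_reg (s : State) (f : ArrayName) (i a : ℕ) : (s.setArr f i a).reg = s.reg := rfl

@[simp]
theorem State.setArr_arr (s : State) (f f' : ArrayName) (i j a : ℕ) :
    (s.setArr f i a).arr f' j = if f' = f ∧ j = i then a else s.arr f' j := by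
  by_cases hf : f' = f
  · subst hf
    simp [State.setArr, Function.update_apply]
  · simp [State.setArr, hf]

/-- The weakest precondition of a loop-free program; loops have the precondition `False`, because
they are treated by `Triple.loop`. -/
def wp (E : Env) : Prog → (State → Prop) → State → Prop
  | .skip, Q, s => Q s
  | .assign r e, Q, s => e.Safe E s ∧ Q (s.setReg r (e.val E s))
  | .store f r e, Q, s => e.Safe E s ∧ Q (s.setArr f (s.reg r) (e.val E s))
  | .seq c d, Q, s => wp E c (wp E d Q) s
  | .cond e c d, Q, s =>
    e.Safe E s ∧ (e.val E s ≠ 0 → wp E c Q s) ∧ (e.val E s = 0 → wp E d Q s)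
  | .loop _ _, _, _ => False

theorem wp_mono {E : Env} {c : Prog} {Q Q' : State → Prop} {s : State} (hc : wp E c Q s)
    (hQ : ∀ s', Q s' → Q' s') : wp E c Q' s := by
  induction c generalizing Q Q' s with
  | skip => exact hQ _ hc
  | assign r e => exact ⟨hc.1, hQ _ hc.2⟩
  | store f r e => exact ⟨hc.1, hQ _ hc.2⟩
  | seq c d ihc ihd => exact ihc hc fun _ hd => ihd hd hQ
  | cond e c d ihc ihd => exact ⟨hc.1, fun he => ihc (hc.2.1 he) hQ, fun he => ihd (hc.2.2 he) hQ⟩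
  | loop e c => exact hc

/-- The address of an array entry whose index is in register `r`: machine register `0` holds the
length of the input, and the arrays follow the input. The multiplication of the index by eight
consists of three doublings. -/
def addr (f : ArrayName) (r : Reg) : RAM.Expr :=
  let r₁ : RAM.Expr := .reg r.idx
  let r₂ := r₁.add r₁
  let r₄ := r₂.add r₂
  (RAM.Expr.reg 0).add ((r₄.add r₄).add (.const f.idx))

/-- Compilation of expressions to the random access machine. -/
def Expr.compile : Expr → RAM.Expr
  | const k => .const k
  | reg r => .reg r.idx
  | arr f r => .load (addr f r)
  | input r => .load (.reg r.idx)
  | add a b => .add a.compile b.compile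
  | sub a b => .sub a.compile b.compile
  | lt a b => .lt a.compile b.compile
  | eq a b => .eq a.compile b.compile
  | or a b => .lt (.const 0) (.add a.compile b.compile)

/-- Compilation of programs to the random access machine. -/
def Prog.compile : Prog → RAM.Prog
  | skip => .skip
  | assign r e => .assign r.idx e.compile
  | store f r e => .store (addr f r) e.compile
  | seq c d => .seq c.compile d.compile
  | cond e c d => .cond e.compile c.compile d.compile
  | loop e c => .loop e.compile c.compile

/-- An upper bound for the running time of a loop-free program. -/
def Prog.cost : Prog → ℕ
  | skip => 1
  | assign _ e => e.compile.cost + 1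
  | store f r e => (addr f r).cost + e.compile.cost + 1
  | seq c d => c.cost + d.cost
  | cond e c d => e.compile.cost + 1 + (c.cost + d.cost)
  | loop _ _ => 0

/-- The machine state `σ` represents the state `s` of the array language. -/
structure Simulates (E : Env) (σ : RAM.State) (s : State) : Prop where
  base : σ.reg 0 = E.N
  reg : ∀ r : Reg, σ.reg r.idx = s.reg r
  arr : ∀ (f : ArrayName) (i : ℕ), σ.mem (E.N + (8 * i + f.idx)) = s.arr f i
  input : ∀ a < E.N, σ.mem a = E.input a
  reg_lt : ∀ r, s.reg r < E.M
  arr_lt : ∀ f i, s.arr f i < E.M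

namespace Simulates

variable {E : Env} {σ : RAM.State} {s : State}

theorem addr_val (hσ : Simulates E σ s) (f : ArrayName) (r : Reg) :
    (addr f r).val σ = E.N + (8 * s.reg r + f.idx) := by
  simp only [addr, RAM.Expr.val, hσ.reg, hσ.base]
  omega

theorem addr_fits (hσ : Simulates E σ s) (f : ArrayName) (r : Reg) : (addr f r).Fits E.W σ := by
  have := hσ.reg_lt r
  have := f.idx_lt
  have := E.le_W
  simp only [addr, RAM.Expr.Fits, RAM.Expr.val, hσ.reg, hσ.base]
  and_intros <;> omega

theorem val_compile (hσ : Simulates E σ s) {e : Expr} (he : e.Safe E s) :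
    e.compile.val σ = e.val E s := by
  induction e with
  | const k => rfl
  | reg r => exact hσ.reg r
  | arr f r => simp only [Expr.compile, RAM.Expr.val, Expr.val, hσ.addr_val, hσ.arr]
  | input r => simp only [Expr.compile, RAM.Expr.val, Expr.val, hσ.reg, hσ.input _ he]
  | add a b iha ihb =>
    simp only [Expr.compile, RAM.Expr.val, Expr.val, iha he.1, ihb he.2.1]
  | sub a b iha ihb | lt a b iha ihb | eq a b iha ihb =>
    simp only [Expr.compile, RAM.Expr.val, Expr.val, iha he.1, ihb he.2]
  | or a b iha ihb =>
    simp only [Expr.compile, RAM.Expr.val, Expr.val, iha he.1, ihb he.2]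
    split_ifs <;> omega

theorem val_lt (hσ : Simulates E σ s) {e : Expr} (he : e.Safe E s) : e.val E s < E.M := by
  have := E.le_M
  induction e with
  | const k => exact lt_of_lt_of_le he E.le_M
  | reg r => exact hσ.reg_lt r
  | arr f r => exact hσ.arr_lt f _
  | input r => exact E.input_lt _ he
  | add a b => exact he.2.2
  | sub a b iha => exact (Nat.sub_le _ _).trans_lt (iha he.1)
  | lt a b | eq a b | or a b =>
    simp only [Expr.val]
    split_ifs <;> omega

theorem compile_fits (hσ : Simulates E σ s) {e : Expr} (he : e.Safe E s) :
    e.compile.Fits E.W σ := by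
  have hW := E.le_W
  have hM := E.le_M
  induction e with
  | const k => exact lt_of_lt_of_le he (by omega)
  | reg r =>
    have := hσ.reg_lt r
    simp only [Expr.compile, RAM.Expr.Fits, hσ.reg]
    omega
  | arr f r =>
    have := hσ.val_lt he
    exact ⟨hσ.addr_fits f r, by rw [hσ.addr_val, hσ.arr]; exact this.trans (by omega)⟩
  | input r =>
    have := hσ.reg_lt r
    have := E.input_lt _ he
    simp only [Expr.compile, RAM.Expr.Fits, RAM.Expr.val, hσ.reg, hσ.input _ he]
    omega
  | add a b iha ihb =>
    refine ⟨iha he.1, ihb he.2.1, ?_⟩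
    rw [hσ.val_compile he.1, hσ.val_compile he.2.1]
    exact he.2.2.trans (by omega)
  | sub a b iha ihb => exact ⟨iha he.1, ihb he.2⟩
  | lt a b iha ihb | eq a b iha ihb => exact ⟨iha he.1, ihb he.2, by omega⟩
  | or a b iha ihb =>
    have := hσ.val_lt he.1
    have := hσ.val_lt he.2
    refine ⟨by simp only [RAM.Expr.Fits]; omega, ⟨iha he.1, ihb he.2, ?_⟩, by omega⟩
    rw [hσ.val_compile he.1, hσ.val_compile he.2]
    omega

theorem setReg (hσ : Simulates E σ s) (r : Reg) {a : ℕ} (ha : a < E.M) :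
    Simulates E { σ with reg := Function.update σ.reg r.idx a } (s.setReg r a) where
  base := by
    rw [← hσ.base]
    exact Function.update_of_ne r.idx_pos.ne _ _
  reg r' := by
    simp only [State.setReg_reg, Function.update_apply, Reg.idx_injective.eq_iff, hσ.reg]
  arr := hσ.arr
  input := hσ.input
  reg_lt r' := by
    rw [State.setReg_reg]
    split_ifs
    · exact ha
    · exact hσ.reg_lt r'
  arr_lt := hσ.arr_lt

theorem setArr (hσ : Simulates E σ s) (f : ArrayName) (i : ℕ) {a : ℕ} (ha : a < E.M) :
    Simulates E { σ with mem := Function.update σ.mem (E.N + (8 * i + f.idx)) a }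
      (s.setArr f i a) where
  base := hσ.base
  reg := hσ.reg
  arr f' j := by
    have := f.idx_lt
    have := f'.idx_lt
    simp only [State.setArr_arr, Function.update_apply, hσ.arr]
    by_cases hfj : f' = f ∧ j = i
    · simp [hfj]
    · rw [if_neg hfj, if_neg]
      exact fun h => hfj ⟨ArrayName.idx_injective (by omega), by omega⟩
  input b hb := by
    simp only [Function.update_apply]
    rw [if_neg (by omega)]
    exact hσ.input b hb
  reg_lt := hσ.reg_lt
  arr_lt f' j := by
    rw [State.setArr_arr]
    split_ifs
    · exact ha
    · exact hσ.arr_lt f' j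

end Simulates

/-- Total correctness with a time bound: started in a representation of a state that satisfies `P`,
the compiled program halts within `T` time units in a representation of a state that
satisfies `Q`. -/
def Triple (E : Env) (P : State → Prop) (c : Prog) (T : ℕ) (Q : State → Prop) : Prop :=
  ∀ σ s, Simulates E σ s → P s →
    ∃ t τ s', RAM.Exec E.W c.compile σ t τ ∧ t ≤ T ∧ Simulates E τ s' ∧ Q s'

namespace Triple

variable {E : Env} {P P' Q Q' R : State → Prop} {c d : Prog} {T T' U : ℕ} {e : Expr}

theorem skip (P : State → Prop) : Triple E P .skip 1 P :=
  fun σ s hσ hP => ⟨1, σ, s, .skip σ, le_rfl, hσ, hP⟩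

theorem assign {r : Reg} (h : ∀ s, P s → e.Safe E s ∧ Q (s.setReg r (e.val E s))) :
    Triple E P (.assign r e) (e.compile.cost + 1) Q := by
  intro σ s hσ hP
  obtain ⟨he, hQ⟩ := h s hP
  refine ⟨_, _, _, .assign _ _ _ (hσ.compile_fits he), le_rfl, ?_, hQ⟩
  rw [hσ.val_compile he]
  exact hσ.setReg r (hσ.val_lt he)

theorem store {f : ArrayName} {r : Reg}
    (h : ∀ s, P s → e.Safe E s ∧ Q (s.setArr f (s.reg r) (e.val E s))) :
    Triple E P (.store f r e) ((addr f r).cost + e.compile.cost + 1) Q := by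
  intro σ s hσ hP
  obtain ⟨he, hQ⟩ := h s hP
  refine ⟨_, _, _, .store _ _ _ (hσ.addr_fits f r) (hσ.compile_fits he), le_rfl, ?_, hQ⟩
  rw [hσ.val_compile he, hσ.addr_val]
  exact hσ.setArr f _ (hσ.val_lt he)

theorem seq (hc : Triple E P c T Q) (hd : Triple E Q d U R) :
    Triple E P (.seq c d) (T + U) R := by
  intro σ s hσ hP
  obtain ⟨t, τ, s', exec_c, ht, hτ, hQ⟩ := hc σ s hσ hP
  obtain ⟨u, υ, s'', exec_d, hu, hυ, hR⟩ := hd τ s' hτ hQ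
  exact ⟨_, _, _, .seq exec_c exec_d, Nat.add_le_add ht hu, hυ, hR⟩

theorem cond (he : ∀ s, P s → e.Safe E s) (hc : Triple E (fun s => P s ∧ e.val E s ≠ 0) c T Q)
    (hd : Triple E (fun s => P s ∧ e.val E s = 0) d U Q) :
    Triple E P (.cond e c d) (e.compile.cost + 1 + max T U) Q := by
  intro σ s hσ hP
  have hfits := hσ.compile_fits (he s hP)
  have hval := hσ.val_compile (he s hP)
  by_cases hv : e.val E s = 0
  · obtain ⟨u, τ, s', exec_d, hu, hτ, hQ⟩ := hd σ s hσ ⟨hP, hv⟩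
    exact ⟨_, _, _, .cond_false hfits (hval.trans hv) exec_d, by omega, hτ, hQ⟩
  · obtain ⟨t, τ, s', exec_c, ht, hτ, hQ⟩ := hc σ s hσ ⟨hP, hv⟩
    exact ⟨_, _, _, .cond_true hfits (hval ▸ hv) exec_c, by omega, hτ, hQ⟩

theorem conseq (h : Triple E P c T Q) (hP : ∀ s, P' s → P s) (hT : T ≤ T')
    (hQ : ∀ s, Q s → Q' s) : Triple E P' c T' Q' := by
  intro σ s hσ hs
  obtain ⟨t, τ, s', exec, ht, hτ, hQs⟩ := h σ s hσ (hP s hs)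
  exact ⟨t, τ, s', exec, ht.trans hT, hτ, hQ _ hQs⟩

theorem of_wp (h : ∀ s, P s → wp E c Q s) : Triple E P c c.cost Q := by
  suffices Triple E (wp E c Q) c c.cost Q from this.conseq h le_rfl fun _ h => h
  clear h
  induction c generalizing Q with
  | skip => exact .skip Q
  | assign r e => exact .assign fun _ h => h
  | store f r e => exact .store fun _ h => h
  | seq c d ihc ihd => exact ihc.seq ihd
  | cond e c d ihc ihd =>
    refine (Triple.cond (fun _ h => h.1) (ihc.conseq ?_ le_rfl fun _ h => h)
      (ihd.conseq ?_ le_rfl fun _ h => h)).conseq (fun _ h => h) ?_ fun _ h => h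
    · exact fun _ h => h.1.2.1 h.2
    · exact fun _ h => h.1.2.2 h.2
    · simp only [Prog.cost]
      omega
  | loop e c => exact fun _ _ _ h => h.elim

theorem loop {I : State → Prop} (Φ : State → ℕ) (B : ℕ) (he : ∀ s, I s → e.Safe E s)
    (hc : ∀ b, Triple E (fun s => I s ∧ e.val E s ≠ 0 ∧ Φ s = b) c T (fun s => I s ∧ Φ s < b)) :
    Triple E (fun s => I s ∧ Φ s ≤ B) (.loop e c) ((B + 1) * (e.compile.cost + 1 + T))
      (fun s => I s ∧ e.val E s = 0) := by
  intro σ s hσ ⟨hI, hB⟩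
  induction B generalizing σ s with
  | zero =>
    by_cases hv : e.val E s = 0
    · exact ⟨_, _, _, .loop_false (hσ.compile_fits (he s hI)) ((hσ.val_compile (he s hI)).trans hv),
        by omega, hσ, hI, hv⟩
    · obtain ⟨_, _, _, -, -, -, -, hlt⟩ := hc _ σ s hσ ⟨hI, hv, rfl⟩
      omega
  | succ B ih =>
    have hfits := hσ.compile_fits (he s hI)
    have hval := hσ.val_compile (he s hI)
    rw [Nat.succ_mul]
    by_cases hv : e.val E s = 0
    · exact ⟨_, _, _, .loop_false hfits (hval.trans hv), by omega, hσ, hI, hv⟩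
    · obtain ⟨t, τ, s', exec_c, ht, hτ, hI', hlt⟩ := hc _ σ s hσ ⟨hI, hv, rfl⟩
      obtain ⟨u, υ, s'', exec_loop, hu, hυ, hend⟩ := ih τ s' hτ hI' (by omega)
      exact ⟨_, _, _, .loop_true hfits (hval ▸ hv) exec_c exec_loop, by omega, hυ, hend⟩

end Triple

section ModularSums

theorem add_sub_mod_modEq {n a b : ℕ} (hb : b ≤ n) : (a + (n - b)) % n + b ≡ a [MOD n] := by
  have h := (Nat.mod_modEq (a + (n - b)) n).add_right b
  rw [show a + (n - b) + b = a + n by omega] at h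
  exact h.trans Nat.add_modEq_right

theorem modEq_sum_erase {A : Finset ℕ} {n a b o : ℕ} (ha : a ≡ ∑ w ∈ A, w [MOD n]) (ho : o ∈ A)
    (hb : b + o ≡ a [MOD n]) : b ≡ ∑ w ∈ A.erase o, w [MOD n] := by
  refine Nat.ModEq.add_right_cancel' o ?_
  rw [Finset.sum_erase_add A (fun w => w) ho]
  exact hb.trans ha

theorem modEq_sum_insert_erase {A : Finset ℕ} {n a b o w : ℕ} (ha : a ≡ ∑ u ∈ A, u [MOD n])
    (ho : o ∈ A) (hw : w ∉ A) (hb : b + o ≡ a + w [MOD n]) :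
    b ≡ ∑ u ∈ insert w (A.erase o), u [MOD n] := by
  have how : w ≠ o := fun h => hw (h ▸ ho)
  rw [← Finset.erase_insert_of_ne how]
  refine modEq_sum_erase ?_ (Finset.mem_insert_of_mem ho) hb
  rw [Finset.sum_insert hw, add_comm w]
  exact ha.add_right w

end ModularSums

/-- The degree and the sum modulo `n` that are recorded for the vertex `u` are those of the
neighborhood `A`. -/
structure StoresSum (n : ℕ) (s : State) (u : ℕ) (A : Finset ℕ) : Prop where
  deg : s.arr .deg u = A.card
  sum : s.arr .sum u ≡ ∑ w ∈ A, w [MOD n]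
  sum_lt : s.arr .sum u < n

/-- The entries with index `u` of the arrays represent the set `A` as the neighborhood of the vertex
`u` of a graph with vertices less than `n`. If there are exactly three neighbors, then they are
recorded explicitly. -/
structure StoresNeighborhood (n : ℕ) (s : State) (u : ℕ) (A : Finset ℕ) : Prop
    extends StoresSum n s u A where
  nbs : A.card = 3 → A = {s.arr .nb₁ u, s.arr .nb₂ u, s.arr .nb₃ u}
  nb₁_lt : s.arr .nb₁ u < n
  nb₂_lt : s.arr .nb₂ u < n
  nb₃_lt : s.arr .nb₃ u < n

/-- The arrays represent the family `N` of neighborhoods. -/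
def Stores (n : ℕ) (s : State) (N : ℕ → Finset ℕ) : Prop :=
  ∀ u < n, StoresNeighborhood n s u (N u)

/-- Except for the temporary register, the states `s` and `s'` differ at most in what is recorded
about the vertex `u`. -/
structure AgreeOffVertex (u : ℕ) (s s' : State) : Prop where
  reg : ∀ r, r ≠ .tmp → s'.reg r = s.reg r
  stack : s'.arr .stack = s.arr .stack
  arr : ∀ f, ∀ i ≠ u, s'.arr f i = s.arr f i

/-- Except for the temporary register, the states `s` and `s'` differ at most in what is recorded
about the vertices. -/
structure AgreeOffGraph (s s' : State) : Prop where
  reg : ∀ r, r ≠ .tmp → s'.reg r = s.reg r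
  stack : s'.arr .stack = s.arr .stack

theorem AgreeOffVertex.trans {u : ℕ} {s s' s'' : State} (h : AgreeOffVertex u s s')
    (h' : AgreeOffVertex u s' s'') : AgreeOffVertex u s s'' where
  reg r hr := (h'.reg r hr).trans (h.reg r hr)
  stack := h'.stack.trans h.stack
  arr f i hi := (h'.arr f i hi).trans (h.arr f i hi)

theorem AgreeOffGraph.trans {s s' s'' : State} (h : AgreeOffGraph s s')
    (h' : AgreeOffGraph s' s'') : AgreeOffGraph s s'' where
  reg r hr := (h'.reg r hr).trans (h.reg r hr)
  stack := h'.stack.trans h.stack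

theorem StoresNeighborhood.congr {n u : ℕ} {s s' : State} {A : Finset ℕ}
    (h : StoresNeighborhood n s u A) (hs : ∀ f, f ≠ .stack → s'.arr f u = s.arr f u) :
    StoresNeighborhood n s' u A := by
  constructor
  · constructor
    · simpa only [hs .deg (by decide)] using h.deg
    · simpa only [hs .sum (by decide)] using h.sum
    · simpa only [hs .sum (by decide)] using h.sum_lt
  · simpa only [hs .nb₁ (by decide), hs .nb₂ (by decide), hs .nb₃ (by decide)] using h.nbs
  · simpa only [hs .nb₁ (by decide)] using h.nb₁_lt
  · simpa only [hs .nb₂ (by decide)] using h.nb₂_lt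
  · simpa only [hs .nb₃ (by decide)] using h.nb₃_lt

theorem Stores.update {n u : ℕ} {s s' : State} {N : ℕ → Finset ℕ} {A : Finset ℕ}
    (hN : Stores n s N) (hs : AgreeOffVertex u s s') (hA : StoresNeighborhood n s' u A) :
    AgreeOffGraph s s' ∧ Stores n s' (Function.update N u A) := by
  refine ⟨⟨hs.reg, hs.stack⟩, fun i hi => ?_⟩
  obtain rfl | hiu := eq_or_ne i u
  · rwa [Function.update_self]
  · rw [Function.update_of_ne hiu]
    exact (hN i hi).congr fun f _ => hs.arr f i hiu

/-- Sequential composition of a list of programs. -/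
def block : List Prog → Prog
  | [] => .skip
  | c :: l => .seq c (block l)

@[simp]
theorem wp_block_nil {E : Env} {Q : State → Prop} {s : State} : wp E (block []) Q s ↔ Q s := Iff.rfl

@[simp]
theorem wp_block_cons {E : Env} {c : Prog} {l : List Prog} {Q : State → Prop} {s : State} :
    wp E (block (c :: l)) Q s ↔ wp E c (wp E (block l) Q) s := Iff.rfl

theorem wp_block_singleton {E : Env} {c : Prog} {Q : State → Prop} {s : State} :
    wp E (block [c]) Q s ↔ wp E c Q s := Iff.rfl

theorem wp_block_of_wp {E : Env} {c : Prog} {l : List Prog} {Q Q' : State → Prop} {s : State}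
    (hc : wp E c Q s) (hl : ∀ s', Q s' → wp E (block l) Q' s') : wp E (block (c :: l)) Q' s :=
  wp_block_cons.2 (wp_mono hc hl)

/-- Set `tmp` to the value of `e` modulo `n`, provided that this value is less than `2 * n`. -/
def assignMod (e : Expr) : Prog :=
  .seq (.assign .tmp e)
    (.cond (.lt (.reg .tmp) (.reg .n)) .skip (.assign .tmp (.sub (.reg .tmp) (.reg .n))))

theorem wp_assignMod {E : Env} {Q : State → Prop} {s : State} {e : Expr} (he : e.Safe E s)
    (hlt : e.val E s < 2 * s.reg .n) (hQ : Q (s.setReg .tmp (e.val E s % s.reg .n))) :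
    wp E (assignMod e) Q s := by
  have idem (a b : ℕ) : (s.setReg .tmp a).setReg .tmp b = s.setReg .tmp b := by
    simp [State.setReg]
  simp only [assignMod, wp, Expr.val, Expr.Safe, State.setReg_reg, reduceCtorEq, if_true, if_false,
    idem, and_self, true_and]
  refine ⟨he, fun h => ?_, fun h => ?_⟩
  · rwa [Nat.mod_eq_of_lt (by grind)] at hQ
  · rwa [Nat.mod_eq_sub_mod (by grind), Nat.mod_eq_of_lt (by omega)] at hQ

/-- Replace the entry of `f` for the vertex `u` by `new` if it is `old`. -/
def replaceIn (f : ArrayName) (u old new : Reg) : Prog :=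
  .cond (.eq (.arr f u) (.reg old)) (.store f u (.reg new)) .skip

theorem wp_replaceIn {E : Env} {Q : State → Prop} {s : State} {f : ArrayName} {u old new : Reg}
    (hQ : Q (s.setArr f (s.reg u)
      (if s.arr f (s.reg u) = s.reg old then s.reg new else s.arr f (s.reg u)))) :
    wp E (replaceIn f u old new) Q s := by
  have hself : s.setArr f (s.reg u) (s.arr f (s.reg u)) = s := by simp [State.setArr]
  simp only [replaceIn, wp, Expr.Safe, Expr.val]
  split_ifs at hQ ⊢ with h <;> simp_all

/-- Replace the neighbor `old` of `u` by `new`. -/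
def replaceNb (u old new : Reg) : Prog := block
  [replaceIn .nb₁ u old new, replaceIn .nb₂ u old new, replaceIn .nb₃ u old new,
    assignMod (.add (.arr .sum u) (.reg new)),
    assignMod (.add (.reg .tmp) (.sub (.reg .n) (.reg old))),
    .store .sum u (.reg .tmp)]

theorem insert_erase_triple {a b c o w : ℕ} (h : o ∈ ({a, b, c} : Finset ℕ)) :
    insert w (({a, b, c} : Finset ℕ).erase o) =
      {if a = o then w else a, if b = o then w else b, if c = o then w else c} := by
  ext u
  simp only [Finset.mem_insert, Finset.mem_singleton, Finset.mem_erase] at h ⊢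
  grind

theorem StoresNeighborhood.insert_erase {n u o w : ℕ} {s s' : State} {A : Finset ℕ}
    (hA : StoresNeighborhood n s u A) (ho : o ∈ A) (hw : w ∉ A) (hwn : w < n)
    (deg : s'.arr .deg u = s.arr .deg u)
    (nb : ∀ f, f = .nb₁ ∨ f = .nb₂ ∨ f = .nb₃ →
      s'.arr f u = if s.arr f u = o then w else s.arr f u)
    (sum : s'.arr .sum u + o ≡ s.arr .sum u + w [MOD n]) (sum_lt : s'.arr .sum u < n) :
    StoresNeighborhood n s' u (insert w (A.erase o)) := by
  have hcard := D3.card_insert_erase hw ho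
  have nb₁ := nb .nb₁ (by simp)
  have nb₂ := nb .nb₂ (by simp)
  have nb₃ := nb .nb₃ (by simp)
  refine ⟨⟨by rw [deg, hA.deg, hcard], modEq_sum_insert_erase hA.sum ho hw sum, sum_lt⟩,
    fun h => ?_, ?_, ?_, ?_⟩
  · have hA3 := hA.nbs (hcard ▸ h)
    rw [nb₁, nb₂, nb₃, ← insert_erase_triple (hA3 ▸ ho), ← hA3]
  · grind [hA.nb₁_lt]
  · grind [hA.nb₂_lt]
  · grind [hA.nb₃_lt]

theorem wp_replaceNb_vertex {E : Env} {s : State} {A : Finset ℕ} {u old new : Reg}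
    (hu : u ≠ .tmp) (hold_tmp : old ≠ .tmp) (hM : 2 * s.reg .n ≤ E.M)
    (hA : StoresNeighborhood (s.reg .n) s (s.reg u) A) (hold : s.reg old ∈ A)
    (hold_lt : s.reg old < s.reg .n) (hnew : s.reg new ∉ A) (hnew_lt : s.reg new < s.reg .n) :
    wp E (replaceNb u old new) (fun s' => AgreeOffVertex (s.reg u) s s' ∧
      StoresNeighborhood (s.reg .n) s' (s.reg u) (insert (s.reg new) (A.erase (s.reg old)))) s := by
  have hsum := hA.sum_lt
  have hmod (a : ℕ) : a % s.reg .n < s.reg .n := Nat.mod_lt _ (by omega)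
  have := hmod (s.arr .sum (s.reg u) + s.reg new)
  simp only [replaceNb, wp_block_cons]
  refine wp_replaceIn (wp_replaceIn (wp_replaceIn (wp_assignMod ?_ ?_ (wp_assignMod ?_ ?_ ?_))))
  · grind [Expr.Safe, Expr.val, State.setArr_reg, State.setArr_arr]
  · grind [Expr.val, State.setArr_reg, State.setArr_arr]
  · grind [Expr.Safe, Expr.val, State.setReg_reg, State.setArr_reg, State.setArr_arr]
  · grind [Expr.val, State.setReg_reg, State.setArr_reg, State.setArr_arr]
  refine ⟨trivial, ⟨fun r hr => by simp [hr], rfl, fun f i hi => by simp [hi, hu]⟩, ?_⟩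
  refine hA.insert_erase hold hnew hnew_lt (by simp) ?_ ?_ ?_
  · rintro f (rfl | rfl | rfl) <;> simp
  · have hmodEq := (add_sub_mod_modEq (a := (s.arr .sum (s.reg u) + s.reg new) % s.reg .n)
      hold_lt.le).trans (Nat.mod_modEq _ _)
    simpa [Expr.val, hu, hold_tmp] using hmodEq
  · simpa [Expr.val, hu] using hmod _

theorem wp_replaceNb {E : Env} {n : ℕ} {s₀ s : State} {N : ℕ → Finset ℕ} {u old new : Reg}
    (hM : 2 * n ≤ E.M) (hn : s₀.reg .n = n) (hs : AgreeOffGraph s₀ s) (hN : Stores n s N)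
    (hu : u ≠ .tmp) (hold_tmp : old ≠ .tmp) (hnew_tmp : new ≠ .tmp) (hun : s₀.reg u < n)
    (hold : s₀.reg old ∈ N (s₀.reg u)) (hold_lt : s₀.reg old < n)
    (hnew : s₀.reg new ∉ N (s₀.reg u)) (hnew_lt : s₀.reg new < n) :
    wp E (replaceNb u old new) (fun s' => AgreeOffGraph s₀ s' ∧ Stores n s' (Function.update N
      (s₀.reg u) (insert (s₀.reg new) ((N (s₀.reg u)).erase (s₀.reg old))))) s := by
  rw [← hs.reg .n (by decide)] at hn
  rw [← hs.reg u hu] at *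
  rw [← hs.reg old hold_tmp] at *
  rw [← hs.reg new hnew_tmp] at *
  subst hn
  exact wp_mono (wp_replaceNb_vertex hu hold_tmp hM (hN _ hun) hold hold_lt hnew hnew_lt)
    fun _ h => (hN.update h.1 h.2).imp_left hs.trans

/-- Remove all edges from the record of the neighborhood of `u`. -/
def clearNbs (u : Reg) : Prog := block [.store .deg u (.const 0), .store .sum u (.const 0)]

theorem wp_clearNbs {E : Env} {n : ℕ} {s₀ s : State} {N : ℕ → Finset ℕ} {u : Reg}
    (hs : AgreeOffGraph s₀ s) (hN : Stores n s N) (hu : u ≠ .tmp) (hun : s₀.reg u < n) :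
    wp E (clearNbs u) (fun s' => AgreeOffGraph s₀ s' ∧
      Stores n s' (Function.update N (s₀.reg u) ∅)) s := by
  rw [← hs.reg u hu] at *
  have hA := hN _ hun
  refine ⟨by simp [Expr.Safe], by simp [Expr.Safe], And.imp_left hs.trans
    (hN.update ⟨fun _ _ => rfl, rfl, fun f i hi => ?_⟩ ⟨⟨?_, ?_, ?_⟩, ?_, ?_, ?_, ?_⟩)⟩
  · simp [hi]
  · simp [Expr.val]
  · simpa [Expr.val] using Nat.ModEq.rfl
  · simpa [Expr.val] using hun.pos
  · simp
  · simpa using hA.nb₁_lt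
  · simpa using hA.nb₂_lt
  · simpa using hA.nb₃_lt

/-- Restore the record of the neighborhood of a vertex `z` of degree three from the sum of its
elements and two of them, `x` and `y`. -/
def restoreNbs : Prog := block
  [.store .nb₁ .z (.reg .x), .store .nb₂ .z (.reg .y),
    assignMod (.add (.arr .sum .z) (.sub (.reg .n) (.reg .x))),
    assignMod (.add (.reg .tmp) (.sub (.reg .n) (.reg .y))),
    .store .nb₃ .z (.reg .tmp)]

theorem third_eq_of_sum_modEq {A : Finset ℕ} {n x y a : ℕ} (hA : A.card = 3) (hx : x ∈ A)
    (hy : y ∈ A) (hxy : x ≠ y) (hlt : ∀ w ∈ A, w < n) (ha : a < n)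
    (hsum : a + y + x ≡ ∑ w ∈ A, w [MOD n]) : A = {x, y, a} := by
  have hyx : y ∈ A.erase x := Finset.mem_erase.2 ⟨hxy.symm, hy⟩
  obtain ⟨c, hc⟩ := Finset.card_eq_one.1 (show ((A.erase x).erase y).card = 1 by
    rw [Finset.card_erase_of_mem hyx, Finset.card_erase_of_mem hx, hA])
  have hac : a ≡ c [MOD n] := by
    have := modEq_sum_erase (modEq_sum_erase hsum hx rfl) hyx rfl
    rwa [hc, Finset.sum_singleton] at this
  have hcA : c ∈ A :=
    Finset.mem_of_mem_erase (Finset.mem_of_mem_erase (hc ▸ Finset.mem_singleton_self c))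
  rw [hac.eq_of_lt_of_lt ha (hlt c hcA), ← hc, Finset.insert_erase hyx, Finset.insert_erase hx]

theorem wp_restoreNbs {E : Env} {s : State} {A : Finset ℕ} (hM : 2 * s.reg .n ≤ E.M)
    (hA : StoresSum (s.reg .n) s (s.reg .z) A) (h3 : A.card = 3) (hlt : ∀ w ∈ A, w < s.reg .n)
    (hx : s.reg .x ∈ A) (hy : s.reg .y ∈ A) (hxy : s.reg .x ≠ s.reg .y) :
    wp E restoreNbs (fun s' => AgreeOffVertex (s.reg .z) s s' ∧
      StoresNeighborhood (s.reg .n) s' (s.reg .z) A) s := by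
  have hxn := hlt _ hx
  have hyn := hlt _ hy
  have hsum_lt := hA.sum_lt
  have hmod (a : ℕ) : a % s.reg .n < s.reg .n := Nat.mod_lt _ (by omega)
  have := hmod (s.arr .sum (s.reg .z) + (s.reg .n - s.reg .x))
  refine ⟨trivial, trivial, wp_assignMod ?_ ?_ (wp_assignMod ?_ ?_ ⟨trivial, ?_, ?_⟩)⟩
  · grind [Expr.Safe, Expr.val, State.setArr_reg, State.setArr_arr]
  · grind [Expr.val, State.setArr_reg, State.setArr_arr]
  · grind [Expr.Safe, Expr.val, State.setReg_reg, State.setArr_reg, State.setArr_arr]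
  · grind [Expr.val, State.setReg_reg, State.setArr_reg, State.setArr_arr]
  · exact ⟨fun r hr => by simp [hr], rfl, fun f i hi => by simp [hi]⟩
  · have third := third_eq_of_sum_modEq h3 hx hy hxy hlt (hmod _)
      (((add_sub_mod_modEq hyn.le).add_right _).trans ((add_sub_mod_modEq hxn.le).trans hA.sum))
    refine ⟨⟨?_, ?_, ?_⟩, ?_, ?_, ?_, ?_⟩
    · simpa using hA.deg
    · simpa using hA.sum
    · simpa using hA.sum_lt
    · simpa [Expr.val] using fun _ => third
    · simpa [Expr.val] using hxn
    · simpa [Expr.val] using hyn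
    · simpa [Expr.val] using hmod _

/-- Remove the neighbor `v` of `z` from the degree and the sum that are recorded for `z`. -/
def subtractNb : Prog := block
  [assignMod (.add (.arr .sum .z) (.sub (.reg .n) (.reg .v))), .store .sum .z (.reg .tmp),
    .store .deg .z (.sub (.arr .deg .z) (.const 1))]

theorem wp_subtractNb {E : Env} {s : State} {A : Finset ℕ} (hM : 2 * s.reg .n ≤ E.M)
    (hA : StoresSum (s.reg .n) s (s.reg .z) A) (hv : s.reg .v ∈ A) (hvn : s.reg .v < s.reg .n) :
    wp E subtractNb (fun s' => AgreeOffVertex (s.reg .z) s s' ∧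
      StoresSum (s.reg .n) s' (s.reg .z) (A.erase (s.reg .v)) ∧
      ∀ f, f ≠ .deg → f ≠ .sum → s'.arr f = s.arr f) s := by
  have hsum_lt := hA.sum_lt
  refine wp_assignMod ?_ ?_ ⟨trivial, ⟨trivial, by simp [Expr.Safe]⟩, ⟨?_, rfl, ?_⟩, ?_, ?_⟩
  · grind [Expr.Safe, Expr.val]
  · grind [Expr.val]
  · exact fun r hr => by simp [hr]
  · exact fun f i hi => by simp [hi]
  · constructor
    · simp [Expr.val, hA.deg, Finset.card_erase_of_mem hv]
    · simpa [Expr.val] using modEq_sum_erase hA.sum hv (add_sub_mod_modEq hvn.le)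
    · simpa [Expr.val] using Nat.mod_lt _ (by omega)
  · intro f hdeg hsum
    ext i
    simp [hdeg, hsum]

/-- Remove the neighbor `v` of `z`, where `x` and `y` are two other neighbors of `z`. -/
def removeNb : Prog := .seq subtractNb (.cond (.eq (.arr .deg .z) (.const 3)) restoreNbs .skip)

theorem wp_removeNb_vertex {E : Env} {s : State} {A : Finset ℕ} (hM : 2 * s.reg .n ≤ E.M)
    (hA : StoresNeighborhood (s.reg .n) s (s.reg .z) A) (hlt : ∀ w ∈ A, w < s.reg .n)
    (hv : s.reg .v ∈ A) (hx : s.reg .x ∈ A) (hy : s.reg .y ∈ A)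
    (hvx : s.reg .v ≠ s.reg .x) (hvy : s.reg .v ≠ s.reg .y) (hxy : s.reg .x ≠ s.reg .y) :
    wp E removeNb (fun s' => AgreeOffVertex (s.reg .z) s s' ∧
      StoresNeighborhood (s.reg .n) s' (s.reg .z) (A.erase (s.reg .v))) s := by
  rw [removeNb, wp]
  refine wp_mono (wp_subtractNb hM hA.toStoresSum hv (hlt _ hv)) ?_
  rintro s' ⟨agree, hsum, hnb⟩
  have hreg r (hr : r ≠ .tmp) : s.reg r = s'.reg r := (agree.reg r hr).symm
  have hdeg_iff : s'.arr .deg (s'.reg .z) = 3 ↔ (A.erase (s.reg .v)).card = 3 := by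
    rw [← hreg .z (by decide), hsum.deg]
  refine ⟨by simp [Expr.Safe], fun hdeg => ?_, fun hdeg => ?_⟩
  · have h3' := hdeg_iff.1 (by grind [Expr.val])
    rw [hreg .z (by decide), hreg .n (by decide)] at *
    refine wp_mono (wp_restoreNbs hM hsum h3' (fun w hw => hlt w (Finset.mem_of_mem_erase hw))
      ?_ ?_ ?_) fun s'' h => ⟨agree.trans h.1, h.2⟩
    all_goals grind
  · have h3' := mt hdeg_iff.2 (by grind [Expr.val])
    refine ⟨agree, hsum, fun h => absurd h h3', ?_, ?_, ?_⟩
    · simpa [hnb] using hA.nb₁_lt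
    · simpa [hnb] using hA.nb₂_lt
    · simpa [hnb] using hA.nb₃_lt

theorem wp_removeNb {E : Env} {n : ℕ} {s₀ s : State} {N : ℕ → Finset ℕ} (hM : 2 * n ≤ E.M)
    (hn : s₀.reg .n = n) (hs : AgreeOffGraph s₀ s) (hN : Stores n s N) (hz : s₀.reg .z < n)
    (hlt : ∀ w ∈ N (s₀.reg .z), w < n) (hv : s₀.reg .v ∈ N (s₀.reg .z))
    (hx : s₀.reg .x ∈ N (s₀.reg .z)) (hy : s₀.reg .y ∈ N (s₀.reg .z))
    (hvx : s₀.reg .v ≠ s₀.reg .x) (hvy : s₀.reg .v ≠ s₀.reg .y) (hxy : s₀.reg .x ≠ s₀.reg .y) :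
    wp E removeNb (fun s' => AgreeOffGraph s₀ s' ∧ Stores n s' (Function.update N
      (s₀.reg .z) ((N (s₀.reg .z)).erase (s₀.reg .v)))) s := by
  have hreg r (hr : r ≠ .tmp) : s₀.reg r = s.reg r := (hs.reg r hr).symm
  rw [hreg .n (by decide)] at hn
  subst hn
  rw [hreg .v (by decide), hreg .x (by decide), hreg .y (by decide), hreg .z (by decide)] at *
  exact wp_mono (wp_removeNb_vertex hM (hN _ hz) hlt hv hx hy hvx hvy hxy)
    fun _ h => (hN.update h.1 h.2).imp_left hs.trans

open D3

/-- Change the neighborhoods in the arrays by rule D3a for the triangle `v`, `x`, `y` with outside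
neighbors `z`, `x'`, `y'`. The vertex `v` becomes the new vertex. -/
def contractTriangle : Prog := block
  [replaceNb .x' .x .v, replaceNb .y' .y .v, replaceNb .v .x .x', replaceNb .v .y .y',
    clearNbs .x, clearNbs .y]

/-- Change the neighborhoods in the arrays by rule D3b for the path `x`, `v`, `y` with apex `z`. -/
def contractPath : Prog := block
  [replaceNb .x .v .y, replaceNb .y .v .x, removeNb, clearNbs .v]

theorem wp_contractTriangle {E : Env} {n : ℕ} {s : State} {G : SimpleGraph ℕ} {N : ℕ → Finset ℕ}
    (hM : 2 * n ≤ E.M) (hn : s.reg .n = n) (hs : Stores n s N) (hN : IsNeighborhood G N)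
    (hlt : ∀ u ∈ G.support, u < n)
    (h : ConfigA G (s.reg .v) (s.reg .x) (s.reg .y) (s.reg .z) (s.reg .x') (s.reg .y')) :
    wp E contractTriangle (fun s' => AgreeOffGraph s s' ∧ Stores n s' (neighborhoodA N (s.reg .v)
      (s.reg .x) (s.reg .y) (s.reg .z) (s.reg .x') (s.reg .y'))) s := by
  have hv := hlt _ ⟨_, h.canA.adj_pq⟩
  have hx := hlt _ ⟨_, h.canA.adj_qr⟩
  have hy := hlt _ ⟨_, h.canA.adj_pr.symm⟩
  have hx' := hlt _ ⟨_, ((h.nbrs_q _).2 (.inr (.inr rfl))).symm⟩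
  have hy' := hlt _ ⟨_, ((h.nbrs_r _).2 (.inr (.inr rfl))).symm⟩
  rw [h.neighborhoodA_eq_update hN]
  have mem : s.reg .x ∈ N (s.reg .x') ∧ s.reg .y ∈ N (s.reg .y') ∧ s.reg .x ∈ N (s.reg .v) ∧
      s.reg .y ∈ N (s.reg .v) := by
    cases h
    grind [IsNeighborhood, HasNeighbors, G.adj_comm]
  have notMem : s.reg .v ∉ N (s.reg .x') ∧ s.reg .v ∉ N (s.reg .y') ∧ s.reg .x' ∉ N (s.reg .v) ∧
      s.reg .y' ∉ N (s.reg .v) := by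
    cases h
    grind [IsNeighborhood, HasNeighbors, G.adj_comm]
  cases h
  refine wp_block_of_wp (wp_replaceNb hM hn ⟨fun _ _ => rfl, rfl⟩ hs (by decide) (by decide)
    (by decide) hx' mem.1 hx notMem.1 hv) fun s₁ ⟨agree₁, stores₁⟩ => ?_
  refine wp_block_of_wp (wp_replaceNb hM hn agree₁ stores₁ (by decide) (by decide) (by decide)
    hy' (by grind) hy (by grind) hv) fun s₂ ⟨agree₂, stores₂⟩ => ?_
  refine wp_block_of_wp (wp_replaceNb hM hn agree₂ stores₂ (by decide) (by decide) (by decide)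
    hv (by grind) hx (by grind) hx') fun s₃ ⟨agree₃, stores₃⟩ => ?_
  refine wp_block_of_wp (wp_replaceNb hM hn agree₃ stores₃ (by decide) (by decide) (by decide)
    hv (by grind) hy (by grind) hy') fun s₄ ⟨agree₄, stores₄⟩ => ?_
  refine wp_block_of_wp (wp_clearNbs agree₄ stores₄ (by decide) hx) fun s₅ ⟨agree₅, stores₅⟩ => ?_
  exact wp_block_of_wp (wp_clearNbs agree₅ stores₅ (by decide) hy) fun _ h => h

theorem wp_contractPath {E : Env} {n : ℕ} {s : State} {G : SimpleGraph ℕ} {N : ℕ → Finset ℕ}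
    {p' r' : ℕ} (hM : 2 * n ≤ E.M) (hn : s.reg .n = n) (hs : Stores n s N)
    (hN : IsNeighborhood G N) (hlt : ∀ u ∈ G.support, u < n)
    (h : ConfigB G (s.reg .x) (s.reg .v) (s.reg .y) (s.reg .z) p' r') :
    wp E contractPath (fun s' => AgreeOffGraph s s' ∧ Stores n s' (neighborhoodB N (s.reg .x)
      (s.reg .v) (s.reg .y) (s.reg .z))) s := by
  have hx := hlt _ ⟨_, h.canB.adj_pq⟩
  have hv := hlt _ ⟨_, h.canB.adj_qr⟩
  have hy := hlt _ ⟨_, h.canB.adj_qr.symm⟩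
  have hz := hlt _ ⟨_, ((h.nbrs_q _).2 (.inr (.inr rfl))).symm⟩
  rw [h.neighborhoodB_eq_update]
  have mem : s.reg .v ∈ N (s.reg .x) ∧ s.reg .v ∈ N (s.reg .y) ∧ s.reg .v ∈ N (s.reg .z) ∧
      s.reg .x ∈ N (s.reg .z) ∧ s.reg .y ∈ N (s.reg .z) := by
    cases h
    grind [IsNeighborhood, HasNeighbors, G.adj_comm]
  have notMem : s.reg .y ∉ N (s.reg .x) ∧ s.reg .x ∉ N (s.reg .y) := by
    have := h.not_adj
    grind [IsNeighborhood, G.adj_comm]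
  have lt : ∀ w ∈ N (s.reg .z), w < n := fun w hw => hlt w ⟨_, ((hN _ _).1 hw).symm⟩
  cases h
  refine wp_block_of_wp (wp_replaceNb hM hn ⟨fun _ _ => rfl, rfl⟩ hs (by decide) (by decide)
    (by decide) hx mem.1 hv notMem.1 hy) fun s₁ ⟨agree₁, stores₁⟩ => ?_
  refine wp_block_of_wp (wp_replaceNb hM hn agree₁ stores₁ (by decide) (by decide) (by decide)
    hy (by grind) hv (by grind) hx) fun s₂ ⟨agree₂, stores₂⟩ => ?_
  refine wp_block_of_wp (wp_removeNb hM hn agree₂ stores₂ hz (by grind) (by grind) (by grind)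
    (by grind) (by grind) (by grind) (by grind)) fun s₃ ⟨agree₃, stores₃⟩ => ?_
  exact wp_block_of_wp (wp_clearNbs agree₃ stores₃ (by decide) hv) fun _ h => h

/-- The registers and arrays represent the graph `G` with neighborhoods `N`, whose vertices are less
than `n`. The register `alive` holds the size of a set of vertices that contains all vertices of
positive degree, and `dsum` holds the sum of the degrees. -/
structure Represents (n : ℕ) (s : State) (G : SimpleGraph ℕ) (N : ℕ → Finset ℕ) : Prop where
  reg_n : s.reg .n = n
  isNeighborhood : IsNeighborhood G N
  stores : Stores n s N
  dsum : s.reg .dsum = ∑ u ∈ Finset.range n, (N u).card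
  exists_support_subset : ∃ A ⊆ Finset.range n, A.card = s.reg .alive ∧ G.support ⊆ A

/-- A reduction at the vertex `v` has changed the graph from `G` to `G'`. The registers `t₁`, `t₂`
and `t₃` hold all vertices of degree three at which this may enable further reductions. -/
structure Reduced (n : ℕ) (s s' : State) (G : SimpleGraph ℕ) (N : ℕ → Finset ℕ)
    (G' : SimpleGraph ℕ) (N' : ℕ → Finset ℕ) : Prop where
  represents : Represents n s' G' N'
  reducibleTo_iff : ReducibleTo G (s.reg .alive) ↔ ReducibleTo G' (s'.reg .alive)
  alive_lt : s'.reg .alive < s.reg .alive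
  sp : s'.reg .sp = s.reg .sp
  stack : s'.arr .stack = s.arr .stack
  done : s'.reg .done = 1
  lt : s'.reg .t₁ < n ∧ s'.reg .t₂ < n ∧ s'.reg .t₃ < n
  mem : ∀ u, (N' u).card = 3 → N' u ≠ N u ∨ u = s.reg .v →
    u ∈ ({s'.reg .t₁, s'.reg .t₂, s'.reg .t₃} : Finset ℕ)

/-- Record a reduction that deletes `d` vertices and decreases the sum of the degrees by `k`. -/
def recordReduction (d k : ℕ) (r₁ r₂ r₃ : Reg) : Prog := block
  [.assign .alive (.sub (.reg .alive) (.const d)), .assign .dsum (.sub (.reg .dsum) (.const k)),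
    .assign .done (.const 1), .assign .t₁ (.reg r₁), .assign .t₂ (.reg r₂), .assign .t₃ (.reg r₃)]

theorem Represents.lt_of_mem_support {n : ℕ} {s : State} {G : SimpleGraph ℕ} {N : ℕ → Finset ℕ}
    (h : Represents n s G N) {u : ℕ} (hu : u ∈ G.support) : u < n := by
  obtain ⟨A, hA, -, hGA⟩ := h.exists_support_subset
  exact Finset.mem_range.1 (hA (hGA hu))

theorem Represents.support_subset {n : ℕ} {s : State} {G : SimpleGraph ℕ} {N : ℕ → Finset ℕ}
    (h : Represents n s G N) : G.support ⊆ (Finset.range n : Finset ℕ) := fun _ hu =>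
  Finset.mem_coe.2 (Finset.mem_range.2 (h.lt_of_mem_support hu))

theorem exists_support_subset_sdiff {G G' : SimpleGraph ℕ} {A R : Finset ℕ} {n : ℕ}
    (hA : A ⊆ Finset.range n) (hGA : G.support ⊆ A) (hR : (R : Set ℕ) ⊆ G.support)
    (hG' : G'.support ⊆ G.support \ R) :
    ∃ A' ⊆ Finset.range n, A'.card + R.card = A.card ∧ G'.support ⊆ A' := by
  have hRA : R ⊆ A := Finset.coe_subset.1 (hR.trans hGA)
  refine ⟨A \ R, Finset.sdiff_subset.trans hA, Finset.card_sdiff_add_card_eq_card hRA, ?_⟩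
  rw [Finset.coe_sdiff]
  exact hG'.trans (Set.sdiff_subset_sdiff_left hGA)

theorem wp_recordReduction {E : Env} {s : State} {d k : ℕ} {r₁ r₂ r₃ : Reg} (hd : d < 16)
    (hk : k < 16) (hr : ∀ r ∈ [r₁, r₂, r₃], r ∉ [.alive, .dsum, .done, .t₁, .t₂]) :
    wp E (recordReduction d k r₁ r₂ r₃) (fun s' => s'.arr = s.arr ∧ s'.reg .n = s.reg .n ∧
      s'.reg .sp = s.reg .sp ∧ s'.reg .alive = s.reg .alive - d ∧
      s'.reg .dsum = s.reg .dsum - k ∧ s'.reg .done = 1 ∧ s'.reg .t₁ = s.reg r₁ ∧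
      s'.reg .t₂ = s.reg r₂ ∧ s'.reg .t₃ = s.reg r₃) s := by
  refine ⟨by simpa [Expr.Safe] using hd, by simpa [Expr.Safe] using hk, by simp [Expr.Safe],
    trivial, trivial, trivial, ?_⟩
  simp only [List.mem_cons] at hr
  simp only [wp_block_nil, State.setReg_reg, State.setReg_arr, Expr.val]
  grind

theorem wp_recordReduction_reduced {E : Env} {n d k : ℕ} {s₀ s : State} {G G' : SimpleGraph ℕ}
    {N N' : ℕ → Finset ℕ} {R : Finset ℕ} {r₁ r₂ r₃ : Reg} (hs₀ : Represents n s₀ G N)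
    (hs : AgreeOffGraph s₀ s) (hN's : Stores n s N') (hN' : IsNeighborhood G' N')
    (step : LocalStep d G G') (hk : k < 16) (hRd : R.card = d)
    (hR : (R : Set ℕ) ⊆ G.support) (hG' : G'.support ⊆ G.support \ R)
    (hsum : ∑ u ∈ Finset.range n, (N' u).card + k = ∑ u ∈ Finset.range n, (N u).card)
    (hr : ∀ r ∈ [r₁, r₂, r₃], r ∉ [.alive, .dsum, .done, .t₁, .t₂, .tmp])
    (hlt : s₀.reg r₁ < n ∧ s₀.reg r₂ < n ∧ s₀.reg r₃ < n)
    (hmem : ∀ u, (N' u).card = 3 → N' u ≠ N u ∨ u = s₀.reg .v →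
      u ∈ ({s₀.reg r₁, s₀.reg r₂, s₀.reg r₃} : Finset ℕ)) :
    wp E (recordReduction d k r₁ r₂ r₃) (fun s' => Reduced n s₀ s' G N G' N') s := by
  obtain ⟨A, hA, hAcard, hGA⟩ := hs₀.exists_support_subset
  obtain ⟨A', hA', hA'card, hGA'⟩ := exists_support_subset_sdiff hA hGA hR hG'
  have hd : 0 < d ∧ d < 16 := by cases step <;> omega
  have alive_eq : s₀.reg .alive - d = A'.card := by omega
  refine wp_mono (wp_recordReduction hd.2 hk fun r hrr => by have := hr r hrr; grind)
    fun s' ⟨arr, reg_n, sp, alive, dsum, done, t₁, t₂, t₃⟩ => ?_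
  have reg_eq r (hrr : r ∈ [r₁, r₂, r₃]) : s.reg r = s₀.reg r :=
    hs.reg r fun h => hr r hrr (by simp [h])
  rw [hs.reg _ (by decide)] at reg_n sp alive dsum
  rw [reg_eq _ (by simp)] at t₁ t₂ t₃
  refine ⟨⟨reg_n.trans hs₀.reg_n, hN', fun u hu => (hN's u hu).congr fun f _ => ?_, ?_, A', hA',
    (alive.trans alive_eq).symm, hGA'⟩, ?_, by omega, sp, ?_, done, by rwa [t₁, t₂, t₃],
    by rwa [t₁, t₂, t₃]⟩
  · rw [arr]
  · rw [dsum, hs₀.dsum]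
    omega
  · rw [alive, alive_eq, ← hAcard, ← hA'card, hRd]
    exact step.reducibleTo_iff
  · rw [arr, hs.stack]

/-- Apply rule D3a to `v`, `x` and `y`, whose outside neighbors are `z`, `x'` and `y'`. -/
def applyA : Prog := .seq contractTriangle (recordReduction 2 6 .v .x' .y')

theorem wp_applyA {E : Env} {n : ℕ} {s : State} {G : SimpleGraph ℕ} {N : ℕ → Finset ℕ}
    (hM : 2 * n ≤ E.M) (hs : Represents n s G N)
    (h : ConfigA G (s.reg .v) (s.reg .x) (s.reg .y) (s.reg .z) (s.reg .x') (s.reg .y')) :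
    wp E applyA (fun s' => ∃ G' N', Reduced n s s' G N G' N') s := by
  rw [applyA, wp]
  refine wp_mono (wp_contractTriangle hM hs.reg_n hs.stores hs.isNeighborhood
    (fun _ => hs.lt_of_mem_support) h) fun s₁ ⟨agree, stores⟩ => ?_
  have lt {u w : ℕ} (hu : G.Adj u w) : u < n := hs.lt_of_mem_support ⟨w, hu⟩
  refine wp_mono (wp_recordReduction_reduced (R := {s.reg .x, s.reg .y}) hs agree stores
    (hs.isNeighborhood.reduceA h) (.d3a h.canA) (by decide) (Finset.card_pair h.ne_qr) ?_ ?_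
    (h.sum_card_neighborhoodA hs.isNeighborhood hs.support_subset) (by decide)
    ⟨lt h.canA.adj_pq, lt ((h.nbrs_q _).2 (.inr (.inr rfl))).symm,
      lt ((h.nbrs_r _).2 (.inr (.inr rfl))).symm⟩ ?_) fun _ h => ⟨_, _, h⟩
  · rw [Finset.coe_pair, Set.pair_subset_iff]
    exact ⟨⟨_, h.canA.adj_qr⟩, _, h.canA.adj_qr.symm⟩
  · rw [Finset.coe_pair]
    exact h.support_reduceA_subset
  · intro u hu htouched
    simp only [neighborhoodA] at hu htouched
    grind

/-- Apply rule D3b to the path `x`, `v`, `y` with apex `z`. -/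
def applyB : Prog := .seq contractPath (recordReduction 1 4 .x .y .z)

theorem wp_applyB {E : Env} {n : ℕ} {s : State} {G : SimpleGraph ℕ} {N : ℕ → Finset ℕ}
    {p' r' : ℕ} (hM : 2 * n ≤ E.M) (hs : Represents n s G N)
    (h : ConfigB G (s.reg .x) (s.reg .v) (s.reg .y) (s.reg .z) p' r') :
    wp E applyB (fun s' => ∃ G' N', Reduced n s s' G N G' N') s := by
  rw [applyB, wp]
  refine wp_mono (wp_contractPath hM hs.reg_n hs.stores hs.isNeighborhood
    (fun _ => hs.lt_of_mem_support) h) fun s₁ ⟨agree, stores⟩ => ?_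
  have lt {u w : ℕ} (hu : G.Adj u w) : u < n := hs.lt_of_mem_support ⟨w, hu⟩
  refine wp_mono (wp_recordReduction_reduced (R := {s.reg .v}) hs agree stores
    (hs.isNeighborhood.reduceB h) (.d3b h.canB) (by decide) (Finset.card_singleton _) ?_ ?_
    (h.sum_card_neighborhoodB hs.isNeighborhood hs.support_subset) (by decide)
    ⟨lt h.canB.adj_pq, lt h.canB.adj_qr.symm, lt ((h.nbrs_q _).2 (.inr (.inr rfl))).symm⟩ ?_)
    fun _ h => ⟨_, _, h⟩
  · rw [Finset.coe_singleton, Set.singleton_subset_iff]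
    exact ⟨_, h.canB.adj_qr⟩
  · rw [Finset.coe_singleton]
    exact h.support_reduceB_subset
  · intro u hu htouched
    simp only [neighborhoodB] at hu htouched
    grind

/-- The states agree except for the registers that hold neighbors of `v`, the registers that are set
by a reduction, and the temporary registers. -/
structure AgreeOffLocals (s s' : State) : Prop where
  arr : s'.arr = s.arr
  reg : ∀ r ∈ [Reg.n, .sp, .alive, .dsum, .v, .done], s'.reg r = s.reg r

theorem AgreeOffLocals.trans {s s' s'' : State} (h : AgreeOffLocals s s')
    (h' : AgreeOffLocals s' s'') : AgreeOffLocals s s'' where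
  arr := h'.arr.trans h.arr
  reg r hr := (h'.reg r hr).trans (h.reg r hr)

theorem AgreeOffLocals.setReg {s : State} {r : Reg} {a : ℕ}
    (hr : r ∉ [Reg.n, .sp, .alive, .dsum, .v, .done]) : AgreeOffLocals s (s.setReg r a) where
  arr := rfl
  reg r' hr' := by
    rw [State.setReg_reg, if_neg (by grind)]

theorem Represents.congr {n : ℕ} {s s' : State} {G : SimpleGraph ℕ} {N : ℕ → Finset ℕ}
    (h : Represents n s G N) (hreg : ∀ r ∈ [Reg.n, .alive, .dsum], s'.reg r = s.reg r)
    (harr : ∀ f, f ≠ .stack → s'.arr f = s.arr f) : Represents n s' G N where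
  reg_n := (hreg _ (by decide)).trans h.reg_n
  isNeighborhood := h.isNeighborhood
  stores u hu := (h.stores u hu).congr fun f hf => by rw [harr f hf]
  dsum := (hreg _ (by decide)).trans h.dsum
  exists_support_subset := by simpa only [hreg .alive (by decide)] using h.exists_support_subset

theorem AgreeOffLocals.represents {n : ℕ} {s s' : State} {G : SimpleGraph ℕ} {N : ℕ → Finset ℕ}
    (h : AgreeOffLocals s s') (hs : Represents n s G N) : Represents n s' G N :=
  hs.congr (fun r hr => h.reg r (by grind)) fun f _ => by rw [h.arr]

theorem AgreeOffLocals.reduced {n : ℕ} {s s' s'' : State} {G G' : SimpleGraph ℕ}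
    {N N' : ℕ → Finset ℕ} (h : AgreeOffLocals s s') (hr : Reduced n s' s'' G N G' N') :
    Reduced n s s'' G N G' N' := by
  have alive := h.reg .alive (by decide)
  have sp := h.reg .sp (by decide)
  have v := h.reg .v (by decide)
  cases hr
  constructor <;> grind [AgreeOffLocals]

/-- The state `s` arises from `s₀` either by unsuccessful attempts, which establish `P`, or by a
reduction of the graph `G`. -/
def Attempted (n : ℕ) (s₀ : State) (G : SimpleGraph ℕ) (N : ℕ → Finset ℕ) (P : Prop)
    (s : State) : Prop :=
  (AgreeOffLocals s₀ s ∧ P) ∨ ∃ G₁ N₁, Reduced n s₀ s G N G₁ N₁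

/-- The register `w` holds one of the three neighbors of `u`. -/
def isNb (u w : Reg) : Expr :=
  .or (.eq (.arr .nb₁ u) (.reg w)) (.or (.eq (.arr .nb₂ u) (.reg w)) (.eq (.arr .nb₃ u) (.reg w)))

/-- The neighbor of `u` other than `a` and `b`, if `u` has three neighbors. -/
def thirdNb (u a b : Reg) : Expr :=
  .sub (.sub (.add (.add (.arr .nb₁ u) (.arr .nb₂ u)) (.arr .nb₃ u)) (.reg a)) (.reg b)

/-- Apply rule D3a to the triangle `v`, `x`, `y` unless its outside neighbors coincide. -/
def tryTriangle : Prog := block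
  [.assign .x' (thirdNb .x .v .y), .assign .y' (thirdNb .y .v .x),
    .cond (.or (.eq (.reg .z) (.reg .x')) (.or (.eq (.reg .z) (.reg .y'))
      (.eq (.reg .x') (.reg .y')))) .skip applyA]

/-- Apply rule D3b to the path `x`, `v`, `y` if `z` is an apex. -/
def tryPath : Prog :=
  .cond (isNb .x .z) (.cond (isNb .y .z) applyB .skip) .skip

/-- Apply a reduction to `v` and its neighbors `x` and `y` if possible, where `z` is the third
neighbor of `v`. -/
def tryReduce : Prog :=
  .cond (.eq (.arr .deg .x) (.const 3))
    (.cond (.eq (.arr .deg .y) (.const 3)) (.cond (isNb .x .y) tryTriangle tryPath) .skip) .skip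

section Reduce

variable {E : Env} {n : ℕ} {s : State} {G : SimpleGraph ℕ} {N : ℕ → Finset ℕ}

theorem isNb_safe {u w : Reg} : (isNb u w).Safe E s := by
  simp [isNb, Expr.Safe]

theorem Represents.isNb_ne_zero_iff (hs : Represents n s G N) {u w : Reg} (hu : s.reg u < n)
    (h3 : (N (s.reg u)).card = 3) :
    (isNb u w).val E s ≠ 0 ↔ G.Adj (s.reg u) (s.reg w) := by
  rw [← hs.isNeighborhood, (hs.stores _ hu).nbs h3]
  grind [isNb, Expr.val]

theorem wp_assign_thirdNb (hM : 3 * n ≤ E.M) (hs : Represents n s G N) (r : Reg) {u a b : Reg}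
    (hu : s.reg u < n) (h3 : (N (s.reg u)).card = 3) (ha : G.Adj (s.reg u) (s.reg a))
    (hb : G.Adj (s.reg u) (s.reg b)) (hab : s.reg a ≠ s.reg b) :
    wp E (.assign r (thirdNb u a b)) (fun s' => ∃ c, s' = s.setReg r c ∧
      HasNeighbors G (s.reg u) (s.reg a) (s.reg b) c ∧ c ≠ s.reg a ∧ c ≠ s.reg b) s := by
  have stored := hs.stores _ hu
  have nbs := stored.nbs h3
  rw [← hs.isNeighborhood, nbs] at ha hb
  obtain ⟨ne_a, ne_b, eq⟩ := third_eq_add_sub (nbs ▸ h3) ha hb hab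
  have := stored.nb₁_lt
  have := stored.nb₂_lt
  have := stored.nb₃_lt
  refine ⟨by grind [thirdNb, Expr.Safe, Expr.val], _, rfl, fun w => ?_, ne_a, ne_b⟩
  rw [← hs.isNeighborhood, nbs, eq]
  simp [thirdNb, Expr.val]

theorem wp_tryTriangle (hM : 3 * n ≤ E.M) (hs : Represents n s G N)
    (hv : HasNeighbors G (s.reg .v) (s.reg .x) (s.reg .y) (s.reg .z))
    (hz : s.reg .z ≠ s.reg .x ∧ s.reg .z ≠ s.reg .y) (hx : (N (s.reg .x)).card = 3)
    (hy : (N (s.reg .y)).card = 3) (hxy : G.Adj (s.reg .x) (s.reg .y)) :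
    wp E tryTriangle (Attempted n s G N (¬ CanA G (s.reg .v) (s.reg .x) (s.reg .y))) s := by
  have hvx := (hv _).2 (.inl rfl)
  have hvy := (hv _).2 (.inr (.inl rfl))
  have hxn := hs.lt_of_mem_support ⟨_, hxy⟩
  have hyn := hs.lt_of_mem_support ⟨_, hxy.symm⟩
  refine wp_block_of_wp (wp_assign_thirdNb hM hs _ hxn hx hvx.symm hxy hvy.ne)
    fun _ ⟨c, hc, nbrs_x, ne_x⟩ => ?_
  have agree₁ : AgreeOffLocals s (s.setReg .x' c) := .setReg (by decide)
  refine wp_block_of_wp (wp_assign_thirdNb hM (hc ▸ agree₁.represents hs) _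
    (by simpa [hc] using hyn) (by simpa [hc] using hy) (by simpa [hc] using hvy.symm)
    (by simpa [hc] using hxy.symm) (by simpa [hc] using hvx.ne)) fun s' ⟨d, hd, nbrs_y, ne_y⟩ => ?_
  have agree₂ : AgreeOffLocals s s' := by
    rw [hd, hc]
    exact agree₁.trans (.setReg (by decide))
  simp only [hc, State.setReg_reg, reduceCtorEq, if_false] at nbrs_y ne_y
  have reg r : s'.reg r = if r = .y' then d else if r = .x' then c else s.reg r := by
    simp [hd, hc]
  rw [wp_block_singleton, wp]
  refine ⟨by simp [Expr.Safe], fun coincide => .inl ⟨agree₂, fun can => ?_⟩,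
    fun distinct => wp_mono (wp_applyA (by omega) (agree₂.represents hs) ?_)
      fun _ ⟨G', N', h⟩ => .inr ⟨G', N', agree₂.reduced h⟩⟩
  · have := can.ne_of_hasNeighbors hv nbrs_x nbrs_y
    simp only [Expr.val, reg, reduceCtorEq, if_true, if_false] at coincide
    grind
  · simp only [Expr.val, reg, reduceCtorEq, if_true, if_false] at distinct ⊢
    exact .of_hasNeighbors hv nbrs_x nbrs_y hz ne_x ne_y (by grind)

theorem wp_tryPath (hM : 2 * n ≤ E.M) (hs : Represents n s G N)
    (hv : HasNeighbors G (s.reg .v) (s.reg .x) (s.reg .y) (s.reg .z))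
    (hvn : DegThree G (s.reg .v)) (hne : s.reg .x ≠ s.reg .y) (hx : (N (s.reg .x)).card = 3)
    (hy : (N (s.reg .y)).card = 3) (hxy : ¬ G.Adj (s.reg .x) (s.reg .y)) :
    wp E tryPath (Attempted n s G N (¬ CanB G (s.reg .x) (s.reg .v) (s.reg .y))) s := by
  have hvx := (hv _).2 (.inl rfl)
  have hvy := (hv _).2 (.inr (.inl rfl))
  have hvz := (hv _).2 (.inr (.inr rfl))
  have adj_x := hs.isNb_ne_zero_iff (E := E) (u := .x) (w := .z)
    (hs.lt_of_mem_support ⟨_, hvx.symm⟩) hx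
  have adj_y := hs.isNb_ne_zero_iff (E := E) (u := .y) (w := .z)
    (hs.lt_of_mem_support ⟨_, hvy.symm⟩) hy
  have unchanged : AgreeOffLocals s s := ⟨rfl, fun _ _ => rfl⟩
  have apex (h : CanB G (s.reg .x) (s.reg .v) (s.reg .y)) :
      G.Adj (s.reg .x) (s.reg .z) ∧ G.Adj (s.reg .y) (s.reg .z) := by
    obtain ⟨p', r', config⟩ := h.exists_configB_of_hasNeighbors hv
    exact ⟨(config.nbrs_p _).2 (.inr (.inl rfl)), (config.nbrs_r _).2 (.inr (.inl rfl))⟩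
  refine ⟨isNb_safe, fun hxz => ⟨isNb_safe, fun hyz => ?_, fun hyz => ?_⟩, fun hxz => ?_⟩
  · have can : CanB G (s.reg .x) (s.reg .v) (s.reg .y) :=
      ⟨hs.isNeighborhood.degThree_iff.2 hx, hvn, hs.isNeighborhood.degThree_iff.2 hy,
        hvx.symm, hvy, hne, hxy, _, (adj_x.1 hxz).symm, hvz.symm, (adj_y.1 hyz).symm⟩
    obtain ⟨p', r', config⟩ := can.exists_configB_of_hasNeighbors hv
    exact wp_mono (wp_applyB hM hs config) fun _ h => .inr h
  · exact .inl ⟨unchanged, fun can => adj_y.2 (apex can).2 hyz⟩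
  · exact .inl ⟨unchanged, fun can => adj_x.2 (apex can).1 hxz⟩

theorem wp_tryReduce (hM : 3 * n ≤ E.M) (hs : Represents n s G N)
    (hv : HasNeighbors G (s.reg .v) (s.reg .x) (s.reg .y) (s.reg .z))
    (hv3 : (N (s.reg .v)).card = 3) (hne : s.reg .x ≠ s.reg .y)
    (hz : s.reg .z ≠ s.reg .x ∧ s.reg .z ≠ s.reg .y) :
    wp E tryReduce (Attempted n s G N (¬ CanA G (s.reg .v) (s.reg .x) (s.reg .y) ∧
      ¬ CanB G (s.reg .x) (s.reg .v) (s.reg .y))) s := by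
  have degThree_iff u : DegThree G u ↔ (N u).card = 3 := hs.isNeighborhood.degThree_iff
  have hxn := hs.lt_of_mem_support ⟨_, ((hv (s.reg .x)).2 (.inl rfl)).symm⟩
  have hyn := hs.lt_of_mem_support ⟨_, ((hv (s.reg .y)).2 (.inr (.inl rfl))).symm⟩
  have unchanged : AgreeOffLocals s s := ⟨rfl, fun _ _ => rfl⟩
  have deg_x : (Expr.eq (.arr .deg .x) (.const 3)).val E s ≠ 0 ↔ (N (s.reg .x)).card = 3 := by
    simp [Expr.val, (hs.stores _ hxn).deg]
  have deg_y : (Expr.eq (.arr .deg .y) (.const 3)).val E s ≠ 0 ↔ (N (s.reg .y)).card = 3 := by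
    simp [Expr.val, (hs.stores _ hyn).deg]
  have safe (r : Reg) : (Expr.eq (.arr .deg r) (.const 3)).Safe E s := by simp [Expr.Safe]
  refine ⟨safe _, fun hx => ⟨safe _, fun hy => ?_, fun hy => .inl ⟨unchanged, ?_, ?_⟩⟩,
    fun hx => .inl ⟨unchanged, ?_, ?_⟩⟩
  · have adj := hs.isNb_ne_zero_iff (E := E) (w := .y) hxn (deg_x.1 hx)
    refine ⟨isNb_safe, fun hxy => ?_, fun hxy => ?_⟩
    · exact wp_mono (wp_tryTriangle hM hs hv hz (deg_x.1 hx) (deg_y.1 hy) (adj.1 hxy)) fun _ h =>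
        h.imp_left (.imp_right fun notA => ⟨notA, fun can => can.not_adj_pr (adj.1 hxy)⟩)
    · have hxy : ¬ G.Adj (s.reg .x) (s.reg .y) := fun h => adj.2 h hxy
      exact wp_mono (wp_tryPath (by omega) hs hv ((degThree_iff _).2 hv3) hne (deg_x.1 hx)
        (deg_y.1 hy) hxy) fun _ h =>
        h.imp_left (.imp_right fun notB => ⟨fun can => hxy can.adj_qr, notB⟩)
  · exact fun can => deg_y.2 ((degThree_iff _).1 can.deg_r) hy
  · exact fun can => deg_y.2 ((degThree_iff _).1 can.deg_r) hy
  · exact fun can => deg_x.2 ((degThree_iff _).1 can.deg_q) hx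
  · exact fun can => deg_x.2 ((degThree_iff _).1 can.deg_p) hx

/-- Load the neighbors of `v` from the arrays `f₁`, `f₂` and `f₃` into `x`, `y` and `z`. -/
def loadNbs (f₁ f₂ f₃ : ArrayName) : Prog :=
  block [.assign .x (.arr f₁ .v), .assign .y (.arr f₂ .v), .assign .z (.arr f₃ .v)]

theorem wp_loadNbs {f₁ f₂ f₃ : ArrayName} :
    wp E (loadNbs f₁ f₂ f₃) (fun s' => AgreeOffLocals s s' ∧ s'.reg .x = s.arr f₁ (s.reg .v) ∧
      s'.reg .y = s.arr f₂ (s.reg .v) ∧ s'.reg .z = s.arr f₃ (s.reg .v)) s :=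
  ⟨trivial, trivial, trivial, ((AgreeOffLocals.setReg (by decide)).trans
    (.setReg (by decide))).trans (.setReg (by decide)), rfl, rfl, rfl⟩

/-- Unless there has been a reduction, try to reduce at `v` and the neighbors of `v` in the arrays
`f₁` and `f₂`, where `f₃` holds the third neighbor. -/
def attempt (f₁ f₂ f₃ : ArrayName) : Prog :=
  .cond (.reg .done) .skip (.seq (loadNbs f₁ f₂ f₃) tryReduce)

theorem wp_attempt {s' : State} {P : Prop} {f₁ f₂ f₃ : ArrayName} (hM : 3 * n ≤ E.M)
    (hs : Represents n s G N) (done : s.reg .done = 0) (h3 : (N (s.reg .v)).card = 3)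
    (hN : N (s.reg .v) = {s.arr f₁ (s.reg .v), s.arr f₂ (s.reg .v), s.arr f₃ (s.reg .v)})
    (hs' : Attempted n s G N P s') :
    wp E (attempt f₁ f₂ f₃) (Attempted n s G N (P ∧
      ¬ CanA G (s.reg .v) (s.arr f₁ (s.reg .v)) (s.arr f₂ (s.reg .v)) ∧
      ¬ CanB G (s.arr f₁ (s.reg .v)) (s.reg .v) (s.arr f₂ (s.reg .v)))) s' := by
  rw [attempt, wp]
  obtain ⟨agree, hP⟩ | ⟨G', N', reduced⟩ := hs'
  · refine ⟨trivial, fun h => absurd ((agree.reg .done (by decide)).trans done) h, fun _ => ?_⟩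
    rw [wp]
    refine wp_mono wp_loadNbs fun s₁ ⟨agree₁, hx, hy, hz⟩ => ?_
    rw [agree.arr, agree.reg .v (by decide)] at hx hy hz
    replace agree₁ := agree.trans agree₁
    have hv : s₁.reg .v = s.reg .v := agree₁.reg .v (by decide)
    rw [← hx, ← hy, ← hz, ← hv] at hN
    rw [← hx, ← hy, ← hv]
    rw [← hv] at h3
    have distinct := h3
    rw [hN] at distinct
    simp only [Finset.card_insert_eq_ite, Finset.card_singleton] at distinct
    refine wp_mono (wp_tryReduce hM (agree₁.represents hs) (fun w => ?_) h3 (by grind) (by grind))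
      fun s₂ h => ?_
    · rw [← hs.isNeighborhood, hN]
      simp
    · exact h.imp (fun ⟨agree₂, h⟩ => ⟨agree₁.trans agree₂, hP, h⟩)
        fun ⟨G', N', h⟩ => ⟨G', N', agree₁.reduced h⟩
  · exact ⟨trivial, fun _ => .inr ⟨G', N', reduced⟩, fun h => by simp [Expr.val, reduced.done] at h⟩

/-- Try all reductions at `v`. -/
def attemptAll : Prog :=
  block [attempt .nb₁ .nb₂ .nb₃, attempt .nb₂ .nb₃ .nb₁, attempt .nb₃ .nb₁ .nb₂]

theorem wp_attemptAll (hM : 3 * n ≤ E.M) (hs : Represents n s G N) (hv : s.reg .v < n)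
    (done : s.reg .done = 0) (h3 : (N (s.reg .v)).card = 3) :
    wp E attemptAll (Attempted n s G N (¬ Active G (s.reg .v))) s := by
  have nbs := (hs.stores _ hv).nbs h3
  have unchanged : Attempted n s G N True s := .inl ⟨⟨rfl, fun _ _ => rfl⟩, trivial⟩
  refine wp_block_of_wp (wp_attempt hM hs done h3 nbs unchanged) fun s₁ h₁ =>
    wp_block_of_wp (wp_attempt hM hs done h3 (by grind) h₁) fun s₂ h₂ =>
    wp_block_singleton.2 (wp_mono (wp_attempt hM hs done h3 (by grind) h₂) fun s₃ h₃ =>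
      h₃.imp_left fun ⟨agree, ⟨⟨_, h₁₂⟩, h₂₃⟩, h₃₁⟩ =>
        ⟨agree, HasNeighbors.not_active (fun w => ?_) h₁₂ h₂₃ h₃₁⟩)
  rw [← hs.isNeighborhood, nbs]
  simp

end Reduce

/-- The vertex `u` is one of the first `sp` entries of the array `stack`. -/
def OnStack (s : State) (u : ℕ) : Prop :=
  ∃ i < s.reg .sp, s.arr .stack i = u

/-- The state `s'` arises from `s` by pushing the entries of `l` on the stack. -/
structure Pushed (s s' : State) (l : List ℕ) : Prop where
  reg : ∀ r, r ≠ .sp → s'.reg r = s.reg r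
  arr : ∀ f, f ≠ .stack → s'.arr f = s.arr f
  sp : s'.reg .sp = s.reg .sp + l.length
  onStack_iff : ∀ u, OnStack s' u ↔ OnStack s u ∨ u ∈ l

theorem Pushed.trans {s s' s'' : State} {l l' : List ℕ} (h : Pushed s s' l)
    (h' : Pushed s' s'' l') : Pushed s s'' (l ++ l') where
  reg r hr := (h'.reg r hr).trans (h.reg r hr)
  arr f hf := (h'.arr f hf).trans (h.arr f hf)
  sp := by rw [h'.sp, h.sp, List.length_append, add_assoc]
  onStack_iff u := by rw [h'.onStack_iff, h.onStack_iff, List.mem_append, or_assoc]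

/-- Push the value of `e` on the stack. -/
def push (e : Expr) : Prog :=
  block [.store .stack .sp e, .assign .sp (.add (.reg .sp) (.const 1))]

/-- The vertex in the register `t`, followed by the three vertices that are recorded as its
neighbors. -/
def recorded (s : State) (t : Reg) : List ℕ :=
  [s.reg t, s.arr .nb₁ (s.reg t), s.arr .nb₂ (s.reg t), s.arr .nb₃ (s.reg t)]

theorem length_recorded (s : State) (t : Reg) : (recorded s t).length = 4 := rfl

/-- Push the vertex in the register `t` and its recorded neighbors on the stack. -/
def pushRecorded (t : Reg) : Prog :=
  block [push (.reg t), push (.arr .nb₁ t), push (.arr .nb₂ t), push (.arr .nb₃ t)]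

/-- Push the vertices at which the last reduction may enable further reductions on the stack. -/
def pushReduced : Prog := block [pushRecorded .t₁, pushRecorded .t₂, pushRecorded .t₃]

/-- Pop the vertex `v` from the stack. -/
def pop : Prog := block
  [.assign .sp (.sub (.reg .sp) (.const 1)), .assign .v (.arr .stack .sp),
    .assign .done (.const 0)]

/-- The state `s'` arises from `s` by popping the vertex `v` from the stack. -/
structure Popped (s s' : State) : Prop where
  reg : ∀ r, r ∉ [Reg.sp, .v, .done] → s'.reg r = s.reg r
  arr : s'.arr = s.arr
  done : s'.reg .done = 0
  sp : s'.reg .sp + 1 = s.reg .sp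
  onStack_iff : ∀ u, OnStack s u ↔ OnStack s' u ∨ u = s'.reg .v

section Stack

variable {E : Env} {s : State}

theorem wp_push {e : Expr} (hM : s.reg .sp + 1 < E.M) (he : e.Safe E s) :
    wp E (push e) (fun s' => Pushed s s' [e.val E s]) s := by
  refine ⟨he, ?_, ?_, ?_, ?_, ?_⟩
  · have := E.le_M
    grind [Expr.Safe, Expr.val, State.setArr_reg]
  · intro r hr
    simp [hr]
  · intro f hf
    funext i
    simp [hf]
  · simp [Expr.val]
  · intro u
    simp only [OnStack, Expr.val, State.setReg_reg, State.setArr_reg, State.setReg_arr,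
      State.setArr_arr, if_true, List.mem_singleton, Nat.exists_lt_succ_right]
    grind

theorem wp_pushRecorded {t : Reg} (ht : t ≠ .sp) (hM : s.reg .sp + 4 < E.M) :
    wp E (pushRecorded t) (fun s' => Pushed s s' (recorded s t)) s := by
  refine wp_block_of_wp (wp_push (by omega) trivial) fun s₁ h₁ =>
    wp_block_of_wp (wp_push ?_ trivial) fun s₂ h₂ => wp_block_of_wp (wp_push ?_ trivial)
      fun s₃ h₃ => wp_block_singleton.2 (wp_mono (wp_push ?_ trivial) fun s₄ h₄ => ?_)
  · have := h₁.sp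
    grind
  · have := (h₁.trans h₂).sp
    grind
  · have := ((h₁.trans h₂).trans h₃).sp
    grind
  · have h := ((h₁.trans h₂).trans h₃).trans h₄
    simp only [Expr.val, h₃.arr .nb₃ (by decide), h₂.arr .nb₃ (by decide), h₁.arr .nb₃ (by decide),
      h₂.arr .nb₂ (by decide), h₁.arr .nb₂ (by decide), h₁.arr .nb₁ (by decide), h₃.reg t ht,
      h₂.reg t ht, h₁.reg t ht] at h
    exact h

theorem Pushed.recorded_eq {s' : State} {l : List ℕ} {t : Reg} (h : Pushed s s' l) (ht : t ≠ .sp) :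
    recorded s' t = recorded s t := by
  simp [recorded, h.reg t ht, h.arr]

theorem wp_pushReduced (hM : s.reg .sp + 12 < E.M) :
    wp E pushReduced
      (fun s' => Pushed s s' (recorded s .t₁ ++ recorded s .t₂ ++ recorded s .t₃)) s := by
  refine wp_block_of_wp (wp_pushRecorded (by decide) (by omega)) fun s₁ h₁ =>
    wp_block_of_wp (wp_pushRecorded (by decide) ?_) fun s₂ h₂ =>
      wp_block_singleton.2 (wp_mono (wp_pushRecorded (by decide) ?_) fun s₃ h₃ => ?_)
  · rw [h₁.sp, length_recorded]
    omega
  · rw [h₂.sp, h₁.sp, length_recorded, length_recorded]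
    omega
  · rw [(h₁.trans h₂).recorded_eq (by decide)] at h₃
    rw [h₁.recorded_eq (by decide)] at h₂
    exact (h₁.trans h₂).trans h₃

theorem wp_pop (hs : 0 < s.reg .sp) : wp E pop (Popped s) s := by
  refine ⟨by simp [Expr.Safe], trivial, by simp [Expr.Safe], ?_, rfl, rfl, ?_, ?_⟩
  · intro r hr
    simp only [List.mem_cons, List.not_mem_nil, not_or] at hr
    simp [hr]
  · simp only [Expr.val, State.setReg_reg, reduceCtorEq, if_true, if_false]
    omega
  · intro u
    obtain ⟨k, hk⟩ := Nat.exists_eq_add_one_of_ne_zero hs.ne'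
    simp only [OnStack, Expr.val, State.setReg_reg, State.setReg_arr, reduceCtorEq, if_true,
      if_false, hk, Nat.exists_lt_succ_right, Nat.add_sub_cancel, eq_comm (a := u)]

end Stack

/-- Process the vertex on the top of the stack. -/
def reduceTop : Prog := block
  [pop, .cond (.eq (.arr .deg .v) (.const 3))
    (.seq attemptAll (.cond (.reg .done) pushReduced .skip)) .skip]

/-- The potential that decreases whenever a vertex is processed: a reduction pushes twelve entries
on the stack and deletes a vertex. -/
def potential (s : State) : ℕ :=
  s.reg .sp + 13 * s.reg .alive

/-- The graph `G`, which has been obtained from `G₀` by reductions, is represented, and all vertices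
at which a reduction applies are on the stack. -/
structure ReduceInv (n : ℕ) (G₀ : SimpleGraph ℕ) (s : State) (G : SimpleGraph ℕ)
    (N : ℕ → Finset ℕ) : Prop where
  represents : Represents n s G N
  reducibleTo_iff : ReducibleTo G₀ n ↔ ReducibleTo G (s.reg .alive)
  lt_of_onStack : ∀ u, OnStack s u → u < n
  onStack : ∀ u, Active G u → OnStack s u
  potential_le : potential s ≤ 14 * n

section Reduce

variable {E : Env} {n : ℕ} {s s' s'' : State} {G₀ G G' : SimpleGraph ℕ} {N N' : ℕ → Finset ℕ}

theorem Represents.mem_recorded (h : Represents n s G N) {u : ℕ} {t : Reg} (ht : s.reg t < n)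
    (h3 : (N (s.reg t)).card = 3) : u ∈ recorded s t ↔ u = s.reg t ∨ G.Adj (s.reg t) u := by
  rw [← h.isNeighborhood, (h.stores _ ht).nbs h3]
  simp [recorded]

theorem Represents.lt_of_mem_recorded (h : Represents n s G N) {u : ℕ} {t : Reg}
    (ht : s.reg t < n) (hu : u ∈ recorded s t) : u < n := by
  have := (h.stores _ ht).nb₁_lt
  have := (h.stores _ ht).nb₂_lt
  have := (h.stores _ ht).nb₃_lt
  simp only [recorded, List.mem_cons, List.not_mem_nil] at hu
  grind

theorem Reduced.active_or_mem_recorded (hN : IsNeighborhood G N) (h : Reduced n s s' G N G' N')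
    {u : ℕ} (hu : Active G' u) : (Active G u ∧ u ≠ s.reg .v) ∨
      u ∈ recorded s' .t₁ ++ recorded s' .t₂ ++ recorded s' .t₃ := by
  have hN' := h.represents.isNeighborhood
  by_cases changed : ∃ w, DegThree G' w ∧ (w = u ∨ G'.Adj u w) ∧ (N' w ≠ N w ∨ w = s.reg .v)
  · obtain ⟨w, hw, hwu, hchanged⟩ := changed
    rw [hN'.degThree_iff] at hw
    have mem := h.mem w hw hchanged
    have mem_recorded (t : Reg) (ht : s'.reg t < n) (hwt : w = s'.reg t) : u ∈ recorded s' t :=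
      (h.represents.mem_recorded ht (hwt ▸ hw)).2 (hwt ▸ hwu.imp Eq.symm SimpleGraph.Adj.symm)
    simp only [Finset.mem_insert, Finset.mem_singleton] at mem
    simp only [List.mem_append]
    rcases mem with hwt | hwt | hwt
    · exact .inr (.inl (.inl (mem_recorded _ h.lt.1 hwt)))
    · exact .inr (.inl (.inr (mem_recorded _ h.lt.2.1 hwt)))
    · exact .inr (.inr (mem_recorded _ h.lt.2.2 hwt))
  · refine .inl ⟨hu.of_adj_iff fun w hw hwu t => ?_, fun huv => changed
      ⟨u, hu.degThree, .inl rfl, .inr huv⟩⟩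
    rw [← hN, ← hN', not_ne_iff.1 fun hne => changed ⟨w, hw, hwu, .inl hne⟩]

theorem ReduceInv.of_not_active (h : ReduceInv n G₀ s G N) (hpop : Popped s s')
    (agree : AgreeOffLocals s' s'') (hv : ¬ Active G (s'.reg .v)) : ReduceInv n G₀ s'' G N := by
  have hrep := h.represents.congr (s' := s') (fun r hr => hpop.reg r (by grind)) fun f _ => by
    rw [hpop.arr]
  have alive : s''.reg .alive = s.reg .alive :=
    (agree.reg _ (by decide)).trans (hpop.reg _ (by decide))
  have sp : s''.reg .sp = s'.reg .sp := agree.reg _ (by decide)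
  have onStack_iff u : OnStack s'' u ↔ OnStack s' u := by
    rw [OnStack, OnStack, sp, agree.arr]
  refine ⟨agree.represents hrep, alive ▸ h.reducibleTo_iff, fun u hu => ?_, fun u hu => ?_, ?_⟩
  · exact h.lt_of_onStack u ((hpop.onStack_iff u).2 (.inl ((onStack_iff u).1 hu)))
  · refine (onStack_iff u).2 (((hpop.onStack_iff u).1 (h.onStack u hu)).resolve_right ?_)
    exact fun huv => hv (huv ▸ hu)
  · have := h.potential_le
    rw [potential] at this ⊢
    have := hpop.sp
    omega

theorem ReduceInv.of_reduced {s''' : State} (h : ReduceInv n G₀ s G N) (hpop : Popped s s')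
    (hred : Reduced n s' s'' G N G' N') (hpush : Pushed s'' s'''
      (recorded s'' .t₁ ++ recorded s'' .t₂ ++ recorded s'' .t₃)) : ReduceInv n G₀ s''' G' N' := by
  have alive := hpop.reg .alive (by decide)
  have alive' := hpush.reg .alive (by decide)
  have onStack_iff u : OnStack s'' u ↔ OnStack s' u := by
    rw [OnStack, OnStack, hred.sp, hred.stack]
  refine ⟨hred.represents.congr (fun r hr => hpush.reg r (by grind)) hpush.arr, ?_, fun u hu => ?_,
    fun u hu => ?_, ?_⟩
  · rw [h.reducibleTo_iff, alive', ← hred.reducibleTo_iff, alive]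
  · rcases (hpush.onStack_iff u).1 hu with hu | hu
    · exact h.lt_of_onStack u ((hpop.onStack_iff u).2 (.inl ((onStack_iff u).1 hu)))
    · simp only [List.mem_append] at hu
      rcases hu with (hu | hu) | hu
      · exact hred.represents.lt_of_mem_recorded hred.lt.1 hu
      · exact hred.represents.lt_of_mem_recorded hred.lt.2.1 hu
      · exact hred.represents.lt_of_mem_recorded hred.lt.2.2 hu
  · refine (hpush.onStack_iff u).2
      ((hred.active_or_mem_recorded h.represents.isNeighborhood hu).imp_left fun ⟨hu, huv⟩ => ?_)
    exact (onStack_iff u).2 (((hpop.onStack_iff u).1 (h.onStack u hu)).resolve_right huv)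
  · have := h.potential_le
    rw [potential] at this ⊢
    have := hpop.sp
    have := hred.sp
    have := hred.alive_lt
    have := hpush.sp
    simp only [List.length_append, length_recorded] at this
    omega

theorem wp_reduceTop (hM : 14 * n + 12 < E.M) (h : ReduceInv n G₀ s G N) (hsp : 0 < s.reg .sp) :
    wp E reduceTop (fun s' => ∃ G' N', ReduceInv n G₀ s' G' N' ∧ potential s' < potential s) s := by
  refine wp_block_of_wp (wp_pop hsp) fun s₁ hpop => ?_
  have hrep := h.represents.congr (s' := s₁) (fun r hr => hpop.reg r (by grind)) fun f _ => by
    rw [hpop.arr]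
  have hv := h.lt_of_onStack _ ((hpop.onStack_iff _).2 (.inr rfl))
  have hle := h.potential_le
  rw [potential] at hle
  have hsp₁ := hpop.sp
  have alive₁ := hpop.reg .alive (by decide)
  have inactive {s₂ : State} (agree : AgreeOffLocals s₁ s₂) (hact : ¬ Active G (s₁.reg .v)) :
      ∃ G' N', ReduceInv n G₀ s₂ G' N' ∧ potential s₂ < potential s := by
    refine ⟨G, N, h.of_not_active hpop agree hact, ?_⟩
    rw [potential, potential, agree.reg .sp (by decide), agree.reg .alive (by decide), alive₁]
    omega
  rw [wp_block_singleton, wp]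
  refine ⟨by simp [Expr.Safe], fun hdeg => ?_, fun hdeg => ?_⟩
  · simp only [Expr.val, (hrep.stores _ hv).deg, ne_eq, ite_eq_right_iff, one_ne_zero, imp_false,
      not_not] at hdeg
    rw [wp]
    refine wp_mono (wp_attemptAll (by omega) hrep hv hpop.done hdeg) fun s₂ hs₂ => ?_
    rw [wp]
    obtain ⟨agree, hact⟩ | ⟨G', N', hred⟩ := hs₂
    · exact ⟨trivial, fun hdone => absurd ((agree.reg .done (by decide)).trans hpop.done) hdone,
        fun _ => inactive agree hact⟩
    · have sp := hred.sp
      have alive_lt := hred.alive_lt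
      refine ⟨trivial, fun _ => wp_mono (wp_pushReduced (by omega)) fun s₃ hpush =>
        ⟨G', N', h.of_reduced hpop hred hpush, ?_⟩, fun hdone => ?_⟩
      · rw [potential, potential, hpush.sp, hpush.reg .alive (by decide)]
        simp only [List.length_append, length_recorded]
        omega
      · simp [Expr.val, hred.done] at hdone
  · refine inactive ⟨rfl, fun _ _ => rfl⟩ fun hact => ?_
    have hdeg3 := hrep.isNeighborhood.degThree_iff.1 hact.degThree
    simp [Expr.val, (hrep.stores _ hv).deg, hdeg3] at hdeg

end Reduce

open AdjList

/-- Record the input word at the address `ptr` as a further neighbor of the vertex `v`. -/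
def readNeighbor : Prog := block
  [assignMod (.add (.arr .sum .v) (.input .ptr)), .store .sum .v (.reg .tmp),
    .store .deg .v (.add (.arr .deg .v) (.const 1)),
    .assign .ptr (.add (.reg .ptr) (.const 1))]

/-- Store the input word that precedes the address `ptr` by `k` in the array `f`. -/
def storePreceding (f : ArrayName) (k : ℕ) : Prog := block
  [.assign .tmp (.sub (.reg .ptr) (.const k)), .store f .v (.input .tmp)]

/-- After all neighbors of the vertex `v` have been read, record them explicitly if there are
three of them. -/
def storeTriple : Prog :=
  .cond (.eq (.arr .deg .v) (.const 3))
    (block [storePreceding .nb₁ 3, storePreceding .nb₂ 2, storePreceding .nb₃ 1]) .skip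

/-- Put the vertex `v` on the stack and go on with the next vertex. -/
def finishVertex : Prog := block
  [storeTriple, push (.reg .v), .assign .v (.add (.reg .v) (.const 1))]

/-- Read the next neighbor of the vertex `v`, or go on with the next vertex if there is none. -/
def readNext : Prog := block
  [.assign .tmp (.add (.reg .v) (.const 2)),
    .cond (.lt (.reg .ptr) (.input .tmp)) readNeighbor finishVertex]

/-- The input is the encoding of the adjacency lists `L`. -/
structure Encodes {n : ℕ} (E : Env) (L : Fin n → List (Fin n)) : Prop where
  N_eq : E.N = (encode L).length
  input_eq : ∀ a, E.input a = (encode L).getD a 0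

/-- The vertices before the vertex `v` and the first `j` neighbors of `v` have been read. -/
structure ReadInv {n : ℕ} (L : Fin n → List (Fin n)) (s : State) (j : ℕ) : Prop where
  reg_n : s.reg .n = n
  alive : s.reg .alive = n
  dsum : s.reg .dsum = ∑ u ∈ Finset.range n, (neighborList L u).length
  v_le : s.reg .v ≤ n
  le_length : j ≤ (neighborList L (s.reg .v)).length
  ptr : s.reg .ptr = start L (s.reg .v) + j
  sp : s.reg .sp = s.reg .v
  onStack_iff : ∀ u, OnStack s u ↔ u < s.reg .v
  stores : ∀ u < s.reg .v, StoresNeighborhood n s u (neighborList L u).toFinset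
  storesSum : s.reg .v < n →
    StoresSum n s (s.reg .v) ((neighborList L (s.reg .v)).take j).toFinset
  nbs_eq_zero : s.arr .nb₁ (s.reg .v) = 0 ∧ s.arr .nb₂ (s.reg .v) = 0 ∧ s.arr .nb₃ (s.reg .v) = 0
  arr_eq_zero : ∀ f, f ≠ .stack → ∀ u > s.reg .v, s.arr f u = 0

/-- The state `s'` arises from `s` by recording the neighbor `w` of the vertex `v` and advancing
`ptr`. -/
structure NeighborRead (s s' : State) (w : ℕ) : Prop where
  reg : ∀ r, r ≠ .tmp → r ≠ .ptr → s'.reg r = s.reg r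
  ptr : s'.reg .ptr = s.reg .ptr + 1
  deg : s'.arr .deg (s.reg .v) = s.arr .deg (s.reg .v) + 1
  sum : s'.arr .sum (s.reg .v) = (s.arr .sum (s.reg .v) + w) % s.reg .n
  arr : ∀ f u, f ≠ .deg ∧ f ≠ .sum ∨ u ≠ s.reg .v → s'.arr f u = s.arr f u

/-- The number of vertices and neighbors that have not yet been read. -/
def unread (E : Env) (s : State) : ℕ :=
  (s.reg .n - s.reg .v) + (E.N - s.reg .ptr)

section Read

variable {n : ℕ} {L : Fin n → List (Fin n)} {G : SimpleGraph (Fin n)} {E : Env} {s : State} {j : ℕ}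

theorem ReadInv.ptr_add_le (h : ReadInv L s j) (hv : s.reg .v < n) :
    s.reg .ptr + ((neighborList L (s.reg .v)).length - j) ≤ (encode L).length := by
  have := start_mono L hv le_rfl
  rw [start_succ L hv] at this
  have := h.ptr
  have := h.le_length
  rw [length_encode]
  omega

theorem StoresSum.insert {s' : State} {u w : ℕ} {A : Finset ℕ} (h : StoresSum n s u A)
    (hw : w ∉ A) (deg : s'.arr .deg u = s.arr .deg u + 1)
    (sum : s'.arr .sum u = (s.arr .sum u + w) % n) : StoresSum n s' u (insert w A) where
  deg := by rw [deg, h.deg, Finset.card_insert_of_notMem hw]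
  sum := by
    rw [sum, Finset.sum_insert hw, add_comm w]
    exact (Nat.mod_modEq _ _).trans (h.sum.add_right w)
  sum_lt := sum ▸ Nat.mod_lt _ (Nat.zero_lt_of_lt h.sum_lt)

theorem ReadInv.storesSum_succ (hL : AdjList.Represents L G) (h : ReadInv L s j) {s' : State}
    (hv : s.reg .v < n) (hj : j < (neighborList L (s.reg .v)).length)
    (hs' : NeighborRead s s' (neighborList L (s.reg .v))[j]) :
    StoresSum n s' (s.reg .v) ((neighborList L (s.reg .v)).take (j + 1)).toFinset := by
  rw [← List.take_append_getElem hj, List.toFinset_append, Finset.union_comm]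
  refine (h.storesSum hv).insert (fun hmem => ?_) hs'.deg (h.reg_n ▸ hs'.sum)
  obtain ⟨i, hi, hij⟩ := List.mem_take_iff_getElem.1 (List.mem_toFinset.1 hmem)
  have := (hL.nodup_neighborList _).getElem_inj_iff.1 hij
  omega

theorem ReadInv.of_neighborRead (hL : AdjList.Represents L G) (h : ReadInv L s j) {s' : State}
    (hv : s.reg .v < n) (hj : j < (neighborList L (s.reg .v)).length)
    (hs' : NeighborRead s s' (neighborList L (s.reg .v))[j]) : ReadInv L s' (j + 1) := by
  have reg_v : s'.reg .v = s.reg .v := hs'.reg _ (by decide) (by decide)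
  have reg_sp : s'.reg .sp = s.reg .sp := hs'.reg _ (by decide) (by decide)
  have arr_stack i : s'.arr .stack i = s.arr .stack i := hs'.arr _ i (.inl (by decide))
  constructor
  · exact (hs'.reg _ (by decide) (by decide)).trans h.reg_n
  · exact (hs'.reg _ (by decide) (by decide)).trans h.alive
  · exact (hs'.reg _ (by decide) (by decide)).trans h.dsum
  · exact reg_v ▸ h.v_le
  · exact reg_v ▸ hj
  · rw [hs'.ptr, reg_v, h.ptr, add_assoc]
  · rw [reg_sp, reg_v, h.sp]
  · simp only [OnStack, reg_sp, arr_stack, reg_v]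
    exact h.onStack_iff
  · rw [reg_v]
    exact fun u hu => (h.stores u hu).congr fun f _ => hs'.arr f u (.inr hu.ne)
  · rw [reg_v]
    exact fun _ => h.storesSum_succ hL hv hj hs'
  · rw [reg_v, hs'.arr .nb₁ _ (.inl (by decide)), hs'.arr .nb₂ _ (.inl (by decide)),
      hs'.arr .nb₃ _ (.inl (by decide))]
    exact h.nbs_eq_zero
  · rw [reg_v]
    exact fun f hf u hu => (hs'.arr f u (.inr hu.ne')).trans (h.arr_eq_zero f hf u hu)

theorem wp_readNeighbor (hN : s.reg .ptr < E.N) (hn : 2 * s.reg .n ≤ E.M)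
    (hsum : s.arr .sum (s.reg .v) < s.reg .n) (hinput : E.input (s.reg .ptr) < s.reg .n)
    (hdeg : s.arr .deg (s.reg .v) + 1 < E.M) :
    wp E readNeighbor (fun s' => NeighborRead s s' (E.input (s.reg .ptr))) s := by
  have := E.N_lt
  have := E.le_M
  refine wp_block_cons.2 (wp_assignMod ?_ ?_ ⟨trivial, ?_, ?_, ?_⟩)
  · grind [Expr.Safe, Expr.val]
  · grind [Expr.val]
  · grind [Expr.Safe, Expr.val, State.setReg_reg, State.setReg_arr, State.setArr_arr,
      State.setArr_reg]
  · simp only [Expr.Safe, Expr.val, State.setReg_reg, State.setArr_reg, reduceCtorEq, if_false]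
    grind
  · refine ⟨fun r hr hr' => ?_, ?_, ?_, ?_, fun f u hfu => ?_⟩
    · simp [hr, hr']
    · simp [Expr.val]
    · simp [Expr.val]
    · simp [Expr.val]
    · simp only [State.setReg_arr, State.setArr_arr, State.setArr_reg, State.setReg_reg,
        reduceCtorEq, if_false]
      grind

theorem ReadInv.neighborhood_eq (hE : Encodes E L)
    (h : ReadInv L s (neighborList L (s.reg .v)).length) (hv : s.reg .v < n)
    (h3 : (neighborList L (s.reg .v)).length = 3) :
    (neighborList L (s.reg .v)).toFinset =
      {E.input (s.reg .ptr - 3), E.input (s.reg .ptr - 2), E.input (s.reg .ptr - 1)} := by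
  have input_eq j (hj : j < (neighborList L (s.reg .v)).length) :
      E.input (start L (s.reg .v) + j) = (neighborList L (s.reg .v))[j] := by
    rw [hE.input_eq, getD_encode_start_add L hv hj]
  rw [h.ptr, h3]
  change _ = {E.input (start L (s.reg .v) + 0), E.input (start L (s.reg .v) + 1),
    E.input (start L (s.reg .v) + 2)}
  rw [input_eq 0 (by omega), input_eq 1 (by omega), input_eq 2 (by omega)]
  obtain ⟨a, b, c, list_eq⟩ := List.length_eq_three.1 h3
  simp [list_eq]

theorem wp_storePreceding {Q : State → Prop} {f : ArrayName} {k : ℕ} (hk : k < 16)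
    (hN : s.reg .ptr - k < E.N) (hQ : Q ((s.setReg .tmp (s.reg .ptr - k)).setArr f (s.reg .v)
      (E.input (s.reg .ptr - k)))) : wp E (storePreceding f k) Q s :=
  ⟨⟨trivial, hk⟩, by simpa [Expr.Safe, Expr.val] using hN, by simpa [wp, Expr.val] using hQ⟩

theorem wp_storeTriple {A : Finset ℕ} (hsum : StoresSum n s (s.reg .v) A) (hptr : 0 < s.reg .ptr)
    (hN : s.reg .ptr ≤ E.N) (hlt : ∀ w ∈ A, w < n)
    (hA : A.card = 3 →
      A = {E.input (s.reg .ptr - 3), E.input (s.reg .ptr - 2), E.input (s.reg .ptr - 1)})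
    (nbs_eq_zero :
      s.arr .nb₁ (s.reg .v) = 0 ∧ s.arr .nb₂ (s.reg .v) = 0 ∧ s.arr .nb₃ (s.reg .v) = 0) :
    wp E storeTriple (fun s' => AgreeOffVertex (s.reg .v) s s' ∧
      StoresNeighborhood n s' (s.reg .v) A) s := by
  have := hsum.sum_lt
  rw [storeTriple, wp]
  simp only [Expr.val, hsum.deg]
  refine ⟨⟨trivial, show 3 < 16 by decide⟩, fun h3 => ?_, fun h3 => ?_⟩
  · replace hA := hA (by simpa using h3)
    refine wp_block_cons.2 (wp_storePreceding (by decide) (by omega) (wp_block_cons.2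
      (wp_storePreceding (by decide) (by simp; omega) (wp_block_cons.2
      (wp_storePreceding (by decide) (by simp; omega) ?_)))))
    simp only [wp_block_nil, State.setReg_reg, State.setArr_reg, reduceCtorEq, if_false]
    refine ⟨⟨fun r hr => ?_, rfl, fun f i hi => ?_⟩, ⟨?_, ?_, ?_⟩, fun _ => ?_, ?_, ?_, ?_⟩
    · simp [hr]
    · simp [hi]
    · simpa using hsum.deg
    · simpa using hsum.sum
    · simpa using hsum.sum_lt
    · simpa using hA
    all_goals simpa using hlt _ (by simp [hA])
  · replace h3 : A.card ≠ 3 := by simpa using h3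
    refine ⟨⟨fun _ _ => rfl, rfl, fun _ _ _ => rfl⟩, hsum, fun h => absurd h h3, ?_, ?_, ?_⟩
    all_goals omega

theorem ReadInv.next (h : ReadInv L s (neighborList L (s.reg .v)).length) (hv : s.reg .v < n)
    {s' s'' : State} (agree : AgreeOffVertex (s.reg .v) s s')
    (stores : StoresNeighborhood n s' (s.reg .v) (neighborList L (s.reg .v)).toFinset)
    (pushed : Pushed s' s'' [s.reg .v]) : ReadInv L (s''.setReg .v (s.reg .v + 1)) 0 := by
  have reg r (hr : r ≠ .tmp ∧ r ≠ .sp) : s''.reg r = s.reg r :=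
    (pushed.reg r hr.2).trans (agree.reg r hr.1)
  have reg_sp' : s'.reg .sp = s.reg .sp := agree.reg _ (by decide)
  have reg_sp : s''.reg .sp = s.reg .sp + 1 := by rw [pushed.sp, reg_sp', List.length_singleton]
  have arr_eq_zero f (hf : f ≠ .stack) u (hu : u > s.reg .v) : s''.arr f u = 0 := by
    rw [pushed.arr f hf, agree.arr f u hu.ne', h.arr_eq_zero f hf u hu]
  constructor <;> simp only [State.setReg_reg, State.setReg_arr, reduceCtorEq, if_true, if_false]
  · exact (reg _ (by decide)).trans h.reg_n
  · exact (reg _ (by decide)).trans h.alive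
  · exact (reg _ (by decide)).trans h.dsum
  · exact hv
  · exact Nat.zero_le _
  · rw [reg _ (by decide), h.ptr, start_succ L hv, add_zero]
  · rw [reg_sp, h.sp]
  · intro u
    have onStack_iff : OnStack s' u ↔ OnStack s u := by
      simp only [OnStack, reg_sp', agree.stack]
    change OnStack s'' u ↔ _
    rw [pushed.onStack_iff, onStack_iff, h.onStack_iff, List.mem_singleton]
    omega
  · intro u hu
    obtain hu | rfl := Nat.lt_succ_iff_lt_or_eq.1 hu
    · refine (h.stores u hu).congr fun f hf => ?_
      rw [State.setReg_arr, pushed.arr f hf, agree.arr f u hu.ne]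
    · exact stores.congr fun f hf => by rw [State.setReg_arr, pushed.arr f hf]
  · intro hvn
    have zero f (hf : f ≠ .stack) := arr_eq_zero f hf (s.reg .v + 1) (Nat.lt_succ_self _)
    exact ⟨zero .deg (by decide), by simp [zero .sum (by decide), Nat.ModEq.refl],
      by simpa [zero .sum (by decide)] using Nat.zero_lt_of_lt hvn⟩
  · exact ⟨arr_eq_zero _ (by decide) _ (Nat.lt_succ_self _),
      arr_eq_zero _ (by decide) _ (Nat.lt_succ_self _),
      arr_eq_zero _ (by decide) _ (Nat.lt_succ_self _)⟩
  · exact fun f hf u hu => arr_eq_zero f hf u (Nat.lt_of_succ_lt hu)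

theorem wp_finishVertex (hL : AdjList.Represents L G) (hE : Encodes E L)
    (h : ReadInv L s (neighborList L (s.reg .v)).length) (hv : s.reg .v < n) :
    wp E finishVertex (fun s' => ReadInv L s' 0 ∧ unread E s' < unread E s) s := by
  have hsum := h.storesSum hv
  rw [List.take_length] at hsum
  have start_pos : 0 < start L (s.reg .v) := by
    rw [start]
    omega
  have hptr := h.ptr
  have ptr_le := h.ptr_add_le hv
  have N_lt := E.N_lt
  have N_eq := hE.N_eq
  have := add_two_le_length_encode L
  have := h.reg_n
  have := E.le_M
  refine wp_block_of_wp (wp_storeTriple hsum (by omega) (by omega)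
    (fun w hw => lt_of_mem_neighborList L (List.mem_toFinset.1 hw))
    (fun h3 => h.neighborhood_eq hE hv ((hL.card_toFinset_neighborList _).symm.trans h3))
    h.nbs_eq_zero) fun s' ⟨agree, stores⟩ => ?_
  have reg_v' : s'.reg .v = s.reg .v := agree.reg _ (by decide)
  have reg_sp : s'.reg .sp = s.reg .v := (agree.reg _ (by decide)).trans h.sp
  refine wp_block_of_wp (wp_push (by omega) trivial) fun s'' pushed => ?_
  have reg_v : s''.reg .v = s.reg .v := (pushed.reg _ (by decide)).trans reg_v'
  have reg_ptr : s''.reg .ptr = s.reg .ptr :=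
    (pushed.reg _ (by decide)).trans (agree.reg _ (by decide))
  have reg_n : s''.reg .n = s.reg .n :=
    (pushed.reg _ (by decide)).trans (agree.reg _ (by decide))
  simp only [Expr.val, reg_v'] at pushed
  refine wp_block_singleton.2 ⟨⟨trivial, show 1 < 16 by decide, ?_⟩, ?_, ?_⟩
  · simp only [Expr.val]
    omega
  · simpa only [Expr.val, reg_v] using h.next hv agree stores pushed
  · simp only [unread, Expr.val, State.setReg_reg, reduceCtorEq, if_true, if_false]
    omega

theorem ReadInv.setReg_tmp (h : ReadInv L s j) (a : ℕ) : ReadInv L (s.setReg .tmp a) j where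
  reg_n := h.reg_n
  alive := h.alive
  dsum := h.dsum
  v_le := h.v_le
  le_length := h.le_length
  ptr := h.ptr
  sp := h.sp
  onStack_iff := h.onStack_iff
  stores u hu := (h.stores u hu).congr fun _ _ => rfl
  storesSum hv := ⟨(h.storesSum hv).deg, (h.storesSum hv).sum, (h.storesSum hv).sum_lt⟩
  nbs_eq_zero := h.nbs_eq_zero
  arr_eq_zero := h.arr_eq_zero

theorem ReadInv.wp_readNeighbor (hL : AdjList.Represents L G) (hE : Encodes E L)
    (hM : 2 * n + 1 < E.M) (h : ReadInv L s j) (hv : s.reg .v < n)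
    (hj : j < (neighborList L (s.reg .v)).length) :
    wp E readNeighbor (fun s' => ReadInv L s' (j + 1) ∧ unread E s' < unread E s) s := by
  have input_eq : E.input (s.reg .ptr) = (neighborList L (s.reg .v))[j] := by
    rw [hE.input_eq, h.ptr, getD_encode_start_add L hv hj]
  have input_lt : E.input (s.reg .ptr) < n := by
    rw [input_eq]
    exact lt_of_mem_neighborList L (List.getElem_mem hj)
  have ptr_le := h.ptr_add_le hv
  have deg_le : s.arr .deg (s.reg .v) ≤ n := by
    rw [(h.storesSum hv).deg]
    refine (Finset.card_le_card fun w hw => Finset.mem_range.2 ?_).trans (Finset.card_range n).le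
    exact lt_of_mem_neighborList L (List.mem_of_mem_take (List.mem_toFinset.1 hw))
  have reg_n := h.reg_n
  have sum_lt := (h.storesSum hv).sum_lt
  have N_eq := hE.N_eq
  refine wp_mono (ArrayLang.wp_readNeighbor (by omega) (by omega) (by omega) (by omega) (by omega))
    fun s' hs' => ⟨h.of_neighborRead hL hv hj (input_eq ▸ hs'), ?_⟩
  rw [unread, unread, hs'.ptr, hs'.reg .n (by decide) (by decide),
    hs'.reg .v (by decide) (by decide)]
  omega

theorem wp_readNext (hL : AdjList.Represents L G) (hE : Encodes E L) (hM : 2 * n + 1 < E.M)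
    (h : ReadInv L s j) (hv : s.reg .v < n) :
    wp E readNext (fun s' => ∃ j', ReadInv L s' j' ∧ unread E s' < unread E s) s := by
  have length_ge := add_two_le_length_encode L
  have N_eq := hE.N_eq
  have input_eq :
      E.input (s.reg .v + 2) = start L (s.reg .v) + (neighborList L (s.reg .v)).length := by
    rw [hE.input_eq, getD_encode_succ L (Nat.succ_le_of_lt hv), start_succ L hv]
  have ptr := h.ptr
  have le_length := h.le_length
  replace h := h.setReg_tmp (s.reg .v + 2)
  refine ⟨⟨trivial, show 2 < 16 by decide, ?_⟩, ⟨trivial, ?_⟩, fun hlt => ?_, fun hge => ?_⟩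
  · simp only [Expr.val]
    omega
  · simp only [Expr.Safe, Expr.val, State.setReg_reg, if_true]
    omega
  · refine wp_mono (h.wp_readNeighbor hL hE hM hv ?_) fun s' hs' => ⟨_, hs'⟩
    change j < (neighborList L (s.reg .v)).length
    simp only [Expr.val, State.setReg_reg, reduceCtorEq, if_true, if_false, input_eq] at hlt
    grind
  · have hj : j = (neighborList L (s.reg .v)).length := by
      simp only [Expr.val, State.setReg_reg, reduceCtorEq, if_true, if_false, input_eq] at hge
      grind
    subst hj
    exact wp_mono (wp_finishVertex hL hE h hv) fun s' hs' => ⟨0, hs'⟩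

theorem ReadInv.reduceInv (hL : AdjList.Represents L G) (h : ReadInv L s j) (hv : s.reg .v = n) :
    ReduceInv n (G.map Fin.valEmbedding) s (G.map Fin.valEmbedding)
      fun u => (neighborList L u).toFinset where
  represents :=
    { reg_n := h.reg_n
      isNeighborhood := hL.isNeighborhood
      stores u hu := h.stores u (hv ▸ hu)
      dsum := by simp only [h.dsum, hL.card_toFinset_neighborList]
      exists_support_subset := ⟨Finset.range n, subset_rfl, by simp [h.alive],
        support_map_valEmbedding_subset G⟩ }
  reducibleTo_iff := by rw [h.alive]
  lt_of_onStack u hu := hv ▸ (h.onStack_iff u).1 hu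
  onStack u hu := by
    rw [h.onStack_iff, hv]
    by_contra hun
    simpa [neighborList_of_not_lt L hun] using hL.isNeighborhood.degThree_iff.1 hu.degThree
  potential_le := by
    rw [potential, h.sp, h.alive, hv]
    omega

end Read

/-- Read the number of vertices and the sum of the degrees, and initialize the registers. -/
def prep : Prog := block
  [.assign .n (.input .ptr), .assign .tmp (.add (.reg .n) (.const 1)),
    .assign .dsum (.sub (.input .tmp) (.add (.reg .n) (.const 2))),
    .assign .ptr (.add (.reg .n) (.const 2)), .assign .alive (.reg .n)]

/-- The condition that the sum of the degrees exceeds four times the number of vertices. -/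
def dense : Expr := .lt (.add (.add (.reg .n) (.reg .n)) (.add (.reg .n) (.reg .n))) (.reg .dsum)

/-- Output whether the graph is complete on four vertices, provided that no reduction applies. -/
def finish : Prog :=
  .cond (.eq (.reg .alive) (.const 4))
    (.cond (.eq (.reg .dsum) (.const 12)) (.assign .out (.const 1)) (.assign .out (.const 0)))
    (.assign .out (.const 0))

/-- The loop that reads the adjacency lists. -/
def readLoop : Prog := .loop (.lt (.reg .v) (.reg .n)) readNext

/-- The loop that reduces the graph while the stack is not empty. -/
def reduceLoop : Prog := .loop (.reg .sp) reduceTop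

/-- The recognition algorithm for D3-reducible graphs. -/
def recognize : Prog :=
  .seq prep (.cond dense (.assign .out (.const 0)) (.seq readLoop (.seq reduceLoop finish)))

/-- The time for one iteration of `readLoop`. -/
def readTime : ℕ := (Expr.lt (.reg .v) (.reg .n)).compile.cost + 1 + readNext.cost

/-- The time for one iteration of `reduceLoop`. -/
def reduceTime : ℕ := (Expr.reg .sp).compile.cost + 1 + reduceTop.cost

/-- The part of the time of `recognize` that does not depend on the input. -/
def fixedTime : ℕ :=
  prep.cost + (dense.compile.cost + 1) + (Prog.assign .out (.const 0)).cost + readTime +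
    reduceTime + finish.cost

/-- The time of `recognize` per vertex. -/
def vertexTime : ℕ := 5 * readTime + 14 * reduceTime

/-- The state in which all registers and array entries are zero. -/
def State.zero : State := ⟨fun _ => 0, fun _ _ => 0⟩

/-- The word `a` is `1` if `P` holds and `0` otherwise. -/
def IsTruthValue (P : Prop) (a : ℕ) : Prop :=
  (P → a = 1) ∧ (¬ P → a = 0)

section Recognize

variable {n : ℕ} {L : Fin n → List (Fin n)} {G : SimpleGraph (Fin n)} {E : Env} {s : State}

theorem wp_prep (hE : Encodes E L) :
    wp E prep (fun s => ReadInv L s 0 ∧ s.reg .v = 0) State.zero := by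
  have length_ge := add_two_le_length_encode L
  have N_eq := hE.N_eq
  have N_lt := E.N_lt
  have := E.le_M
  have input_zero : E.input 0 = n := hE.input_eq 0
  have input_succ : E.input (n + 1) = start L n := by
    rw [hE.input_eq, getD_encode_succ L le_rfl]
  have start_eq := start_eq_sum L (le_refl n)
  refine ⟨?_, ⟨trivial, ?_⟩, ⟨?_, trivial, ?_⟩, ⟨trivial, ?_⟩, trivial, ?_, rfl⟩
  all_goals simp only [Expr.Safe, Expr.val, State.zero, State.setReg_reg, reduceCtorEq, if_true,
    if_false, input_zero, input_succ]
  · omega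
  · omega
  · omega
  · omega
  · omega
  exact {
    reg_n := rfl
    alive := rfl
    dsum := by
      simp only [State.setReg_reg, reduceCtorEq, if_true, if_false]
      omega
    v_le := Nat.zero_le _
    le_length := Nat.zero_le _
    ptr := by simp [start_zero]
    sp := rfl
    onStack_iff := by simp [OnStack]
    stores _ hu := absurd hu (Nat.not_lt_zero _)
    storesSum hn := ⟨rfl, Nat.ModEq.refl _, hn⟩
    nbs_eq_zero := ⟨rfl, rfl, rfl⟩
    arr_eq_zero _ _ _ _ := rfl }

theorem wp_finish {G₀ G : SimpleGraph ℕ} {N : ℕ → Finset ℕ} (h : ReduceInv n G₀ s G N)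
    (hsp : s.reg .sp = 0) :
    wp E finish (fun s => IsTruthValue (ReducibleTo G₀ n) (s.reg .out)) s := by
  obtain ⟨A, hAn, card_A, hGA⟩ := h.represents.exists_support_subset
  have hN := h.represents.isNeighborhood
  have not_active u (hu : Active G u) : False := by
    obtain ⟨i, hi, -⟩ := h.onStack u hu
    omega
  have reducibleTo_iff : ReducibleTo G₀ n ↔ s.reg .alive = 4 ∧ s.reg .dsum = 12 := by
    rw [h.reducibleTo_iff, h.represents.dsum, hN.sum_card_eq_of_support_subset hGA hAn, ← card_A]
    exact ReducibleTo.iff_of_not_active hN hGA not_active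
  rw [reducibleTo_iff]
  refine ⟨⟨trivial, show 4 < 16 by decide⟩, fun halive => ⟨⟨trivial, show 12 < 16 by decide⟩,
    fun hdsum => ⟨show 1 < 16 by decide, ?_⟩, fun hdsum => ⟨show 0 < 16 by decide, ?_⟩⟩,
    fun halive => ⟨show 0 < 16 by decide, ?_⟩⟩
  all_goals grind [IsTruthValue, Expr.val, State.setReg_reg]

theorem triple_readLoop (hL : AdjList.Represents L G) (hE : Encodes E L) (hM : 2 * n + 1 < E.M) :
    Triple E (fun s => (ReadInv L s 0 ∧ s.reg .v = 0) ∧ s.reg .dsum ≤ 4 * n) readLoop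
      ((5 * n + 1) * readTime) (fun s => ∃ j, ReadInv L s j ∧ s.reg .v = n) := by
  refine (Triple.loop (I := fun s => ∃ j, ReadInv L s j) (unread E) (5 * n)
    ?_ fun b => .of_wp ?_).conseq ?_ le_rfl ?_
  · exact fun _ _ => ⟨trivial, trivial⟩
  · rintro s ⟨⟨j, h⟩, hv, rfl⟩
    refine wp_mono (wp_readNext hL hE hM h ?_) fun s' ⟨j', h', hlt⟩ => ⟨⟨j', h'⟩, hlt⟩
    simpa [Expr.val, h.reg_n] using hv
  · rintro s ⟨⟨h, hv⟩, hdsum⟩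
    refine ⟨⟨0, h⟩, ?_⟩
    have ptr := h.ptr
    have dsum := h.dsum
    have length_eq := length_encode L
    rw [hv, start_zero] at ptr
    rw [start_eq_sum L le_rfl] at length_eq
    rw [unread, h.reg_n, hE.N_eq]
    omega
  · rintro s ⟨⟨j, h⟩, hv⟩
    refine ⟨j, h, h.v_le.antisymm ?_⟩
    simpa [Expr.val, h.reg_n] using hv

theorem triple_reduceLoop {G₀ : SimpleGraph ℕ} (hM : 14 * n + 12 < E.M) :
    Triple E (fun s => ∃ G N, ReduceInv n G₀ s G N) reduceLoop ((14 * n + 1) * reduceTime)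
      (fun s => (∃ G N, ReduceInv n G₀ s G N) ∧ s.reg .sp = 0) := by
  refine (Triple.loop (I := fun s => ∃ G N, ReduceInv n G₀ s G N) potential (14 * n) ?_
    fun b => .of_wp ?_).conseq (fun s ⟨G, N, h⟩ => ⟨⟨G, N, h⟩, h.potential_le⟩) le_rfl fun _ h => h
  · exact fun _ _ => trivial
  · rintro s ⟨⟨G, N, h⟩, hsp, rfl⟩
    exact wp_mono (wp_reduceTop hM h (Nat.pos_of_ne_zero hsp))
      fun s' ⟨G', N', h', hlt⟩ => ⟨⟨G', N', h'⟩, hlt⟩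

theorem ReadInv.dense_val_ne_zero_iff {j : ℕ} (h : ReadInv L s j) :
    dense.val E s ≠ 0 ↔ 4 * n < s.reg .dsum := by
  simp only [dense, Expr.val, h.reg_n, ne_eq, ite_eq_right_iff, one_ne_zero, imp_false, not_not]
  omega

theorem ReadInv.dsum_le {j k : ℕ} (hL : AdjList.Represents L G) (h : ReadInv L s j)
    (hG : ReducibleTo (G.map Fin.valEmbedding) k) : s.reg .dsum ≤ 4 * k := by
  simpa only [h.dsum, hL.card_toFinset_neighborList] using
    hG.sum_card_le hL.isNeighborhood (support_map_valEmbedding_subset G)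

theorem triple_recognize (hL : AdjList.Represents L G) (hE : Encodes E L) (hM : 14 * n + 12 < E.M) :
    Triple E (fun s => s = State.zero) recognize (fixedTime + n * vertexTime)
      (fun s => IsTruthValue (ReducibleTo (G.map Fin.valEmbedding) n) (s.reg .out)) := by
  have prep_triple : Triple E (fun s => s = State.zero) prep prep.cost
      (fun s => ReadInv L s 0 ∧ s.reg .v = 0) := .of_wp fun s hs => hs ▸ wp_prep hE
  have sparse_triple : Triple E (fun s => (ReadInv L s 0 ∧ s.reg .v = 0) ∧ dense.val E s = 0)
      (.seq readLoop (.seq reduceLoop finish))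
      ((5 * n + 1) * readTime + ((14 * n + 1) * reduceTime + finish.cost))
      (fun s => IsTruthValue (ReducibleTo (G.map Fin.valEmbedding) n) (s.reg .out)) := by
    refine ((triple_readLoop hL hE (by omega)).conseq ?_ le_rfl ?_).seq
      ((triple_reduceLoop hM).seq (.of_wp fun s ⟨⟨G', N', h⟩, hsp⟩ => wp_finish h hsp))
    · rintro s ⟨h, hdense⟩
      exact ⟨h, not_lt.1 (h.1.dense_val_ne_zero_iff.not_right.1 hdense)⟩
    · exact fun s ⟨j, h, hv⟩ => ⟨_, _, h.reduceInv hL hv⟩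
  have dense_triple : Triple E (fun s => (ReadInv L s 0 ∧ s.reg .v = 0) ∧ dense.val E s ≠ 0)
      (.assign .out (.const 0)) (Prog.assign .out (.const 0)).cost
      (fun s => IsTruthValue (ReducibleTo (G.map Fin.valEmbedding) n) (s.reg .out)) := by
    refine .assign fun s ⟨⟨h, _⟩, hdense⟩ => ⟨show 0 < 16 by decide, fun hG => ?_, fun _ => rfl⟩
    exact absurd (h.dsum_le hL hG) (not_le.2 (h.dense_val_ne_zero_iff.1 hdense))
  refine (prep_triple.seq (.cond ?_ dense_triple sparse_triple)).conseq (fun _ h => h) ?_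
    fun _ h => h
  · rintro s ⟨h, -⟩
    simp only [dense, Expr.Safe, Expr.val, h.reg_n]
    and_intros <;> first | trivial | omega
  · refine (Nat.add_le_add_left (Nat.add_le_add_left
    (max_le_add_of_nonneg (Nat.zero_le _) (Nat.zero_le _)) _) _).trans_eq ?_
    rw [fixedTime, vertexTime]
    ring

/-- The bounds for an input that consists of the adjacency lists `L`. -/
def env (L : Fin n → List (Fin n)) (W : ℕ) (hW : 1000 * (encode L).length ≤ W) : Env where
  input a := (encode L).getD a 0
  N := (encode L).length
  M := 100 * (encode L).length
  W := W
  N_lt := by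
    have := add_two_le_length_encode L
    omega
  input_lt a _ := by
    have := add_two_le_length_encode L
    have := getD_encode_le L a
    omega
  le_M := by
    have := add_two_le_length_encode L
    omega
  le_W := by
    have := add_two_le_length_encode L
    omega

theorem simulates_zero {W : ℕ} (hW : 1000 * (encode L).length ≤ W) :
    Simulates (env L W hW) { RAM.init (encode L) with
      reg := Function.update (RAM.init (encode L)).reg 0 (encode L).length } State.zero where
  base := Function.update_self 0 (encode L).length (RAM.init (encode L)).reg
  reg r := Function.update_of_ne r.idx_pos.ne' _ _
  arr _ _ := List.getD_eq_default _ _ (Nat.le_add_right _ _)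
  input _ _ := rfl
  reg_lt _ := Nat.zero_lt_of_lt (env L W hW).N_lt
  arr_lt _ _ := Nat.zero_lt_of_lt (env L W hW).N_lt

/-- The machine program: it computes the length of the input, which is the last of the start
addresses, runs the recognition algorithm, and copies the output to register `0`. -/
def machineProg : RAM.Prog :=
  .seq (.assign 0 (.load (.add (.load (.const 0)) (.const 1))))
    (.seq recognize.compile (.assign 0 (.reg Reg.out.idx)))

/-- The constant `c` of the theorem. The summand `1000` provides enough words for the addresses of
the arrays. -/
def timeBound : ℕ := 1000 + fixedTime + vertexTime

theorem exec_assign_length {W : ℕ} (hW : (encode L).length < W) :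
    RAM.Exec W (.assign 0 (.load (.add (.load (.const 0)) (.const 1)))) (RAM.init (encode L)) 6
      { RAM.init (encode L) with
        reg := Function.update (RAM.init (encode L)).reg 0 (encode L).length } := by
  have length_ge := add_two_le_length_encode L
  have mem_zero : (RAM.init (encode L)).mem 0 = n := getD_encode_zero L
  have mem_succ : (RAM.init (encode L)).mem (n + 1) = (encode L).length := by
    rw [length_encode]
    exact getD_encode_succ L le_rfl
  have val_eq : (RAM.Expr.load (.add (.load (.const 0)) (.const 1))).val (RAM.init (encode L)) =
      (encode L).length := by
    simp only [RAM.Expr.val, mem_zero, mem_succ]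
  rw [← val_eq]
  refine .assign 0 _ _ ?_
  simp only [RAM.Expr.Fits, RAM.Expr.val, mem_zero, mem_succ]
  omega

theorem exec_machineProg (hL : AdjList.Represents L G) {W : ℕ}
    (hW : timeBound * (encode L).length ≤ W) :
    ∃ (t : ℕ) (τ : RAM.State), RAM.Exec W machineProg (RAM.init (encode L)) t τ ∧
      t ≤ timeBound * (n + 1) ∧ IsTruthValue (Reducible G) (τ.reg 0) := by
  have length_ge := add_two_le_length_encode L
  have reducible_iff : Reducible G ↔ ReducibleTo (G.map Fin.valEmbedding) n := by
    simpa using reducible_iff_reducibleTo (isSupportEmbedding_map Fin.valEmbedding G)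
  replace hW : 1000 * (encode L).length ≤ W :=
    (Nat.mul_le_mul_right _ (by rw [timeBound, add_assoc]; exact Nat.le_add_right _ _)).trans hW
  have hM : 14 * n + 12 < (env L W hW).M := show 14 * n + 12 < 100 * _ by omega
  obtain ⟨t, τ, s, exec_recognize, ht, hτ, htruth⟩ :=
    triple_recognize hL (E := env L W hW) ⟨rfl, fun _ => rfl⟩ hM _ _ (simulates_zero hW) rfl
  have out_lt : s.reg .out < W := by
    have := hτ.reg_lt .out
    have := (env L W hW).le_W
    change _ + 8 * _ + 8 ≤ W at this
    omega
  refine ⟨_, _, .seq (exec_assign_length (by omega)) (.seq exec_recognize (.assign 0 _ _ ?_)),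
    ?_, ?_⟩
  · simpa only [RAM.Expr.Fits, hτ.reg] using out_lt
  · simp only [timeBound, RAM.Expr.cost]
    linarith [Nat.zero_le (n * fixedTime)]
  · simpa only [RAM.Expr.val, Function.update_self, hτ.reg, reducible_iff] using htruth

end Recognize

end ArrayLang

theorem mainTheorem2 :
    ∃ (prog : RAM.Prog) (c : ℕ),
      ∀ (n : ℕ) (G : SimpleGraph (Fin n)) (L : Fin n → List (Fin n)),
        AdjList.Represents L G →
        ∀ W : ℕ, c * (AdjList.encode L).length ≤ W →
          ∃ (t : ℕ) (τ : RAM.State),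
            RAM.Exec W prog (RAM.init (AdjList.encode L)) t τ ∧
            t ≤ c * (n + 1) ∧
            (D3.Reducible G → τ.reg 0 = 1) ∧
            (¬ D3.Reducible G → τ.reg 0 = 0) := by
  exact ⟨ArrayLang.machineProg, ArrayLang.timeBound, fun n G L hL W hW =>
    ArrayLang.exec_machineProg hL hW⟩
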